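/- Let $1\le q,q'<\infty$ and $M,M'\ge 0$. There is a function $\alpha:[0,\infty)\to[0,\infty)$, depending only on $q,q',M,M'$, with the following property. If $X$ and $Y$ are separable infinite-dimensional (real) Banach lattices with $M_q(X)=M<\infty$ and $M_{q'}(Y)=M'<\infty$, then there is a uniform homeomorphism $F:S(X)\to S(Y)$ between the unit spheres such that $\alpha$ is a modulus of continuity for both $F$ and $F^{-1}$. Here $M_q(X)$, the $q$-concavity constant of $X$, is the smallest constant $C$ such that $$\Big(\sum_{i=1}^n\|x_i\|^q\Big)^{1/q}\le C\,\Big\|\Big(\sum_{i=1}^n|x_i|^q\Big)^{1/q}\Big\|$$ for all $n\in\mathbb N$ and $x_1,\dots,x_n\in X$ (and $M_q(X)=\infty$ if there is none), where $\big(\sum_{i=1}^n|x_i|^q\big)^{1/q}$ is the supremum in $X$ of all $\sum_{i=1}^n a_ix_i$ with $a$ in the unit ball of $\ell_{q^*}^n$, $\frac1q+\frac1{q^*}=1$. A modulus of continuity for a map $F:(A,d_1)\to(B,d_2)$ is a continuous function $\alpha:[0,\infty)\to[0,\infty)$ with $\alpha(0)=0$ and $d_2(F(a_1),F(a_2))\le\alpha(d_1(a_1,a_2))$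 for all $a_1,a_2\in A$. -/

import Mathlib

open scoped NNReal ENNReal

/-- The linear combinations `∑ aᵢ xᵢ` with `a` in the unit ball of `ℓ_{q*}ⁿ`, where `1/q + 1/q* = 1`
(`q* = ∞` if `q = 1`). -/
def dualBallCombinations {X : Type*} [NormedAddCommGroup X] [NormedSpace ℝ X]
    (q : ℝ) {n : ℕ} (x : Fin n → X) : Set X :=
  {y | ∃ a : Fin n → ℝ, ‖WithLp.toLp (ENNReal.conjExponent (ENNReal.ofReal q)) a‖ ≤ 1 ∧
    y = ∑ i, a i • x i}

section
variable {X : Type*} [NormedAddCommGroup X] [NormedSpace ℝ X] [CompleteSpace X]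
  [Lattice X] [IsOrderedAddMonoid X] [HasSolidNorm X] [IsOrderedModule ℝ X]

/-- In a Banach lattice the supremum that defines `(∑ |xᵢ|^q)^{1/q}` exists. -/
theorem exists_isLUB_dualBallCombinations (q : ℝ) {n : ℕ} (x : Fin n → X) :
    ∃ s : X, IsLUB (dualBallCombinations q x) s := by
  set p := ENNReal.conjExponent (ENNReal.ofReal q) with hp
  have : Fact (1 ≤ p) := ⟨by rw [hp, ENNReal.conjExponent]; exact le_self_add⟩
  set K : Set (Fin n → ℝ) := {a | ‖WithLp.toLp p a‖ ≤ 1} with hK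
  set L : (Fin n → ℝ) → X := fun a => ∑ i, a i • x i with hL
  set u : X := ∑ i, |x i| with hu
  have hcomb : dualBallCombinations q x = L '' K := by
    ext y; constructor
    · rintro ⟨a, ha, rfl⟩; exact ⟨a, ha, rfl⟩
    · rintro ⟨a, ha, rfl⟩; exact ⟨a, ha, rfl⟩
  have h0 : (0 : Fin n → ℝ) ∈ K := by simp [hK]
  have hu0 : 0 ≤ u := Finset.sum_nonneg fun i _ => abs_nonneg _
  have hKb : TotallyBounded K := by
    refine TotallyBounded.subset ?_ (isCompact_closedBall (0 : Fin n → ℝ) 1).totallyBounded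
    intro a ha
    rw [mem_closedBall_zero_iff, pi_norm_le_iff_of_nonneg zero_le_one]
    exact fun i => (PiLp.norm_apply_le (WithLp.toLp p a) i).trans ha
  have hLle : ∀ (a b : Fin n → ℝ) (ε : ℝ), dist a b ≤ ε → L a ≤ L b + ε • u := by
    intro a b ε hab
    rw [← sub_le_iff_le_add', hL, hu, Finset.smul_sum]
    simp only [← Finset.sum_sub_distrib, ← sub_smul]
    refine Finset.sum_le_sum fun i _ => ?_
    have h1 : |a i - b i| ≤ ε := (dist_le_pi_dist a b i).trans hab
    have h2 : (a i - b i) • x i ≤ |a i - b i| • |x i| := by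
      rcases le_total 0 (a i - b i) with h | h
      · rw [abs_of_nonneg h]; exact smul_le_smul_of_nonneg_left (le_abs_self _) h
      · rw [abs_of_nonpos h, ← neg_smul_neg (a i - b i) (x i)]
        exact smul_le_smul_of_nonneg_left (neg_le_abs (x i)) (neg_nonneg.2 h)
    exact h2.trans (smul_le_smul_of_nonneg_right h1 (abs_nonneg _))
  have key : ∀ m : ℕ, ∃ y : X, (∀ a ∈ K, L a ≤ y + (1 / ((m : ℝ) + 1)) • u) ∧
      ∀ z ∈ upperBounds (L '' K), y ≤ z := by
    intro m
    obtain ⟨t, htK, htf, ht⟩ := totallyBounded_iff_subset.1 hKb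
      _ (Metric.dist_mem_uniformity (Nat.one_div_pos_of_nat (α := ℝ) (n := m)))
    have htn : htf.toFinset.Nonempty := by
      have := ht h0
      simp only [Set.mem_iUnion] at this
      obtain ⟨b, hb, -⟩ := this
      exact ⟨b, by simpa using hb⟩
    refine ⟨htf.toFinset.sup' htn L, ?_, ?_⟩
    · intro a ha
      have := ht ha
      simp only [Set.mem_iUnion] at this
      obtain ⟨b, hb, hab⟩ := this
      have hab' : dist a b ≤ 1 / ((m : ℝ) + 1) := le_of_lt hab
      exact (hLle a b _ hab').trans
        (add_le_add_left (Finset.le_sup' L (by simpa using hb)) _)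
    · intro z hz
      refine Finset.sup'_le _ _ fun b hb => hz ⟨b, htK (by simpa using hb), rfl⟩
  choose y hy1 hy2 using key
  have hle : ∀ k m, y k ≤ y m + (1 / ((m : ℝ) + 1)) • u := fun k m =>
    hy2 k _ (by rintro _ ⟨a, ha, rfl⟩; exact hy1 m a ha)
  have hnn : ∀ m : ℕ, (0 : ℝ) ≤ 1 / ((m : ℝ) + 1) := fun m => by positivity
  have hanti : ∀ {m k : ℕ}, m ≤ k → (1 / ((k : ℝ) + 1)) ≤ 1 / ((m : ℝ) + 1) := fun h =>
    Nat.one_div_le_one_div h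
  have hlim : Filter.Tendsto (fun m : ℕ => 1 / ((m : ℝ) + 1)) Filter.atTop (nhds 0) :=
    tendsto_one_div_add_atTop_nhds_zero_nat
  have hC : CauchySeq y := by
    refine cauchySeq_of_le_tendsto_0' (fun m : ℕ => (1 / ((m : ℝ) + 1)) * ‖u‖) ?_
      (by simpa using hlim.mul_const ‖u‖)
    intro m k hmk
    rw [dist_eq_norm]
    have h3 : |y m - y k| ≤ |(1 / ((m : ℝ) + 1)) • u| := by
      rw [abs_of_nonneg (smul_nonneg (hnn m) hu0)]
      refine abs_le'.2 ⟨?_, ?_⟩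
      · rw [sub_le_iff_le_add']
        exact (hle m k).trans
          (add_le_add_right (smul_le_smul_of_nonneg_right (hanti hmk) hu0) _)
      · rw [neg_sub, sub_le_iff_le_add']
        exact hle k m
    refine (norm_le_norm_of_abs_le_abs h3).trans ?_
    rw [norm_smul, Real.norm_of_nonneg (hnn m)]
  obtain ⟨s, hs⟩ := cauchySeq_tendsto_of_complete hC
  refine ⟨s, ?_⟩
  rw [hcomb]
  refine ⟨?_, fun z hz => le_of_tendsto' hs fun m => hy2 m z hz⟩
  rintro _ ⟨a, ha, rfl⟩
  refine ge_of_tendsto' (f := fun m : ℕ => y m + (1 / ((m : ℝ) + 1)) • u) (x := Filter.atTop) ?_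
    fun m => hy1 m a ha
  simpa using hs.add (hlim.smul_const u)

/-- The element `(∑ |xᵢ|^q)^{1/q}` of a Banach lattice, for `1 ≤ q < ∞`: the supremum, in the order
of `X`, of all `∑ aᵢ xᵢ` with `a` in the unit ball of `ℓ_{q*}ⁿ`. -/
noncomputable def latticeLqSum (q : ℝ) {n : ℕ} (x : Fin n → X) : X :=
  Classical.choose (exists_isLUB_dualBallCombinations q x)

theorem isLUB_latticeLqSum (q : ℝ) {n : ℕ} (x : Fin n → X) :
    IsLUB (dualBallCombinations q x) (latticeLqSum q x) :=
  Classical.choose_spec (exists_isLUB_dualBallCombinations q x)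

end

/-- `X` satisfies the `q`-concavity inequality with constant `C`. -/
def IsConcaveWith (q : ℝ) (X : Type*) [NormedAddCommGroup X] [NormedSpace ℝ X] [CompleteSpace X]
    [Lattice X] [IsOrderedAddMonoid X] [HasSolidNorm X] [IsOrderedModule ℝ X] (C : ℝ≥0) : Prop :=
  ∀ (n : ℕ) (x : Fin n → X), (∑ i, ‖x i‖ ^ q) ^ (1 / q) ≤ C * ‖latticeLqSum q x‖

/-- The `q`-concavity constant `M_q(X)`; it is `∞` if `X` is not `q`-concave. -/
noncomputable def concavityConstant (q : ℝ) (X : Type*) [NormedAddCommGroup X] [NormedSpace ℝ X]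
    [CompleteSpace X] [Lattice X] [IsOrderedAddMonoid X] [HasSolidNorm X] [IsOrderedModule ℝ X] :
    ℝ≥0∞ :=
  ⨅ (C : ℝ≥0) (_ : IsConcaveWith q X C), (C : ℝ≥0∞)

/-- `f : [0, ∞) → [0, ∞)` is a modulus of continuity for the map `F`. -/
def IsModulusOfContinuity {A B : Type*} [PseudoMetricSpace A] [PseudoMetricSpace B]
    (f : ℝ≥0 → ℝ≥0) (F : A → B) : Prop :=
  Continuous f ∧ f 0 = 0 ∧ ∀ a₁ a₂ : A, nndist (F a₁) (F a₂) ≤ f (nndist a₁ a₂)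

/-!
Both spheres are compared with the unit sphere of `ℓ²`. By Kakutani's theorem a separable Banach
lattice with a quasi-interior unit contains a dense copy of a lattice of continuous functions on a
compact space, and `q`-concavity allows a renorming, equivalent up to the factor `C`, whose
`q`-concavity constant is `1`. For the new norm `N`, every `x` with `N x = 1` is normed by a
probability density `ρ`:
`∫ ρ w ≤ N (x w)` and `N (x w) ^ q ≤ ∫ ρ w ^ q` for all bounded `w ≥ 0`.
The homeomorphism sends `x` to `sign(x) √ρ` in `L²`, which is the generalised Mazur map, `ρ` being
the density at which the entropy functional of Odell and Schlumprecht is maximised.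

Testing the two inequalities on `w = 1 + t 1_B` shows that `‖ρ_x - ρ_y‖₁` is controlled by
`N (x - y)`; testing them on `w = |y / x|` and `w = |x / y|` bounds `N (x - y)` by `‖ρ_x - ρ_y‖₁`.
Both moduli depend only on `q` and `C`. The range is dense: given a bounded density `k`, an almost
maximiser `x` of `∫ k log |x|` over the unit sphere has `ρ_x` close to `k` in `L¹`. As the
vectors `x` are dense in one sphere and their images in the other, the estimates extend the map to
a homeomorphism.
-/

open Filter Topology Pointwise

section OrderUnit

variable {E : Type*} [AddCommGroup E] [Module ℝ E] [Lattice E]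

/-- `u` is an order unit of the vector lattice `E`: every element is dominated by a multiple
of `u ≥ 0`. -/
structure IsOrderUnit (u : E) : Prop where
  nonneg : 0 ≤ u
  exists_abs_le : ∀ x : E, ∃ c : ℝ, |x| ≤ c • u

/-- Sublinear functionals on a vector lattice that preserve finite suprema and are normalised at
`u`. The minimal ones are the lattice homomorphisms, see `isLatticeCharacter_of_minimal`. -/
structure IsMaxSublinear (u : E) (p : E → ℝ) : Prop where
  mono : Monotone p
  add_le : ∀ x y, p (x + y) ≤ p x + p y
  smul : ∀ (c : ℝ) x, 0 ≤ c → p (c • x) = c * p x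
  sup : ∀ x y, p (x ⊔ y) = p x ⊔ p y
  unit : p u = 1
  neg_unit : p (-u) = -1

/-- Real lattice homomorphisms on `E` that take the value `1` at `u`. -/
structure IsLatticeCharacter (u : E) (φ : E → ℝ) : Prop extends IsLinearMap ℝ φ where
  map_sup : ∀ x y, φ (x ⊔ y) = φ x ⊔ φ y
  map_unit : φ u = 1

/-- The localization of `p` at the zero set of `w ≥ 0`: subtracting large multiples of `w` makes
everything outside that set irrelevant for the value of `p`. -/
noncomputable def localization (p : E → ℝ) (w x : E) : ℝ := ⨅ t : ℝ, p (x - t • w)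

/-- The smallest multiple of `u` above `x`, up to an infinitesimal. -/
noncomputable def orderGauge (u x : E) : ℝ := sInf {c : ℝ | x ≤ c • u}

namespace IsMaxSublinear

variable {u : E} {p : E → ℝ}

theorem zero (hp : IsMaxSublinear u p) : p 0 = 0 := by
  simpa using hp.smul 0 0 le_rfl

theorem smul_unit (hp : IsMaxSublinear u p) (c : ℝ) : p (c • u) = c := by
  rcases le_total 0 c with hc | hc
  · rw [hp.smul c u hc, hp.unit, mul_one]
  · have := hp.smul (-c) (-u) (by linarith)
    rw [neg_smul_neg, hp.neg_unit] at this
    linarith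

theorem add_smul_unit (hp : IsMaxSublinear u p) (x : E) (c : ℝ) : p (x + c • u) = p x + c := by
  have hle := hp.add_le x (c • u)
  have hge := hp.add_le (x + c • u) (-c • u)
  rw [neg_smul, add_neg_cancel_right, ← neg_smul] at hge
  rw [hp.smul_unit] at hle hge
  linarith

theorem neg_le (hp : IsMaxSublinear u p) (x : E) : -p (-x) ≤ p x := by
  have := hp.add_le x (-x)
  rw [add_neg_cancel, hp.zero] at this
  linarith

theorem abs_le_of_abs_le (hp : IsMaxSublinear u p) {x : E} {c : ℝ} (hx : |x| ≤ c • u) :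
    |p x| ≤ c := by
  have hle := hp.mono ((le_abs_self x).trans hx)
  have hge := hp.mono ((neg_le_abs x).trans hx)
  rw [hp.smul_unit] at hle hge
  exact abs_le.2 ⟨by linarith [hp.neg_le x], hle⟩

theorem bddBelow_range_apply {ι : Type*} {P : ι → E → ℝ} (hu : IsOrderUnit u)
    (hP : ∀ i, IsMaxSublinear u (P i)) (x : E) : BddBelow (Set.range fun i => P i x) := by
  obtain ⟨c, hc⟩ := hu.exists_abs_le x
  exact ⟨-c, Set.forall_mem_range.2 fun i => (abs_le.1 ((hP i).abs_le_of_abs_le hc)).1⟩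

theorem iInf_of_directed {ι : Type*} [Nonempty ι] {P : ι → E → ℝ}
    (hu : IsOrderUnit u) (hP : ∀ i, IsMaxSublinear u (P i))
    (hdir : Directed (· ≥ ·) P) : IsMaxSublinear u fun x => ⨅ i, P i x := by
  have hbdd : ∀ x, BddBelow (Set.range fun i => P i x) := bddBelow_range_apply hu hP
  have hmono : Monotone fun x => ⨅ i, P i x := fun x y hxy =>
    ciInf_mono (hbdd x) fun i => (hP i).mono hxy
  refine ⟨hmono, fun x y => ?_, fun c x hc => ?_, fun x y => ?_, ?_, ?_⟩
  · refine le_ciInf_add_ciInf fun i j => ?_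
    obtain ⟨k, hki, hkj⟩ := hdir i j
    exact (ciInf_le (hbdd _) k).trans (((hP k).add_le x y).trans (add_le_add (hki x) (hkj y)))
  · simp only [Real.mul_iInf_of_nonneg hc, (hP _).smul c x hc]
  · refine le_antisymm ?_ (sup_le (hmono le_sup_left) (hmono le_sup_right))
    refine le_of_forall_gt_imp_ge_of_dense fun b hb => ?_
    obtain ⟨i, hi⟩ := exists_lt_of_ciInf_lt (le_sup_left.trans_lt hb)
    obtain ⟨j, hj⟩ := exists_lt_of_ciInf_lt (le_sup_right.trans_lt hb)
    obtain ⟨k, hki, hkj⟩ := hdir i j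
    refine (ciInf_le (hbdd _) k).trans ?_
    rw [(hP k).sup]
    exact sup_le ((hki x).trans hi.le) ((hkj y).trans hj.le)
  · simp only [(hP _).unit, ciInf_const]
  · simp only [(hP _).neg_unit, ciInf_const]

theorem exists_minimal_le (hp : IsMaxSublinear u p) (hu : IsOrderUnit u) :
    ∃ m ≤ p, Minimal (IsMaxSublinear u) m := by
  let S : Set (E → ℝ)ᵒᵈ := {p | IsMaxSublinear u (OrderDual.ofDual p)}
  have hchain : ∀ c ⊆ S, IsChain (· ≤ ·) c → ∀ y ∈ c, ∃ b ∈ S, ∀ q ∈ c, q ≤ b := by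
    intro c hc hchain y hy
    have : Nonempty c := ⟨⟨y, hy⟩⟩
    have hP : ∀ i : c, IsMaxSublinear u (OrderDual.ofDual i.1) := fun i => hc i.2
    refine ⟨OrderDual.toDual fun x => ⨅ i : c, OrderDual.ofDual i.1 x,
      iInf_of_directed hu hP fun i j => ?_, fun q hq x =>
        ciInf_le (bddBelow_range_apply hu hP x) (⟨q, hq⟩ : c)⟩
    rcases hchain.total i.2 j.2 with h | h
    · exact ⟨j, h, le_rfl⟩
    · exact ⟨i, le_rfl, h⟩
  obtain ⟨m, hmp, hm⟩ := zorn_le_nonempty₀ S hchain (OrderDual.toDual p) hp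
  exact ⟨OrderDual.ofDual m, hmp, hm⟩

variable {w : E}

theorem neg_smul_eq_zero (hp : IsMaxSublinear u p) (hpw : p (-w) = 0) {t : ℝ} (ht : 0 ≤ t) :
    p (-(t • w)) = 0 := by
  rw [← smul_neg, hp.smul _ _ ht, hpw, mul_zero]

variable [IsOrderedAddMonoid E]

theorem neg_posPart_eq_zero (hp : IsMaxSublinear u p) (x : E) : p (-(p x • u - x)⁺) = 0 := by
  set a := x - p x • u with ha
  have hpa : p a = 0 := by
    have := hp.add_smul_unit x (-p x)
    rw [neg_smul, ← sub_eq_add_neg] at this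
    rw [ha, this, add_neg_cancel]
  have hpa_pos : p (a⁺) = 0 := by
    rw [posPart_def, hp.sup, hpa, hp.zero, sup_idem]
  have hneg_part : (p x • u - x)⁺ = a⁻ := by
    rw [← posPart_neg, ha, neg_sub]
  refine le_antisymm ((hp.mono (neg_nonpos.2 (posPart_nonneg _))).trans_eq hp.zero) ?_
  have := hp.add_le (a⁺) (-a⁻)
  rwa [← sub_eq_add_neg, posPart_sub_negPart, hpa, hpa_pos, zero_add, ← hneg_part] at this

variable [IsOrderedModule ℝ E]

theorem antitone_sub_smul (hp : IsMaxSublinear u p) (hw : 0 ≤ w) (x : E) :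
    Antitone fun t : ℝ => p (x - t • w) := fun _ _ hst =>
  hp.mono (sub_le_sub_left (smul_le_smul_of_nonneg_right hst hw) x)

theorem tendsto_localization (hp : IsMaxSublinear u p) (hw : 0 ≤ w) (hpw : p (-w) = 0) (x : E) :
    Tendsto (fun t : ℝ => p (x - t • w)) atTop (𝓝 (localization p w x)) := by
  refine tendsto_atTop_ciInf (hp.antitone_sub_smul hw x)
    ⟨-p (-x), Set.forall_mem_range.2 fun t => ?_⟩
  refine le_trans ?_ (hp.antitone_sub_smul hw x (le_abs_self t))
  have := hp.add_le (x - |t| • w) (-x)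
  rw [show x - |t| • w + -x = -(|t| • w) by abel, hp.neg_smul_eq_zero hpw (abs_nonneg t)] at this
  linarith

theorem localization_smul_unit (hp : IsMaxSublinear u p) (hw : 0 ≤ w) (hpw : p (-w) = 0) (c : ℝ) :
    localization p w (c • u) = c := by
  refine tendsto_nhds_unique (hp.tendsto_localization hw hpw _) (tendsto_const_nhds.congr' ?_)
  filter_upwards [eventually_ge_atTop 0] with t ht
  rw [sub_eq_neg_add, hp.add_smul_unit, hp.neg_smul_eq_zero hpw ht, zero_add]

theorem localization_le_apply_sub_smul (hp : IsMaxSublinear u p) (hw : 0 ≤ w) (hpw : p (-w) = 0)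
    (x : E) (t : ℝ) : localization p w x ≤ p (x - t • w) :=
  (hp.antitone_sub_smul hw x).le_of_tendsto (hp.tendsto_localization hw hpw x) t

theorem isMaxSublinear_localization (hp : IsMaxSublinear u p) (hw : 0 ≤ w) (hpw : p (-w) = 0) :
    IsMaxSublinear u (localization p w) := by
  have hlim := hp.tendsto_localization hw hpw
  refine ⟨fun x y hxy => ?_, fun x y => ?_, fun c x hc => ?_, fun x y => ?_, ?_, ?_⟩
  · exact le_of_tendsto_of_tendsto' (hlim x) (hlim y) fun t => hp.mono (sub_le_sub_right hxy _)
  · refine le_of_tendsto_of_tendsto' ((hlim (x + y)).comp (tendsto_id.const_mul_atTop two_pos))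
      ((hlim x).add (hlim y)) fun t => ?_
    dsimp only [Function.comp_apply, id]
    rw [two_mul, add_smul, add_sub_add_comm]
    exact hp.add_le _ _
  · rcases hc.eq_or_lt with rfl | hc
    · simpa using hp.localization_smul_unit hw hpw 0
    · refine tendsto_nhds_unique ((hlim (c • x)).comp (tendsto_id.const_mul_atTop hc))
        (((hlim x).const_mul c).congr fun t => ?_)
      rw [← hp.smul c _ hc.le, smul_sub, smul_smul]
      rfl
  · refine tendsto_nhds_unique (hlim (x ⊔ y)) (((hlim x).sup_nhds (hlim y)).congr fun t => ?_)
    rw [← hp.sup, sub_eq_add_neg, sub_eq_add_neg, sub_eq_add_neg, sup_add]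
  · simpa using hp.localization_smul_unit hw hpw 1
  · simpa using hp.localization_smul_unit hw hpw (-1)

theorem localization_posPart_nonpos (hp : IsMaxSublinear u p) {y : E} (hpy : p (-y⁺) = 0) :
    localization p y⁺ y ≤ 0 := by
  refine (hp.localization_le_apply_sub_smul (posPart_nonneg y) hpy y 1).trans ?_
  rw [one_smul, ← hp.zero]
  exact hp.mono (sub_nonpos.2 (le_posPart y))

theorem map_neg_of_minimal (hp : Minimal (IsMaxSublinear u) p) (x : E) : p (-x) = -p x := by
  -- By minimality, localizing at the set where `x` is at least `p x` does not change `p`.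
  set y := p x • u - x with hy
  have hpy : p (-y⁺) = 0 := hp.prop.neg_posPart_eq_zero x
  have hloc : p ≤ localization p y⁺ := hp.2
    (hp.prop.isMaxSublinear_localization (posPart_nonneg y) hpy) fun z => by
      simpa using hp.prop.localization_le_apply_sub_smul (posPart_nonneg y) hpy z 0
  have hle : p y ≤ 0 := (hloc y).trans (hp.prop.localization_posPart_nonpos hpy)
  have := hp.prop.add_smul_unit (-x) (p x)
  rw [neg_add_eq_sub, ← hy] at this
  linarith [hp.prop.neg_le x]

theorem isLatticeCharacter_of_minimal (hp : Minimal (IsMaxSublinear u) p) :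
    IsLatticeCharacter u p := by
  have hneg := map_neg_of_minimal hp
  refine ⟨⟨fun x y => le_antisymm (hp.prop.add_le x y) ?_, fun c x => ?_⟩, hp.prop.sup,
    hp.prop.unit⟩
  · have := hp.prop.add_le (x + y) (-y)
    rw [add_neg_cancel_right, hneg] at this
    linarith
  · rw [smul_eq_mul]
    rcases le_total 0 c with hc | hc
    · exact hp.prop.smul c x hc
    · have := hp.prop.smul (-c) x (by linarith)
      rw [neg_smul, hneg] at this
      linarith

end IsMaxSublinear

namespace IsOrderUnit

variable {u : E}

theorem exists_le_smul (hu : IsOrderUnit u) (x : E) : ∃ c : ℝ, x ≤ c • u :=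
  (hu.exists_abs_le x).imp fun _ hc => (le_abs_self x).trans hc

variable [IsOrderedAddMonoid E] [IsOrderedModule ℝ E]

theorem smul_le_smul_iff (hu : IsOrderUnit u) (hu0 : u ≠ 0) {a b : ℝ} :
    a • u ≤ b • u ↔ a ≤ b := by
  refine ⟨fun h => ?_, fun h => smul_le_smul_of_nonneg_right h hu.nonneg⟩
  by_contra! hba
  have hnonpos : (a - b) • u ≤ 0 := by rwa [sub_smul, sub_nonpos]
  have hnonneg : 0 ≤ (a - b) • u := smul_nonneg (sub_pos.2 hba).le hu.nonneg
  exact smul_ne_zero (sub_pos.2 hba).ne' hu0 (hnonpos.antisymm hnonneg)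

theorem bddBelow_setOf_le_smul (hu : IsOrderUnit u) (hu0 : u ≠ 0) (x : E) :
    BddBelow {c : ℝ | x ≤ c • u} := by
  obtain ⟨c, hc⟩ := hu.exists_abs_le x
  refine ⟨-c, fun a ha => (hu.smul_le_smul_iff hu0).1 ?_⟩
  rw [neg_smul]
  exact (neg_le_neg hc).trans ((neg_le.1 (neg_le_abs x)).trans ha)

theorem le_smul_of_orderGauge_lt (hu : IsOrderUnit u) {x : E} {c : ℝ} (hc : orderGauge u x < c) :
    x ≤ c • u := by
  obtain ⟨a, ha, hac⟩ := exists_lt_of_csInf_lt (hu.exists_le_smul x) hc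
  exact le_trans ha (smul_le_smul_of_nonneg_right hac.le hu.nonneg)

theorem orderGauge_le (hu : IsOrderUnit u) (hu0 : u ≠ 0) {x : E} {c : ℝ} (hc : x ≤ c • u) :
    orderGauge u x ≤ c :=
  csInf_le (hu.bddBelow_setOf_le_smul hu0 x) hc

theorem orderGauge_smul_unit (hu : IsOrderUnit u) (hu0 : u ≠ 0) (c : ℝ) :
    orderGauge u (c • u) = c :=
  IsLeast.csInf_eq ⟨le_rfl, fun _ ha => (hu.smul_le_smul_iff hu0).1 ha⟩

theorem isMaxSublinear_orderGauge (hu : IsOrderUnit u) (hu0 : u ≠ 0) :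
    IsMaxSublinear u (orderGauge u) := by
  have hmono : Monotone (orderGauge u) := fun x y hxy =>
    csInf_le_csInf (hu.bddBelow_setOf_le_smul hu0 x) (hu.exists_le_smul y) fun c hc => hxy.trans hc
  refine ⟨hmono, fun x y => ?_, fun c x hc => ?_, fun x y => ?_, ?_, ?_⟩
  · refine le_of_forall_pos_le_add fun ε hε => ?_
    have hx := hu.le_smul_of_orderGauge_lt (lt_add_of_pos_right (orderGauge u x) (half_pos hε))
    have hy := hu.le_smul_of_orderGauge_lt (lt_add_of_pos_right (orderGauge u y) (half_pos hε))
    refine hu.orderGauge_le hu0 ((add_le_add hx hy).trans_eq ?_)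
    rw [← add_smul]
    congr 1
    ring
  · rcases hc.eq_or_lt with rfl | hc
    · simpa using hu.orderGauge_smul_unit hu0 0
    · have : {a : ℝ | c • x ≤ a • u} = c • {a : ℝ | x ≤ a • u} := by
        ext a
        rw [Set.mem_smul_set_iff_inv_smul_mem₀ hc.ne']
        simp only [Set.mem_ofPred_eq, smul_assoc]
        exact (le_inv_smul_iff_of_pos hc).symm
      rw [orderGauge, this, Real.sInf_smul_of_nonneg hc.le, smul_eq_mul, orderGauge]
  · refine le_antisymm ?_ (sup_le (hmono le_sup_left) (hmono le_sup_right))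
    refine le_of_forall_gt_imp_ge_of_dense fun c hc => hu.orderGauge_le hu0 (sup_le ?_ ?_)
    · exact hu.le_smul_of_orderGauge_lt (le_sup_left.trans_lt hc)
    · exact hu.le_smul_of_orderGauge_lt (le_sup_right.trans_lt hc)
  · simpa using hu.orderGauge_smul_unit hu0 1
  · simpa using hu.orderGauge_smul_unit hu0 (-1)

theorem exists_isLatticeCharacter_orderGauge_le (hu : IsOrderUnit u) (hu0 : u ≠ 0) (x : E) :
    ∃ φ, IsLatticeCharacter u φ ∧ orderGauge u x ≤ φ x := by
  -- Characters below the localization of the gauge at the maximum set of `x` attain that maximum.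
  have hp := hu.isMaxSublinear_orderGauge hu0
  set y := orderGauge u x • u - x with hy
  have hpy : orderGauge u (-y⁺) = 0 := hp.neg_posPart_eq_zero x
  obtain ⟨φ, hφ_le, hφ⟩ :=
    (hp.isMaxSublinear_localization (posPart_nonneg y) hpy).exists_minimal_le hu
  have hchar := IsMaxSublinear.isLatticeCharacter_of_minimal hφ
  refine ⟨φ, hchar, ?_⟩
  have hle : φ y ≤ 0 := (hφ_le y).trans (hp.localization_posPart_nonpos hpy)
  have := hchar.map_add y x
  rw [hy, sub_add_cancel, hφ.prop.smul_unit, ← hy] at this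
  linarith

end IsOrderUnit

end OrderUnit

section Spectrum

variable {E : Type*} [AddCommGroup E] [Module ℝ E] [Lattice E] {u : E}

/-- The space of lattice characters of `E` normalised at `u`, with the topology of pointwise
convergence. -/
abbrev LatticeSpectrum (u : E) : Type _ := {φ : E → ℝ // IsLatticeCharacter u φ}

theorem isClosed_setOf_isLatticeCharacter (u : E) :
    IsClosed {φ : E → ℝ | IsLatticeCharacter u φ} := by
  have hset : {φ : E → ℝ | IsLatticeCharacter u φ} =
      {φ | ∀ x y, φ (x + y) = φ x + φ y} ∩ {φ | ∀ (c : ℝ) x, φ (c • x) = c • φ x} ∩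
        {φ | ∀ x y, φ (x ⊔ y) = φ x ⊔ φ y} ∩ {φ | φ u = 1} := by
    ext φ
    exact ⟨fun h => ⟨⟨⟨h.map_add, h.map_smul⟩, h.map_sup⟩, h.map_unit⟩,
      fun h => ⟨⟨h.1.1.1, h.1.1.2⟩, h.1.2, h.2⟩⟩
  simp only [hset, Set.ofPred_forall]
  refine IsClosed.inter (IsClosed.inter (IsClosed.inter ?_ ?_) ?_) ?_
  · exact isClosed_iInter fun x => isClosed_iInter fun y => isClosed_eq (by fun_prop) (by fun_prop)
  · exact isClosed_iInter fun c => isClosed_iInter fun x => isClosed_eq (by fun_prop) (by fun_prop)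
  · exact isClosed_iInter fun x => isClosed_iInter fun y =>
      isClosed_eq (by fun_prop) ((continuous_apply x).sup (continuous_apply y))
  · exact isClosed_eq (by fun_prop) continuous_const

theorem IsLatticeCharacter.monotone {φ : E → ℝ} (hφ : IsLatticeCharacter u φ) : Monotone φ :=
  fun x y h => by
    rw [← sup_eq_right.2 h, hφ.map_sup]
    exact le_sup_left

theorem IsOrderUnit.compactSpace_latticeSpectrum (hu : IsOrderUnit u) :
    CompactSpace (LatticeSpectrum u) := by
  choose c hc using hu.exists_abs_le
  refine isCompact_iff_compactSpace.1 <|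
    (isCompact_univ_pi fun x => isCompact_Icc (a := -c x) (b := c x)).of_isClosed_subset
      (isClosed_setOf_isLatticeCharacter u) fun φ hφ x _ => ?_
  have hle := hφ.monotone ((le_abs_self x).trans (hc x))
  have hge := hφ.monotone ((neg_le_abs x).trans (hc x))
  rw [hφ.map_smul, hφ.map_unit, smul_eq_mul, mul_one] at hle hge
  rw [hφ.map_neg] at hge
  exact ⟨neg_le.1 hge, hle⟩

/-- The Kakutani representation: evaluation of the elements of `E` at the lattice characters. -/
def latticeEval (u : E) : E →ₗ[ℝ] C(LatticeSpectrum u, ℝ) where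
  toFun x := ⟨fun φ => φ.1 x, (continuous_apply x).comp continuous_subtype_val⟩
  map_add' x y := by ext φ; exact φ.2.map_add x y
  map_smul' c x := by ext φ; exact φ.2.map_smul c x

theorem latticeEval_apply (x : E) (φ : LatticeSpectrum u) : latticeEval u x φ = φ.1 x := rfl

theorem latticeEval_unit : latticeEval u u = 1 := by
  ext φ; exact φ.2.map_unit

theorem latticeEval_sup (x y : E) :
    latticeEval u (x ⊔ y) = latticeEval u x ⊔ latticeEval u y := by
  ext φ; exact φ.2.map_sup x y

theorem latticeEval_abs (x : E) : latticeEval u |x| = |latticeEval u x| := by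
  rw [abs, abs, latticeEval_sup, map_neg]

theorem separatesPointsStrongly_range_latticeEval (u : E) :
    (Set.range (latticeEval u)).SeparatesPointsStrongly := by
  intro v φ ψ
  by_cases h : φ = ψ
  · subst h
    refine ⟨_, ⟨v φ • u, rfl⟩, ?_⟩
    simp [latticeEval_unit]
  · obtain ⟨x, hx⟩ : ∃ x, φ.1 x ≠ ψ.1 x := Function.ne_iff.1 fun h' => h (Subtype.ext h')
    set a := (v φ - v ψ) / (φ.1 x - ψ.1 x)
    have ha : a * (φ.1 x - ψ.1 x) = v φ - v ψ := div_mul_cancel₀ _ (sub_ne_zero.2 hx)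
    refine ⟨_, ⟨a • x + (v φ - a * φ.1 x) • u, rfl⟩, ?_, ?_⟩
    · simp [latticeEval_unit, latticeEval_apply]
    · simp only [map_add, map_smul, latticeEval_unit, ContinuousMap.add_apply,
        ContinuousMap.smul_apply, latticeEval_apply, ContinuousMap.one_apply, smul_eq_mul, mul_one]
      linarith

variable [IsOrderedAddMonoid E]

theorem latticeEval_inf (x y : E) :
    latticeEval u (x ⊓ y) = latticeEval u x ⊓ latticeEval u y := by
  rw [← neg_neg (x ⊓ y), neg_inf, map_neg, latticeEval_sup, map_neg, map_neg, neg_sup, neg_neg,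
    neg_neg]

theorem IsOrderUnit.denseRange_latticeEval (hu : IsOrderUnit u) : DenseRange (latticeEval u) := by
  have := hu.compactSpace_latticeSpectrum
  rw [DenseRange, dense_iff_closure_eq]
  refine ContinuousMap.sublattice_closure_eq_top _ ⟨_, 0, rfl⟩ ?_ ?_
    (separatesPointsStrongly_range_latticeEval u)
  · rintro _ ⟨x, rfl⟩ _ ⟨y, rfl⟩
    exact ⟨x ⊓ y, latticeEval_inf x y⟩
  · rintro _ ⟨x, rfl⟩ _ ⟨y, rfl⟩
    exact ⟨x ⊔ y, latticeEval_sup x y⟩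

theorem IsOrderUnit.abs_le_norm_latticeEval_smul [IsOrderedModule ℝ E]
    [CompactSpace (LatticeSpectrum u)] (hu : IsOrderUnit u) (hu0 : u ≠ 0) (x : E) {c : ℝ}
    (hc : ‖latticeEval u x‖ < c) : |x| ≤ c • u := by
  obtain ⟨φ, hφ, hle⟩ := hu.exists_isLatticeCharacter_orderGauge_le hu0 |x|
  refine hu.le_smul_of_orderGauge_lt ((hle.trans ?_).trans_lt hc)
  calc φ |x| = |latticeEval u x| ⟨φ, hφ⟩ := by rw [← latticeEval_abs, latticeEval_apply]
    _ = ‖latticeEval u x ⟨φ, hφ⟩‖ := by rw [ContinuousMap.abs_apply, Real.norm_eq_abs]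
    _ ≤ ‖latticeEval u x‖ := (latticeEval u x).norm_coe_le_norm ⟨φ, hφ⟩

end Spectrum

section OrderIdeal

variable {E : Type*} [AddCommGroup E] [Module ℝ E] [Lattice E] [IsOrderedModule ℝ E]

theorem abs_smul_le_abs_smul_abs (a : ℝ) (x : E) : |a • x| ≤ |a| • |x| := by
  have hpos : ∀ {c : ℝ}, 0 ≤ c → |c • x| ≤ c • |x| := fun {c} hc => by
    refine abs_le'.2 ⟨smul_le_smul_of_nonneg_left (le_abs_self x) hc, ?_⟩
    rw [← smul_neg]
    exact smul_le_smul_of_nonneg_left (neg_le_abs x) hc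
  rcases le_total 0 a with ha | ha
  · rw [abs_of_nonneg ha]
    exact hpos ha
  · rw [abs_of_nonpos ha, ← abs_neg (a • x), ← neg_smul]
    exact hpos (neg_nonneg.2 ha)

theorem abs_smul_eq_smul_abs {c : ℝ} (hc : 0 < c) (x : E) : |c • x| = c • |x| := by
  refine le_antisymm ?_ ?_
  · simpa only [abs_of_pos hc] using abs_smul_le_abs_smul_abs c x
  · rw [← le_inv_smul_iff_of_pos hc]
    simpa only [abs_of_pos (inv_pos.2 hc), inv_smul_smul₀ hc.ne'] using
      abs_smul_le_abs_smul_abs c⁻¹ (c • x)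

variable [IsOrderedAddMonoid E]

/-- The order ideal generated by `u ≥ 0`, the largest sublattice with order unit `u`. -/
def orderIdeal (u : E) : Submodule ℝ E where
  carrier := {x | ∃ c : ℝ, |x| ≤ c • u}
  add_mem' := by
    rintro x y ⟨a, ha⟩ ⟨b, hb⟩
    exact ⟨a + b, (abs_add_le x y).trans ((add_le_add ha hb).trans_eq (add_smul a b u).symm)⟩
  zero_mem' := ⟨0, by simp⟩
  smul_mem' := by
    rintro c x ⟨a, ha⟩
    refine ⟨|c| * a, (abs_smul_le_abs_smul_abs c x).trans ?_⟩
    rw [mul_smul]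
    exact smul_le_smul_of_nonneg_left ha (abs_nonneg c)

namespace orderIdeal

variable {u x y : E}

theorem abs_mem (hx : x ∈ orderIdeal u) : |x| ∈ orderIdeal u := by
  obtain ⟨c, hc⟩ := hx
  exact ⟨c, by rwa [abs_abs]⟩

theorem sup_mem (hx : x ∈ orderIdeal u) (hy : y ∈ orderIdeal u) : x ⊔ y ∈ orderIdeal u := by
  rw [sup_eq_half_smul_add_add_abs_sub' ℝ]
  exact Submodule.smul_mem _ _ (add_mem (add_mem hx hy) (abs_mem (sub_mem hy hx)))

theorem inf_mem (hx : x ∈ orderIdeal u) (hy : y ∈ orderIdeal u) : x ⊓ y ∈ orderIdeal u := by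
  rw [inf_eq_half_smul_add_sub_abs_sub' ℝ]
  exact Submodule.smul_mem _ _ (sub_mem (add_mem hx hy) (abs_mem (sub_mem hy hx)))

instance instLattice (u : E) : Lattice (orderIdeal u) :=
  Subtype.lattice (fun _ _ => sup_mem) (fun _ _ => inf_mem)

instance instIsOrderedAddMonoid (u : E) : IsOrderedAddMonoid (orderIdeal u) where
  add_le_add_left a b h c := add_le_add_left (show (a : E) ≤ b from h) (c : E)

instance instIsOrderedModule (u : E) : IsOrderedModule ℝ (orderIdeal u) where
  smul_le_smul_of_nonneg_left _ hc a b h :=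
    show _ • (a : E) ≤ _ • (b : E) from smul_le_smul_of_nonneg_left (show (a : E) ≤ b from h) hc
  smul_le_smul_of_nonneg_right a ha _ _ h :=
    show _ • (a : E) ≤ _ • (a : E) from smul_le_smul_of_nonneg_right h (show (0 : E) ≤ a from ha)

theorem self_mem (hu : 0 ≤ u) : u ∈ orderIdeal u := ⟨1, by rw [abs_of_nonneg hu, one_smul]⟩

theorem isOrderUnit (hu : 0 ≤ u) : IsOrderUnit (⟨u, self_mem hu⟩ : orderIdeal u) :=
  ⟨hu, fun x => x.2⟩

end orderIdeal

end OrderIdeal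

section Representation

variable {X : Type*} [NormedAddCommGroup X] [NormedSpace ℝ X] [Lattice X] [HasSolidNorm X]

theorem norm_le_of_abs_le_smul {u x : X} {c : ℝ} (h : |x| ≤ c • u) : ‖x‖ ≤ |c| * ‖u‖ := by
  rw [← Real.norm_eq_abs, ← norm_smul]
  exact norm_le_norm_of_abs_le_abs (h.trans (le_abs_self _))

variable [IsOrderedAddMonoid X] [IsOrderedModule ℝ X]

theorem exists_dense_orderIdeal (X : Type*) [NormedAddCommGroup X] [NormedSpace ℝ X]
    [CompleteSpace X] [Lattice X] [IsOrderedAddMonoid X] [HasSolidNorm X] [IsOrderedModule ℝ X]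
    [TopologicalSpace.SeparableSpace X] : ∃ u : X, 0 ≤ u ∧ Dense (orderIdeal u : Set X) := by
  set d := TopologicalSpace.denseSeq X
  set c : ℕ → ℝ := fun n => (1 / 2) ^ n * (1 + ‖d n‖)⁻¹ with hc
  have hcpos : ∀ n, 0 < c n := fun n => by positivity
  have hsum : Summable fun n => c n • |d n| := by
    refine Summable.of_norm_bounded summable_geometric_two fun n => ?_
    rw [norm_smul, norm_abs_eq_norm, Real.norm_of_nonneg (hcpos n).le, hc, mul_assoc]
    refine mul_le_of_le_one_right (by positivity) ?_
    rw [inv_mul_le_iff₀ (by positivity)]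
    linarith
  have hnonneg : ∀ n, 0 ≤ c n • |d n| := fun n => smul_nonneg (hcpos n).le (abs_nonneg _)
  refine ⟨∑' n, c n • |d n|, tsum_nonneg hnonneg,
    (TopologicalSpace.denseRange_denseSeq X).mono ?_⟩
  rintro _ ⟨n, rfl⟩
  refine ⟨(c n)⁻¹, ?_⟩
  rw [le_inv_smul_iff_of_pos (hcpos n)]
  exact hsum.le_tsum n fun j _ => hnonneg j

theorem orderIdeal_zero : (orderIdeal (0 : X) : Set X) = {0} := by
  ext x
  refine ⟨fun ⟨c, hc⟩ => norm_le_zero_iff.1 ?_, ?_⟩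
  · simpa using norm_le_of_abs_le_smul hc
  · rintro rfl
    exact zero_mem _

theorem norm_le_norm_latticeEval {u : X} (hu : 0 ≤ u) (hu0 : u ≠ 0)
    [CompactSpace (LatticeSpectrum (⟨u, orderIdeal.self_mem hu⟩ : orderIdeal u))]
    (x : orderIdeal u) :
    ‖(x : X)‖ ≤ ‖u‖ * ‖latticeEval (⟨u, orderIdeal.self_mem hu⟩ : orderIdeal u) x‖ := by
  rw [mul_comm, ← div_le_iff₀ (norm_pos_iff.2 hu0)]
  refine le_of_forall_gt_imp_ge_of_dense fun c hc => ?_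
  rw [div_le_iff₀ (norm_pos_iff.2 hu0), ← abs_of_nonneg ((norm_nonneg _).trans hc.le)]
  have hx := (orderIdeal.isOrderUnit hu).abs_le_norm_latticeEval_smul
    (fun h => hu0 (congrArg Subtype.val h)) x hc
  exact norm_le_of_abs_le_smul (show |(x : X)| ≤ c • u from hx)

theorem continuous_abs_continuousMap {K : Type*} [TopologicalSpace K] [CompactSpace K] :
    Continuous fun f : C(K, ℝ) => |f| := by
  refine LipschitzWith.continuous (K := 1) <| LipschitzWith.of_dist_le_mul fun f g => ?_
  rw [NNReal.coe_one, one_mul]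
  refine (ContinuousMap.dist_le dist_nonneg).2 fun k => ?_
  rw [ContinuousMap.abs_apply, ContinuousMap.abs_apply]
  exact (abs_abs_sub_abs_le (f k) (g k)).trans (f.dist_apply_le_dist (g := g) k)

theorem exists_continuousMap_latticeHom.{u} (X : Type u) [NormedAddCommGroup X] [NormedSpace ℝ X]
    [CompleteSpace X] [Lattice X] [IsOrderedAddMonoid X] [HasSolidNorm X] [IsOrderedModule ℝ X]
    [TopologicalSpace.SeparableSpace X] [Nontrivial X] :
    ∃ (K : Type u) (_ : TopologicalSpace K) (_ : CompactSpace K) (_ : T2Space K)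
      (T : C(K, ℝ) →L[ℝ] X), (∀ f, T |f| = |T f|) ∧ DenseRange T := by
  obtain ⟨u, hu, hdense⟩ := exists_dense_orderIdeal X
  have hu0 : u ≠ 0 := by
    rintro rfl
    rw [orderIdeal_zero] at hdense
    obtain ⟨x, hx⟩ := exists_ne (0 : X)
    exact hx (by simpa using hdense x)
  set e : orderIdeal u := ⟨u, orderIdeal.self_mem hu⟩
  have hK := (orderIdeal.isOrderUnit hu).compactSpace_latticeSpectrum
  have hrange := (orderIdeal.isOrderUnit hu).denseRange_latticeEval
  -- `T` extends the inverse of `latticeEval e` from its dense range.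
  let T := (orderIdeal u).subtype.extendOfNorm (latticeEval e)
  have hTe : ∀ x : orderIdeal u, T (latticeEval e x) = x :=
    LinearMap.extendOfNorm_eq hrange ⟨‖u‖, fun x => norm_le_norm_latticeEval hu hu0 x⟩
  refine ⟨LatticeSpectrum e, inferInstance, hK, inferInstance, T, fun f => ?_, ?_⟩
  · refine hrange.induction_on f (isClosed_eq (T.continuous.comp continuous_abs_continuousMap)
      (T.continuous.sup T.continuous.neg)) fun x => ?_
    rw [← latticeEval_abs, hTe, hTe]
    rfl
  · exact hdense.mono fun x hx => ⟨latticeEval e ⟨x, hx⟩, hTe _⟩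

end Representation

section ConcaveNorm

variable {Ω X : Type*} [NormedAddCommGroup X]

theorem rpow_sum_norm_add_le {ι : Type*} [Fintype ι] {q : ℝ} (hq : 1 ≤ q) (x y : ι → X) :
    (∑ i, ‖x i + y i‖ ^ q) ^ (1 / q) ≤
      (∑ i, ‖x i‖ ^ q) ^ (1 / q) + (∑ i, ‖y i‖ ^ q) ^ (1 / q) := by
  refine le_trans ?_ (Real.Lp_add_le_of_nonneg Finset.univ hq (fun i _ => norm_nonneg (x i))
    fun i _ => norm_nonneg (y i))
  gcongr with i
  exact norm_add_le _ _

theorem sum_abs_mul_div_rpow_le {ι : Type*} [Fintype ι] {q : ℝ} {k : ι → ℝ} {d : ℝ} (hd : 0 < d)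
    (hk : ∑ i, |k i| ^ q ≤ d ^ q) (c : ℝ) : ∑ i, |k i * (c / d)| ^ q ≤ |c| ^ q := by
  have hfactor : ∀ i, |k i * (c / d)| ^ q = |k i| ^ q * (|c| ^ q / d ^ q) := fun i => by
    rw [abs_mul, abs_div, abs_of_pos hd, Real.mul_rpow (abs_nonneg _) (by positivity),
      Real.div_rpow (abs_nonneg _) hd.le]
  simp only [hfactor, ← Finset.sum_mul]
  calc (∑ i, |k i| ^ q) * (|c| ^ q / d ^ q) ≤ d ^ q * (|c| ^ q / d ^ q) := by gcongr
    _ = |c| ^ q := mul_div_cancel₀ _ (by positivity)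

variable [NormedSpace ℝ X]

/-- A linear map `T` on a space `A` of bounded functions, closed under continuous operations, such
that `f ↦ ‖T f‖` is a `q`-concave lattice seminorm with constant `C`. Only the values of `T` on `A`
matter. -/
structure IsConcaveRep (A : Submodule ℝ (Ω → ℝ)) (T : (Ω → ℝ) →ₗ[ℝ] X) (q C : ℝ) : Prop where
  comp : ∀ f ∈ A, ∀ g ∈ A, ∀ Φ : ℝ → ℝ → ℝ, Continuous (Function.uncurry Φ) →
    (fun ω => Φ (f ω) (g ω)) ∈ A
  bdd : ∀ f ∈ A, ∃ c : ℝ, ∀ ω, |f ω| ≤ c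
  one_le_q : 1 ≤ q
  one_le_C : 1 ≤ C
  mono : ∀ f ∈ A, ∀ g ∈ A, (∀ ω, |f ω| ≤ |g ω|) → ‖T f‖ ≤ ‖T g‖
  concave : ∀ (n : ℕ) (g : Fin n → Ω → ℝ), (∀ i, g i ∈ A) → ∀ f ∈ A,
    (∀ ω, ∑ i, |g i ω| ^ q ≤ |f ω| ^ q) → ∑ i, ‖T (g i)‖ ^ q ≤ (C * ‖T f‖) ^ q

/-- The sums whose supremum is the `q`-th power of the renorming `concaveNorm`. -/
def concaveSums (A : Submodule ℝ (Ω → ℝ)) (T : (Ω → ℝ) →ₗ[ℝ] X) (q : ℝ) (f : Ω → ℝ) : Set ℝ :=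
  {r | ∃ (n : ℕ) (g : Fin n → Ω → ℝ), (∀ i, g i ∈ A) ∧ (∀ ω, ∑ i, |g i ω| ^ q ≤ |f ω| ^ q) ∧
    r = ∑ i, ‖T (g i)‖ ^ q}

/-- A norm equivalent to `f ↦ ‖T f‖` whose `q`-concavity constant is `1`. -/
noncomputable def concaveNorm (A : Submodule ℝ (Ω → ℝ)) (T : (Ω → ℝ) →ₗ[ℝ] X) (q : ℝ)
    (f : Ω → ℝ) : ℝ :=
  sSup (concaveSums A T q f) ^ (1 / q)

variable {A : Submodule ℝ (Ω → ℝ)} {T : (Ω → ℝ) →ₗ[ℝ] X} {q C : ℝ} {f g : Ω → ℝ}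

theorem zero_mem_concaveSums (A : Submodule ℝ (Ω → ℝ)) (T : (Ω → ℝ) →ₗ[ℝ] X) (q : ℝ)
    (f : Ω → ℝ) : 0 ∈ concaveSums A T q f :=
  ⟨0, Fin.elim0, fun i => i.elim0, fun ω => by simpa using Real.rpow_nonneg (abs_nonneg _) q,
    by simp⟩

theorem sSup_concaveSums_nonneg : 0 ≤ sSup (concaveSums A T q f) :=
  Real.sSup_nonneg <| by rintro _ ⟨n, g, -, -, rfl⟩; positivity

theorem concaveNorm_nonneg : 0 ≤ concaveNorm A T q f :=
  Real.rpow_nonneg sSup_concaveSums_nonneg _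

theorem concaveNorm_rpow (hq : 0 < q) :
    concaveNorm A T q f ^ q = sSup (concaveSums A T q f) := by
  rw [concaveNorm, one_div, Real.rpow_inv_rpow sSup_concaveSums_nonneg hq.ne']

theorem concaveNorm_le_of_forall_sum_le (hq : 0 < q) {c : ℝ} (hc : 0 ≤ c)
    (hle : ∀ (n : ℕ) (g : Fin n → Ω → ℝ), (∀ i, g i ∈ A) →
      (∀ ω, ∑ i, |g i ω| ^ q ≤ |f ω| ^ q) → ∑ i, ‖T (g i)‖ ^ q ≤ c ^ q) :
    concaveNorm A T q f ≤ c := by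
  rw [← Real.rpow_le_rpow_iff concaveNorm_nonneg hc hq, concaveNorm_rpow hq]
  refine csSup_le ⟨0, zero_mem_concaveSums A T q f⟩ ?_
  rintro _ ⟨n, g, hg, hgf, rfl⟩
  exact hle n g hg hgf

namespace IsConcaveRep

theorem q_pos (h : IsConcaveRep A T q C) : 0 < q := zero_lt_one.trans_le h.one_le_q

theorem comp_one (h : IsConcaveRep A T q C) (hf : f ∈ A) {Φ : ℝ → ℝ} (hΦ : Continuous Φ) :
    (fun ω => Φ (f ω)) ∈ A :=
  h.comp f hf f hf (fun a _ => Φ a) (by fun_prop)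

theorem const_mem (h : IsConcaveRep A T q C) (c : ℝ) : (fun _ => c) ∈ A :=
  h.comp_one A.zero_mem (Φ := fun _ => c) continuous_const

theorem abs_mem (h : IsConcaveRep A T q C) (hf : f ∈ A) : (fun ω => |f ω|) ∈ A :=
  h.comp_one hf continuous_abs

theorem mul_mem (h : IsConcaveRep A T q C) (hf : f ∈ A) (hg : g ∈ A) : f * g ∈ A :=
  h.comp f hf g hg (fun a b => a * b) (by fun_prop)

theorem div_mem (h : IsConcaveRep A T q C) (hf : f ∈ A) (hg : g ∈ A) {ε : ℝ} (hε : 0 < ε)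
    (hle : ∀ ω, ε ≤ g ω) : (fun ω => f ω / g ω) ∈ A := by
  have := h.comp f hf g hg (fun a b => a / max b ε)
    (continuous_fst.div₀ (continuous_snd.max continuous_const) fun p =>
      (hε.trans_le (le_max_right _ _)).ne')
  simpa only [max_eq_left (hle _)] using this

theorem rpow_mem (h : IsConcaveRep A T q C) (hf : f ∈ A) {r : ℝ} (hr : 0 ≤ r) :
    (fun ω => f ω ^ r) ∈ A :=
  h.comp_one hf (Φ := fun a => a ^ r) (Real.continuous_rpow_const hr)

theorem bddAbove_concaveSums (h : IsConcaveRep A T q C) (hf : f ∈ A) :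
    BddAbove (concaveSums A T q f) :=
  ⟨(C * ‖T f‖) ^ q, by rintro _ ⟨n, g, hg, hle, rfl⟩; exact h.concave n g hg f hf hle⟩

theorem sum_le_concaveNorm_rpow (h : IsConcaveRep A T q C) (hf : f ∈ A) {n : ℕ}
    {g : Fin n → Ω → ℝ} (hg : ∀ i, g i ∈ A) (hle : ∀ ω, ∑ i, |g i ω| ^ q ≤ |f ω| ^ q) :
    ∑ i, ‖T (g i)‖ ^ q ≤ concaveNorm A T q f ^ q := by
  rw [concaveNorm_rpow h.q_pos]
  exact le_csSup (h.bddAbove_concaveSums hf) ⟨n, g, hg, hle, rfl⟩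

theorem concaveNorm_le (h : IsConcaveRep A T q C) (hf : f ∈ A) :
    concaveNorm A T q f ≤ C * ‖T f‖ :=
  concaveNorm_le_of_forall_sum_le h.q_pos
    (mul_nonneg (zero_le_one.trans h.one_le_C) (norm_nonneg _)) fun n g hg hle =>
      h.concave n g hg f hf hle

theorem le_concaveNorm (h : IsConcaveRep A T q C) (hf : f ∈ A) : ‖T f‖ ≤ concaveNorm A T q f := by
  rw [← Real.rpow_le_rpow_iff (norm_nonneg _) concaveNorm_nonneg h.q_pos]
  simpa using h.sum_le_concaveNorm_rpow hf (n := 1) (g := fun _ => f) (fun _ => hf) (by simp)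

theorem concaveNorm_mono (h : IsConcaveRep A T q C) (hg : g ∈ A) (hle : ∀ ω, |f ω| ≤ |g ω|) :
    concaveNorm A T q f ≤ concaveNorm A T q g :=
  concaveNorm_le_of_forall_sum_le h.q_pos concaveNorm_nonneg fun _ _ hk hkf =>
    h.sum_le_concaveNorm_rpow hg hk fun ω =>
      (hkf ω).trans (Real.rpow_le_rpow (abs_nonneg _) (hle ω) h.q_pos.le)

theorem concaveNorm_zero (h : IsConcaveRep A T q C) : concaveNorm A T q (0 : Ω → ℝ) = 0 := by
  refine le_antisymm ?_ concaveNorm_nonneg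
  simpa using h.concaveNorm_le A.zero_mem

theorem concaveNorm_smul_le (h : IsConcaveRep A T q C) (hf : f ∈ A) {c : ℝ} (hc : c ≠ 0) :
    concaveNorm A T q (c • f) ≤ |c| * concaveNorm A T q f := by
  have hc_pos : 0 < |c| ^ q := Real.rpow_pos_of_pos (abs_pos.2 hc) q
  have hscale : ∀ {t : ℝ}, 0 ≤ t → (|c|⁻¹ * t) ^ q = (|c| ^ q)⁻¹ * t ^ q := fun ht => by
    rw [Real.mul_rpow (by positivity) ht, Real.inv_rpow (abs_nonneg c)]
  refine concaveNorm_le_of_forall_sum_le h.q_pos (mul_nonneg (abs_nonneg c) concaveNorm_nonneg)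
    fun n g hg hle => ?_
  have hsum := h.sum_le_concaveNorm_rpow hf (g := fun i => c⁻¹ • g i)
    (fun i => A.smul_mem _ (hg i)) fun ω => by
      simp only [Pi.smul_apply, smul_eq_mul, abs_mul, abs_inv, hscale (abs_nonneg _),
        ← Finset.mul_sum]
      rw [inv_mul_le_iff₀ hc_pos, ← Real.mul_rpow (abs_nonneg _) (abs_nonneg _), ← abs_mul]
      exact hle ω
  simp only [map_smul, norm_smul, norm_inv, Real.norm_eq_abs, hscale (norm_nonneg _),
    ← Finset.mul_sum] at hsum
  rwa [inv_mul_le_iff₀ hc_pos, ← Real.mul_rpow (abs_nonneg _) concaveNorm_nonneg] at hsum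

theorem concaveNorm_smul (h : IsConcaveRep A T q C) (hf : f ∈ A) (c : ℝ) :
    concaveNorm A T q (c • f) = |c| * concaveNorm A T q f := by
  rcases eq_or_ne c 0 with rfl | hc
  · rw [zero_smul, h.concaveNorm_zero, abs_zero, zero_mul]
  refine (h.concaveNorm_smul_le hf hc).antisymm ?_
  have := h.concaveNorm_smul_le (A.smul_mem c hf) (inv_ne_zero hc)
  rwa [inv_smul_smul₀ hc, abs_inv, le_inv_mul_iff₀ (abs_pos.2 hc)] at this

theorem concaveNorm_superadd (h : IsConcaveRep A T q C) {f₁ f₂ : Ω → ℝ} (hf₁ : f₁ ∈ A)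
    (hf₂ : f₂ ∈ A) (hf : f ∈ A) (hle : ∀ ω, |f₁ ω| ^ q + |f₂ ω| ^ q ≤ |f ω| ^ q) :
    concaveNorm A T q f₁ ^ q + concaveNorm A T q f₂ ^ q ≤ concaveNorm A T q f ^ q := by
  have hne : ∀ g : Ω → ℝ, (concaveSums A T q g).Nonempty := fun g =>
    ⟨0, zero_mem_concaveSums A T q g⟩
  rw [concaveNorm_rpow h.q_pos (f := f₁), concaveNorm_rpow h.q_pos (f := f₂),
    ← csSup_add (hne f₁) (h.bddAbove_concaveSums hf₁) (hne f₂) (h.bddAbove_concaveSums hf₂)]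
  refine csSup_le ((hne f₁).add (hne f₂)) ?_
  rintro _ ⟨_, ⟨n, g, hg, hgle, rfl⟩, _, ⟨m, k, hk, hkle, rfl⟩, rfl⟩
  have happend : ∀ i, Fin.append g k i ∈ A := fun i => by
    refine Fin.addCases (fun i => ?_) (fun i => ?_) i
    · rw [Fin.append_left]; exact hg i
    · rw [Fin.append_right]; exact hk i
  have := h.sum_le_concaveNorm_rpow hf happend fun ω => by
    simp only [Fin.sum_univ_add, Fin.append_left, Fin.append_right]
    exact (add_le_add (hgle ω) (hkle ω)).trans (hle ω)
  simpa only [Fin.sum_univ_add, Fin.append_left, Fin.append_right] using this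

theorem rpow_sum_norm_mul_div_le (h : IsConcaveRep A T q C) {n : ℕ} {k : Fin n → Ω → ℝ}
    (hk : ∀ i, k i ∈ A) {c d : Ω → ℝ} (hc : c ∈ A) (hd : d ∈ A) {ε : ℝ} (hε : 0 < ε)
    (hεd : ∀ ω, ε ≤ d ω) (hkd : ∀ ω, ∑ i, |k i ω| ^ q ≤ d ω ^ q) :
    (∑ i, ‖T fun ω => k i ω * (c ω / d ω)‖ ^ q) ^ (1 / q) ≤ concaveNorm A T q c := by
  rw [one_div, Real.rpow_inv_le_iff_of_pos (by positivity) concaveNorm_nonneg h.q_pos]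
  exact h.sum_le_concaveNorm_rpow hc (fun i => h.mul_mem (hk i) (h.div_mem hc hd hε hεd))
    fun ω => sum_abs_mul_div_rpow_le (hε.trans_le (hεd ω)) (hkd ω) (c ω)

theorem concaveNorm_add_le_add_const (h : IsConcaveRep A T q C) (hf : f ∈ A) (hg : g ∈ A) {ε : ℝ}
    (hε : 0 < ε) : concaveNorm A T q (f + g) ≤
      concaveNorm A T q f + concaveNorm A T q g + concaveNorm A T q (fun _ => ε) := by
  refine concaveNorm_le_of_forall_sum_le h.q_pos
    (add_nonneg (add_nonneg concaveNorm_nonneg concaveNorm_nonneg) concaveNorm_nonneg)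
    fun n k hk hle => ?_
  -- Split each `k i` in the proportions `|f| : |g| : ε`.
  set d : Ω → ℝ := fun ω => |f ω| + |g ω| + ε
  have hd_mem : d ∈ A := A.add_mem (A.add_mem (h.abs_mem hf) (h.abs_mem hg)) (h.const_mem ε)
  have hεd : ∀ ω, ε ≤ d ω := fun ω => le_add_of_nonneg_left (by positivity)
  have hkd : ∀ ω, ∑ i, |k i ω| ^ q ≤ d ω ^ q := fun ω =>
    (hle ω).trans <| Real.rpow_le_rpow (abs_nonneg _)
      ((abs_add_le _ _).trans (le_add_of_nonneg_right hε.le)) h.q_pos.le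
  have hsplit : ∀ i, T (k i) = T (fun ω => k i ω * (|f ω| / d ω)) +
      T (fun ω => k i ω * (|g ω| / d ω)) + T (fun ω => k i ω * (ε / d ω)) := fun i => by
    rw [← map_add, ← map_add]
    congr 1
    ext ω
    have : d ω ≠ 0 := (hε.trans_le (hεd ω)).ne'
    simp only [Pi.add_apply]
    field_simp
    rfl
  have hpart : ∀ {c : Ω → ℝ}, c ∈ A →
      (∑ i, ‖T fun ω => k i ω * (c ω / d ω)‖ ^ q) ^ (1 / q) ≤ concaveNorm A T q c :=
    fun hc => h.rpow_sum_norm_mul_div_le hk hc hd_mem hε hεd hkd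
  have habs : ∀ {c : Ω → ℝ}, c ∈ A →
      concaveNorm A T q (fun ω => |c ω|) ≤ concaveNorm A T q c :=
    fun {c} hc => h.concaveNorm_mono hc fun ω => (abs_abs (c ω)).le
  rw [← Real.rpow_inv_le_iff_of_pos (by positivity) (add_nonneg (add_nonneg concaveNorm_nonneg
    concaveNorm_nonneg) concaveNorm_nonneg) h.q_pos, ← one_div]
  simp only [hsplit]
  refine (rpow_sum_norm_add_le h.one_le_q _ _).trans (add_le_add ?_ (hpart (h.const_mem ε)))
  exact (rpow_sum_norm_add_le h.one_le_q _ _).trans (add_le_add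
    ((hpart (h.abs_mem hf)).trans (habs hf)) ((hpart (h.abs_mem hg)).trans (habs hg)))

theorem concaveNorm_const (h : IsConcaveRep A T q C) {ε : ℝ} (hε : 0 ≤ ε) :
    concaveNorm A T q (fun _ => ε) = ε * concaveNorm A T q 1 := by
  have := h.concaveNorm_smul (h.const_mem 1) ε
  rw [abs_of_nonneg hε] at this
  rw [show (fun _ : Ω => ε) = ε • fun _ => 1 by ext; simp, this]
  rfl

theorem concaveNorm_add_le (h : IsConcaveRep A T q C) (hf : f ∈ A) (hg : g ∈ A) :
    concaveNorm A T q (f + g) ≤ concaveNorm A T q f + concaveNorm A T q g := by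
  have hlim : Tendsto (fun ε : ℝ => concaveNorm A T q f + concaveNorm A T q g +
      ε * concaveNorm A T q 1) (𝓝[>] 0) (𝓝 (concaveNorm A T q f + concaveNorm A T q g +
        0 * concaveNorm A T q 1)) :=
    tendsto_const_nhds.add (tendsto_nhdsWithin_of_tendsto_nhds (tendsto_id.mul_const _))
  rw [zero_mul, add_zero] at hlim
  refine ge_of_tendsto hlim (eventually_nhdsWithin_of_forall fun ε hε => ?_)
  exact (h.concaveNorm_add_le_add_const hf hg hε).trans_eq
    (by rw [h.concaveNorm_const (le_of_lt hε)])

end IsConcaveRep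

end ConcaveNorm

section NormingFunctional

theorem exists_linearMap_le_sublinear {E : Type*} [AddCommGroup E] [Module ℝ E] {p : E → ℝ}
    (hsmul : ∀ c : ℝ, 0 < c → ∀ x, p (c • x) = c * p x) (hadd : ∀ x y, p (x + y) ≤ p x + p y)
    (e : E) : ∃ φ : E →ₗ[ℝ] ℝ, φ e = p e ∧ ∀ x, φ x ≤ p x := by
  have hzero : p 0 = 0 := by
    have := hsmul 2 two_pos 0
    rw [smul_zero] at this
    linarith
  have hspan : ∀ c : ℝ, c * p e ≤ p (c • e) := fun c => by
    rcases lt_trichotomy c 0 with hc | rfl | hc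
    · have := hadd (c • e) ((-c) • e)
      rw [← add_smul, add_neg_cancel, zero_smul, hzero, hsmul (-c) (neg_pos.2 hc)] at this
      linarith
    · simp [hzero]
    · exact (hsmul c hc e).ge
  have hwell_defined : ∀ c : ℝ, c • e = 0 → c • p e = 0 := fun c hc => by
    rcases smul_eq_zero.1 hc with rfl | rfl
    · exact zero_smul ℝ _
    · rw [hzero, smul_zero]
  obtain ⟨φ, hφe, hφ⟩ := exists_extension_of_le_sublinear
    (LinearPMap.mkSpanSingleton' e (p e) hwell_defined) p hsmul hadd fun ⟨x, hx⟩ => by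
      obtain ⟨c, rfl⟩ := Submodule.mem_span_singleton.1 hx
      rw [LinearPMap.mkSpanSingleton'_apply]
      exact hspan c
  refine ⟨φ, (hφe ⟨e, Submodule.mem_span_singleton_self e⟩).trans ?_, hφ⟩
  exact LinearPMap.mkSpanSingleton'_apply_self e (p e) hwell_defined _

theorem one_sub_div_le_one_sub_rpow_inv {q s b : ℝ} (hq : 0 < q) (hs : |s| ≤ b) (hb : b ≤ 1 / 2) :
    1 - (s + 2 * b ^ 2) / q ≤ (1 - s) ^ (1 / q) := by
  have hs_le := (abs_le.1 hs).2
  have hpos : 0 < 1 - s := by linarith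
  have hinv : (1 - s)⁻¹ - 1 ≤ s + 2 * b ^ 2 := by
    have hs_sq : s ^ 2 ≤ b ^ 2 := sq_le_sq' (abs_le.1 hs).1 hs_le
    rw [sub_le_iff_le_add, inv_le_iff_one_le_mul₀ hpos]
    nlinarith [mul_nonneg (sq_nonneg b) (show 0 ≤ 1 - 2 * s by linarith)]
  calc 1 - (s + 2 * b ^ 2) / q ≤ 1 - ((1 - s)⁻¹ - 1) / q := by gcongr
    _ = (1 - (1 - s)⁻¹) / q + 1 := by ring
    _ ≤ Real.log (1 - s) / q + 1 := by gcongr; exact Real.one_sub_inv_le_log_of_pos hpos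
    _ ≤ Real.exp (Real.log (1 - s) / q) := Real.add_one_le_exp _
    _ = (1 - s) ^ (1 / q) := by rw [Real.rpow_def_of_pos hpos, mul_one_div]

variable {Ω X : Type*} [NormedAddCommGroup X] [NormedSpace ℝ X]

/-- `π w = φ (x * w)` for a positive functional `φ` that supports the unit ball of `concaveNorm`
at `x`. -/
structure IsSupporting (A : Submodule ℝ (Ω → ℝ)) (T : (Ω → ℝ) →ₗ[ℝ] X) (q : ℝ) (x : Ω → ℝ)
    (π : (Ω → ℝ) →ₗ[ℝ] ℝ) : Prop where
  nonneg : ∀ w ∈ A, (∀ ω, 0 ≤ w ω) → 0 ≤ π w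
  one : π (fun _ => 1) = 1
  le : ∀ w ∈ A, (∀ ω, 0 ≤ w ω) → π w ≤ concaveNorm A T q (x * w)

/-- A supporting functional for which the reverse inequality holds for `q`-th powers, so that
`w ↦ concaveNorm (x * w)` lies between the `L¹` and the `L^q` norm of `π`. -/
structure IsNorming (A : Submodule ℝ (Ω → ℝ)) (T : (Ω → ℝ) →ₗ[ℝ] X) (q : ℝ) (x : Ω → ℝ)
    (π : (Ω → ℝ) →ₗ[ℝ] ℝ) : Prop extends IsSupporting A T q x π where
  ge : ∀ w ∈ A, (∀ ω, 0 ≤ w ω) → concaveNorm A T q (x * w) ^ q ≤ π (fun ω => w ω ^ q)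

variable {A : Submodule ℝ (Ω → ℝ)} {T : (Ω → ℝ) →ₗ[ℝ] X} {q C : ℝ} {x w : Ω → ℝ}

theorem IsConcaveRep.exists_isSupporting (h : IsConcaveRep A T q C) (hx : x ∈ A)
    (hN : concaveNorm A T q x = 1) : ∃ π, IsSupporting A T q x π := by
  have hmem : ∀ w : A, (x * fun ω => max (w.1 ω) 0) ∈ A := fun w =>
    h.mul_mem hx (h.comp_one w.2 (Φ := fun a => max a 0) (by fun_prop))
  let p : A → ℝ := fun w => concaveNorm A T q (x * fun ω => max (w.1 ω) 0)
  have hsmul : ∀ c : ℝ, 0 < c → ∀ w, p (c • w) = c * p w := fun c hc w => by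
    have : (x * fun ω => max ((c • w).1 ω) 0) = c • (x * fun ω => max (w.1 ω) 0) := by
      ext ω
      simp only [Submodule.coe_smul, Pi.mul_apply, Pi.smul_apply, smul_eq_mul]
      rw [mul_left_comm, mul_max_of_nonneg _ _ hc.le, mul_zero]
    simp only [p]
    rw [this, h.concaveNorm_smul (hmem w), abs_of_pos hc]
  have hadd : ∀ v w, p (v + w) ≤ p v + p w := fun v w => by
    refine (h.concaveNorm_mono (A.add_mem (hmem v) (hmem w)) fun ω => ?_).trans
      (h.concaveNorm_add_le (hmem v) (hmem w))
    simp only [Pi.mul_apply, Pi.add_apply, Submodule.coe_add]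
    rw [← mul_add, abs_mul, abs_mul]
    refine mul_le_mul_of_nonneg_left (abs_le_abs_of_nonneg (le_max_right _ _) ?_) (abs_nonneg _)
    exact max_le (add_le_add (le_max_left _ _) (le_max_left _ _)) (by positivity)
  let e : A := ⟨fun _ => 1, h.const_mem 1⟩
  have hpe : p e = 1 := by
    simp only [p, e, max_eq_left zero_le_one]
    exact (congrArg _ (mul_one x)).trans hN
  obtain ⟨φ, hφe, hφ⟩ := exists_linearMap_le_sublinear hsmul hadd e
  obtain ⟨π, hπ⟩ := LinearMap.exists_extend φ
  have hval : ∀ w : A, π w = φ w := fun w => LinearMap.congr_fun hπ w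
  refine ⟨π, fun w hw hw0 => ?_, (hval e).trans (hφe.trans hpe), fun w hw hw0 => ?_⟩
  · have hle := hφ (-⟨w, hw⟩)
    have hzero : (x * fun ω => max ((-⟨w, hw⟩ : A).1 ω) 0) = 0 := by
      ext ω
      simp [hw0 ω]
    simp only [p] at hle
    rw [map_neg, ← hval, hzero, h.concaveNorm_zero] at hle
    linarith
  · have hle := hφ ⟨w, hw⟩
    simp only [p, max_eq_left (hw0 _)] at hle
    rwa [← hval] at hle

theorem IsConcaveRep.smul_concaveNorm_add_concaveNorm_le (h : IsConcaveRep A T q C) (hx : x ∈ A)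
    (hN : concaveNorm A T q x = 1) {t : ℝ} (ht : 0 ≤ t) (hw : w ∈ A) {a : Ω → ℝ} (ha : a ∈ A)
    (hle : ∀ ω, t * |w ω| ^ q + |a ω| ^ q ≤ 1 + t) :
    t * concaveNorm A T q (x * w) ^ q + concaveNorm A T q (x * a) ^ q ≤ 1 + t := by
  have hroot : ∀ {r : ℝ}, 0 ≤ r → |r ^ (1 / q)| ^ q = r := fun hr => by
    rw [abs_of_nonneg (Real.rpow_nonneg hr _), one_div, Real.rpow_inv_rpow hr h.q_pos.ne']
  have hpow : ∀ {r s : ℝ}, 0 ≤ r → 0 ≤ s → (|r ^ (1 / q)| * s) ^ q = r * s ^ q := fun hr hs => by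
    rw [Real.mul_rpow (abs_nonneg _) hs, hroot hr]
  have hsuper := h.concaveNorm_superadd (A.smul_mem (t ^ (1 / q)) (h.mul_mem hx hw))
    (h.mul_mem hx ha) (A.smul_mem ((1 + t) ^ (1 / q)) hx) fun ω => by
      simp only [Pi.smul_apply, Pi.mul_apply, smul_eq_mul, abs_mul]
      rw [hpow ht (by positivity), hpow (by positivity) (abs_nonneg _),
        Real.mul_rpow (abs_nonneg _) (abs_nonneg _), Real.mul_rpow (abs_nonneg _) (abs_nonneg _)]
      linarith [mul_le_mul_of_nonneg_left (hle ω) (Real.rpow_nonneg (abs_nonneg (x ω)) q)]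
  rwa [h.concaveNorm_smul (h.mul_mem hx hw), h.concaveNorm_smul hx, hN, mul_one,
    hpow ht concaveNorm_nonneg, hroot (by positivity)] at hsuper

namespace IsSupporting

variable {π : (Ω → ℝ) →ₗ[ℝ] ℝ}

theorem mono (hπ : IsSupporting A T q x π) {v w : Ω → ℝ} (hv : v ∈ A) (hw : w ∈ A)
    (hle : ∀ ω, v ω ≤ w ω) : π v ≤ π w := by
  have := hπ.nonneg (w - v) (A.sub_mem hw hv) fun ω => sub_nonneg.2 (hle ω)
  rw [map_sub] at this
  linarith

theorem map_const (hπ : IsSupporting A T q x π) (c : ℝ) : π (fun _ => c) = c := by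
  rw [show (fun _ : Ω => c) = c • fun _ => (1 : ℝ) by ext; simp, map_smul, hπ.one, smul_eq_mul,
    mul_one]

theorem one_sub_le_concaveNorm_rpow (hπ : IsSupporting A T q x π) (h : IsConcaveRep A T q C)
    {v : Ω → ℝ} (hv : v ∈ A) {b : ℝ} (hvb : ∀ ω, |v ω| ≤ b) (hb0 : 0 ≤ b) (hb : b ≤ 1 / 2) :
    1 - (π v + 2 * b ^ 2) ≤ concaveNorm A T q (x * fun ω => (1 - v ω) ^ (1 / q)) ^ q := by
  have hq0 := h.q_pos
  have hbase : ∀ ω, 0 ≤ 1 - v ω := fun ω => by linarith [(abs_le.1 (hvb ω)).2]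
  have hmem : (fun ω => (1 - v ω) ^ (1 / q)) ∈ A :=
    h.rpow_mem (A.sub_mem (h.const_mem 1) hv) (by positivity)
  have hv_le : π v ≤ b := by
    rw [← hπ.map_const b]
    exact hπ.mono hv (h.const_mem b) fun ω => (le_abs_self _).trans (hvb ω)
  set y := (π v + 2 * b ^ 2) / q with hy
  have hqy : q * y = π v + 2 * b ^ 2 := mul_div_cancel₀ _ hq0.ne'
  have hlin : 1 - y ≤ concaveNorm A T q (x * fun ω => (1 - v ω) ^ (1 / q)) := by
    refine le_trans ?_ (hπ.le _ hmem fun ω => Real.rpow_nonneg (hbase ω) _)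
    have hlin_mem : (fun _ => 1 - 2 * b ^ 2 / q) - (1 / q) • v ∈ A :=
      A.sub_mem (h.const_mem _) (A.smul_mem _ hv)
    have hmono := hπ.mono hlin_mem hmem fun ω => by
      refine le_trans (le_of_eq ?_) (one_sub_div_le_one_sub_rpow_inv hq0 (hvb ω) hb)
      simp only [Pi.sub_apply, Pi.smul_apply, smul_eq_mul]
      ring
    rw [map_sub, map_smul, hπ.map_const, smul_eq_mul] at hmono
    refine le_trans (le_of_eq ?_) hmono
    rw [hy]
    ring
  have hy1 : y ≤ 1 := by
    rw [hy, div_le_one hq0]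
    nlinarith [h.one_le_q]
  calc 1 - (π v + 2 * b ^ 2) = 1 + q * -y := by rw [← hqy]; ring
    _ ≤ (1 + -y) ^ q := one_add_mul_self_le_rpow_one_add (by linarith) h.one_le_q
    _ ≤ _ := Real.rpow_le_rpow (by linarith) (by linarith) hq0.le

theorem concaveNorm_rpow_le_add (hπ : IsSupporting A T q x π) (h : IsConcaveRep A T q C)
    (hx : x ∈ A) (hN : concaveNorm A T q x = 1) (hw : w ∈ A) (hw0 : ∀ ω, 0 ≤ w ω) {b t : ℝ}
    (hb : ∀ ω, |w ω ^ q - 1| ≤ b) (hb0 : 0 ≤ b) (ht : 0 < t) (htb : t * b ≤ 1 / 2) :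
    concaveNorm A T q (x * w) ^ q ≤ π (fun ω => w ω ^ q) + t * (2 * b ^ 2) := by
  -- Perturb `x` in the directions `w` and `a` with `t * w ^ q + a ^ q = 1 + t`.
  set v : Ω → ℝ := (fun ω => w ω ^ q) - fun _ => 1
  have hv : t • v ∈ A := A.smul_mem t (A.sub_mem (h.rpow_mem hw h.q_pos.le) (h.const_mem 1))
  have hvb : ∀ ω, |(t • v) ω| ≤ t * b := fun ω => by
    rw [Pi.smul_apply, smul_eq_mul, abs_mul, abs_of_pos ht]
    exact mul_le_mul_of_nonneg_left (hb ω) ht.le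
  have hbase : ∀ ω, 0 ≤ 1 - (t • v) ω := fun ω => by linarith [(abs_le.1 (hvb ω)).2]
  have hlower := hπ.one_sub_le_concaveNorm_rpow h hv hvb (by positivity) htb
  have hupper := h.smul_concaveNorm_add_concaveNorm_le hx hN ht.le hw
    (a := fun ω => (1 - (t • v) ω) ^ (1 / q))
    (h.rpow_mem (A.sub_mem (h.const_mem 1) hv) (one_div_nonneg.2 h.q_pos.le)) fun ω => by
      rw [abs_of_nonneg (hw0 ω), abs_of_nonneg (Real.rpow_nonneg (hbase ω) _), one_div,
        Real.rpow_inv_rpow (hbase ω) h.q_pos.ne']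
      simp only [Pi.smul_apply, smul_eq_mul, v, Pi.sub_apply]
      linarith
  rw [map_smul, map_sub, hπ.one, smul_eq_mul] at hlower
  refine le_of_mul_le_mul_left ?_ ht
  nlinarith

theorem isNorming (hπ : IsSupporting A T q x π) (h : IsConcaveRep A T q C) (hx : x ∈ A)
    (hN : concaveNorm A T q x = 1) : IsNorming A T q x π := by
  refine ⟨hπ, fun w hw hw0 => ?_⟩
  obtain ⟨b, hb⟩ := h.bdd _ (A.sub_mem (h.rpow_mem hw h.q_pos.le) (h.const_mem 1))
  have hb' : ∀ ω, |w ω ^ q - 1| ≤ |b| := fun ω => (hb ω).trans (le_abs_self b)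
  have hlim : Tendsto (fun t : ℝ => π (fun ω => w ω ^ q) + t * (2 * |b| ^ 2)) (𝓝[>] 0)
      (𝓝 (π (fun ω => w ω ^ q) + 0 * (2 * |b| ^ 2))) :=
    tendsto_nhdsWithin_of_tendsto_nhds (tendsto_const_nhds.add (tendsto_id.mul_const _))
  rw [zero_mul, add_zero] at hlim
  have hsmall : ∀ᶠ t : ℝ in 𝓝[>] 0, t * |b| < 1 / 2 :=
    tendsto_nhdsWithin_of_tendsto_nhds (tendsto_id.mul_const |b|) |>.eventually_lt_const
      (by norm_num)
  refine ge_of_tendsto hlim ?_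
  filter_upwards [hsmall, self_mem_nhdsWithin] with t htb ht
  exact hπ.concaveNorm_rpow_le_add h hx hN hw hw0 hb' (abs_nonneg b) ht htb.le

end IsSupporting

theorem IsConcaveRep.exists_isNorming (h : IsConcaveRep A T q C) (hx : x ∈ A)
    (hN : concaveNorm A T q x = 1) : ∃ π, IsNorming A T q x π := by
  obtain ⟨π, hπ⟩ := h.exists_isSupporting hx hN
  exact ⟨π, hπ.isNorming h hx hN⟩

end NormingFunctional

section ConcaveLattice

theorem sum_mul_le_of_norm_toLp_le_one {q : ℝ} (hq : 1 ≤ q) {n : ℕ} {a b : Fin n → ℝ} {c : ℝ}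
    (ha : ‖WithLp.toLp (ENNReal.conjExponent (ENNReal.ofReal q)) a‖ ≤ 1)
    (hb : ∑ i, |b i| ^ q ≤ |c| ^ q) : ∑ i, a i * b i ≤ |c| := by
  rcases hq.eq_or_lt with rfl | hq1
  · have : Fact (1 ≤ ENNReal.conjExponent (ENNReal.ofReal 1)) :=
      ⟨by rw [ENNReal.conjExponent]; exact le_self_add⟩
    simp only [Real.rpow_one] at hb
    refine (Finset.sum_le_sum fun i _ => ?_).trans hb
    have hai : |a i| ≤ 1 := (PiLp.norm_apply_le (WithLp.toLp _ a) i).trans ha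
    calc a i * b i ≤ |a i| * |b i| := by rw [← abs_mul]; exact le_abs_self _
      _ ≤ |b i| := mul_le_of_le_one_left (abs_nonneg _) hai
  · have hconj : q.HolderConjugate (ENNReal.conjExponent (ENNReal.ofReal q)).toReal := by
      have : Fact (1 ≤ ENNReal.ofReal q) := ⟨by simpa using hq⟩
      have hq' : (ENNReal.ofReal q).toReal = q := ENNReal.toReal_ofReal (by positivity)
      simpa only [hq'] using ENNReal.HolderConjugate.toReal (p := ENNReal.ofReal q)
        (q := ENNReal.conjExponent (ENNReal.ofReal q)) (by rwa [hq'])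
    rw [PiLp.norm_eq_sum hconj.symm.pos] at ha
    simp only [Real.norm_eq_abs] at ha
    calc ∑ i, a i * b i ≤ _ * (∑ i, |b i| ^ q) ^ (1 / q) :=
          Real.inner_le_Lp_mul_Lq Finset.univ a b hconj.symm
      _ ≤ (∑ i, |b i| ^ q) ^ (1 / q) := mul_le_of_le_one_left (by positivity) ha
      _ ≤ |c| := by
        rwa [one_div, Real.rpow_inv_le_iff_of_pos (by positivity) (abs_nonneg _) (by positivity)]

variable {X : Type*} [NormedAddCommGroup X] [NormedSpace ℝ X] [CompleteSpace X]
  [Lattice X] [IsOrderedAddMonoid X] [HasSolidNorm X] [IsOrderedModule ℝ X]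

theorem IsConcaveWith.sum_norm_rpow_le {q : ℝ} {C : ℝ≥0} (hC : IsConcaveWith q X C) (hq : 0 < q)
    {n : ℕ} {x : Fin n → X} {y : X} (hy : y ∈ upperBounds (dualBallCombinations q x)) :
    ∑ i, ‖x i‖ ^ q ≤ (C * ‖y‖) ^ q := by
  have : Fact (1 ≤ ENNReal.conjExponent (ENNReal.ofReal q)) :=
    ⟨by rw [ENNReal.conjExponent]; exact le_self_add⟩
  have hlub := isLUB_latticeLqSum q x
  have hnonneg : 0 ≤ latticeLqSum q x := hlub.1 ⟨0, by simp, by simp⟩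
  have hle : latticeLqSum q x ≤ y := hlub.2 hy
  have hnorm : ‖latticeLqSum q x‖ ≤ ‖y‖ := by
    refine norm_le_norm_of_abs_le_abs ?_
    rwa [abs_of_nonneg hnonneg, abs_of_nonneg (hnonneg.trans hle)]
  rw [← Real.rpow_inv_le_iff_of_pos (by positivity) (by positivity) hq, ← one_div]
  exact (hC n x).trans (mul_le_mul_of_nonneg_left hnorm C.coe_nonneg)

theorem isConcaveRep_of_latticeHom {Ω : Type*} {A : Submodule ℝ (Ω → ℝ)}
    {T : (Ω → ℝ) →ₗ[ℝ] X} {q : ℝ} (hq : 1 ≤ q) {C : ℝ≥0} (hC1 : 1 ≤ C)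
    (hC : IsConcaveWith q X C)
    (hcomp : ∀ f ∈ A, ∀ g ∈ A, ∀ Φ : ℝ → ℝ → ℝ, Continuous (Function.uncurry Φ) →
      (fun ω => Φ (f ω) (g ω)) ∈ A)
    (hbdd : ∀ f ∈ A, ∃ c : ℝ, ∀ ω, |f ω| ≤ c)
    (hT : ∀ f ∈ A, T (fun ω => |f ω|) = |T f|) : IsConcaveRep A T q C := by
  have habs : ∀ f ∈ A, (fun ω => |f ω|) ∈ A := fun f hf =>
    hcomp f hf f hf (fun a _ => |a|) (by fun_prop)
  have hmono : ∀ f ∈ A, ∀ g ∈ A, (∀ ω, f ω ≤ g ω) → T f ≤ T g := by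
    intro f hf g hg hle
    have hsub := hT (g - f) (A.sub_mem hg hf)
    rw [show (fun ω => |(g - f) ω|) = g - f from
      funext fun ω => abs_of_nonneg (sub_nonneg.2 (hle ω)), map_sub] at hsub
    exact sub_nonneg.1 (hsub ▸ abs_nonneg (T g - T f))
  refine ⟨hcomp, hbdd, hq, hC1, fun f hf g hg hle => ?_, fun n g hg f hf hle => ?_⟩
  · refine norm_le_norm_of_abs_le_abs ?_
    rw [← hT f hf, ← hT g hg]
    exact hmono _ (habs f hf) _ (habs g hg) hle
  · rw [← norm_abs_eq_norm (T f), ← hT f hf]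
    refine hC.sum_norm_rpow_le (zero_lt_one.trans_le hq) ?_
    rintro _ ⟨a, ha, rfl⟩
    rw [show ∑ i, a i • T (g i) = T (∑ i, a i • g i) by simp only [map_sum, map_smul]]
    refine hmono _ (A.sum_mem fun i _ => A.smul_mem _ (hg i)) _ (habs f hf) fun ω => ?_
    simp only [Finset.sum_apply, Pi.smul_apply, smul_eq_mul]
    exact sum_mul_le_of_norm_toLp_le_one hq ha (hle ω)

end ConcaveLattice

section FunctionSpaces

open MeasureTheory

/-- The continuous real functions as a space of functions, the domain of the Kakutani
representation. -/
def continuousFunctions (K : Type*) [TopologicalSpace K] : Submodule ℝ (K → ℝ) where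
  carrier := {f | Continuous f}
  add_mem' hf hg := Continuous.add hf hg
  zero_mem' := continuous_const
  smul_mem' c _ hf := Continuous.const_smul hf c

/-- The bounded measurable real functions, not identified up to null sets; they form the domain of
the representation of a lattice over a measure space. -/
def boundedMeasurable (Ω : Type*) [MeasurableSpace Ω] : Submodule ℝ (Ω → ℝ) where
  carrier := {f | Measurable f ∧ ∃ c : ℝ, ∀ ω, |f ω| ≤ c}
  add_mem' := by
    rintro f g ⟨hf, a, ha⟩ ⟨hg, b, hb⟩
    exact ⟨hf.add hg, a + b, fun ω => (abs_add_le _ _).trans (add_le_add (ha ω) (hb ω))⟩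
  zero_mem' := ⟨measurable_const, 0, by simp⟩
  smul_mem' := by
    rintro c f ⟨hf, a, ha⟩
    refine ⟨hf.const_smul c, |c| * a, fun ω => ?_⟩
    rw [Pi.smul_apply, smul_eq_mul, abs_mul]
    exact mul_le_mul_of_nonneg_left (ha ω) (abs_nonneg c)

theorem exists_measure_of_positive {K : Type*} [TopologicalSpace K] [CompactSpace K] [T2Space K]
    [MeasurableSpace K] [BorelSpace K] {π : (K → ℝ) →ₗ[ℝ] ℝ}
    (hπ : ∀ w ∈ continuousFunctions K, (∀ k, 0 ≤ w k) → 0 ≤ π w) (hone : π (fun _ => 1) = 1) :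
    ∃ μ : Measure K, IsProbabilityMeasure μ ∧ μ.WeaklyRegular ∧
      ∀ w ∈ continuousFunctions K, ∫ k, w k ∂μ = π w := by
  let Λ₀ : CompactlySupportedContinuousMap K ℝ →ₗ[ℝ] ℝ :=
    { toFun := fun f => π f
      map_add' := fun f g => by rw [CompactlySupportedContinuousMap.coe_add, map_add]
      map_smul' := fun c f => by rw [CompactlySupportedContinuousMap.coe_smul, map_smul]; rfl }
  let Λ : CompactlySupportedContinuousMap K ℝ →ₚ[ℝ] ℝ :=
    PositiveLinearMap.mk₀ Λ₀ fun f hf => hπ f f.continuous fun k => hf k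
  have hint : ∀ w ∈ continuousFunctions K, ∫ k, w k ∂(RealRMK.rieszMeasure Λ) = π w :=
    fun w hw => RealRMK.integral_rieszMeasure Λ ⟨⟨w, hw⟩, HasCompactSupport.of_compactSpace w⟩
  refine ⟨RealRMK.rieszMeasure Λ, ⟨?_⟩, inferInstance, hint⟩
  have hmass := hint (fun _ => 1) continuous_const
  rw [hone, integral_const, smul_eq_mul, mul_one, Measure.real] at hmass
  exact (ENNReal.toReal_eq_one_iff _).1 hmass

variable {Ω : Type*} [MeasurableSpace Ω] {μ : Measure Ω} {f g : Ω → ℝ}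

theorem comp_mem_boundedMeasurable
    (hf : f ∈ boundedMeasurable Ω) (hg : g ∈ boundedMeasurable Ω) {Φ : ℝ → ℝ → ℝ}
    (hΦ : Continuous (Function.uncurry Φ)) : (fun ω => Φ (f ω) (g ω)) ∈ boundedMeasurable Ω := by
  obtain ⟨hfm, a, ha⟩ := hf
  obtain ⟨hgm, b, hb⟩ := hg
  refine ⟨hΦ.measurable.comp (hfm.prodMk hgm), ?_⟩
  obtain ⟨c, hc⟩ := ((isCompact_Icc (a := -a) (b := a)).prod
    (isCompact_Icc (a := -b) (b := b))).exists_bound_of_continuousOn hΦ.continuousOn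
  exact ⟨c, fun ω => hc (f ω, g ω) ⟨abs_le.1 (ha ω), abs_le.1 (hb ω)⟩⟩

theorem memLp_of_mem_boundedMeasurable [IsFiniteMeasure μ] (hf : f ∈ boundedMeasurable Ω)
    (p : ℝ≥0∞) : MemLp f p μ := by
  obtain ⟨hm, c, hc⟩ := hf
  exact MemLp.of_bound hm.aestronglyMeasurable c (Filter.Eventually.of_forall hc)

theorem integrable_of_mem_boundedMeasurable [IsFiniteMeasure μ] (hf : f ∈ boundedMeasurable Ω) :
    Integrable f μ :=
  memLp_one_iff_integrable.1 (memLp_of_mem_boundedMeasurable hf 1)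

theorem norm_toLp_eq_integral {q : ℝ} (hq : 0 < q) (hf : MemLp f (ENNReal.ofReal q) μ) :
    ‖hf.toLp f‖ = (∫ ω, |f ω| ^ q ∂μ) ^ (1 / q) := by
  have hq0 : ENNReal.ofReal q ≠ 0 := by simpa using hq
  rw [Lp.norm_toLp, hf.eLpNorm_eq_integral_rpow_norm hq0 ENNReal.ofReal_ne_top,
    ENNReal.toReal_ofReal hq.le, ENNReal.toReal_ofReal, one_div]
  · rfl
  · exact Real.rpow_nonneg (integral_nonneg fun ω => Real.rpow_nonneg (norm_nonneg _) _) _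

theorem integral_abs_le_norm_Lp [IsProbabilityMeasure μ] {p : ℝ≥0∞} (hp : 1 ≤ p) (F : Lp ℝ p μ) :
    ∫ ω, |F ω| ∂μ ≤ ‖F‖ := by
  have hexp : eLpNorm F 1 μ ≤ eLpNorm F p μ :=
    eLpNorm_le_eLpNorm_of_exponent_le hp (Lp.aestronglyMeasurable F)
  have hint : ∫ ω, |F ω| ∂μ = (eLpNorm F 1 μ).toReal := by
    rw [eLpNorm_one_eq_lintegral_enorm]
    exact integral_norm_eq_lintegral_enorm (Lp.aestronglyMeasurable F)
  rw [hint, Lp.norm_def]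
  exact ENNReal.toReal_mono (Lp.eLpNorm_ne_top F) hexp

theorem continuous_integral_abs_Lp [IsProbabilityMeasure μ] {p : ℝ≥0∞} [hp : Fact (1 ≤ p)] :
    Continuous fun F : Lp ℝ p μ => ∫ ω, |F ω| ∂μ := by
  refine LipschitzWith.continuous (K := 1) <| LipschitzWith.of_le_add fun F G => ?_
  have hint : ∀ H : Lp ℝ p μ, Integrable (fun ω => |H ω|) μ := fun H =>
    ((Lp.memLp H).integrable hp.out).abs
  calc ∫ ω, |F ω| ∂μ ≤ ∫ ω, |G ω| + |(F - G) ω| ∂μ := by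
        refine integral_mono_ae (hint F) ((hint G).add (hint _)) ?_
        filter_upwards [Lp.coeFn_sub F G] with ω hω
        rw [hω, Pi.sub_apply, add_comm, ← sub_le_iff_le_add]
        exact abs_sub_abs_le_abs_sub _ _
    _ = ∫ ω, |G ω| ∂μ + ∫ ω, |(F - G) ω| ∂μ := integral_add (hint G) (hint _)
    _ ≤ ∫ ω, |G ω| ∂μ + dist F G := by
        rw [dist_eq_norm]
        exact add_le_add le_rfl (integral_abs_le_norm_Lp hp.out (F - G))

end FunctionSpaces

section MeasureRepresentation

open MeasureTheory

/-- A representation of a `q`-concave Banach lattice as a completion of the bounded measurable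
functions on a probability space, with a norm lying between those of `L_q` and `L_1`. Only the
values of `T` on bounded measurable functions matter. -/
structure IsMeasureRep {Ω X : Type*} [MeasurableSpace Ω] (μ : Measure Ω) [NormedAddCommGroup X]
    [NormedSpace ℝ X] (T : (Ω → ℝ) →ₗ[ℝ] X) (q C : ℝ) : Prop where
  isConcaveRep : IsConcaveRep (boundedMeasurable Ω) T q C
  norm_le : ∀ f ∈ boundedMeasurable Ω, ‖T f‖ ≤ (∫ ω, |f ω| ^ q ∂μ) ^ (1 / q)
  integral_le : ∀ f ∈ boundedMeasurable Ω, ∫ ω, |f ω| ∂μ ≤ C * ‖T f‖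
  dense : Dense (T '' boundedMeasurable Ω)

section Lp

variable {Ω : Type*} [MeasurableSpace Ω] {μ : Measure Ω}

theorem abs_toLp {p : ℝ≥0∞} {f : Ω → ℝ} (hf : MemLp f p μ)
    (hf' : MemLp (fun ω => |f ω|) p μ) : hf'.toLp = |hf.toLp f| := by
  refine Lp.ext (hf'.coeFn_toLp.trans ?_)
  filter_upwards [Lp.coeFn_abs (hf.toLp f), hf.coeFn_toLp] with ω habs hω
  rw [habs, hω]

theorem dense_toLp_boundedMeasurable [IsFiniteMeasure μ] {p : ℝ≥0∞} [Fact (1 ≤ p)] (hp : p ≠ ∞) :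
    DenseRange fun f : boundedMeasurable Ω =>
      (memLp_of_mem_boundedMeasurable f.2 p).toLp (μ := μ) f.1 := by
  refine (Lp.simpleFunc.denseRange (E := ℝ) (μ := μ) hp).mono ?_
  rintro _ ⟨s, rfl⟩
  let g := Lp.simpleFunc.toSimpleFunc s
  have hg : (g : Ω → ℝ) ∈ boundedMeasurable Ω := ⟨g.measurable, g.exists_forall_norm_le⟩
  exact ⟨⟨g, hg⟩, congrArg Subtype.val (Lp.simpleFunc.toLp_toSimpleFunc s)⟩

variable {X : Type*} [NormedAddCommGroup X] [NormedSpace ℝ X]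

theorem exists_linearMap_eq_toLp [IsFiniteMeasure μ] {p : ℝ≥0∞} (R : Lp ℝ p μ →ₗ[ℝ] X) :
    ∃ S : (Ω → ℝ) →ₗ[ℝ] X, ∀ f (hf : f ∈ boundedMeasurable Ω),
      S f = R ((memLp_of_mem_boundedMeasurable hf p).toLp f) := by
  let S₀ : boundedMeasurable Ω →ₗ[ℝ] X :=
    { toFun := fun f => R ((memLp_of_mem_boundedMeasurable f.2 p).toLp f.1)
      map_add' := fun f g => by rw [← map_add]; rfl
      map_smul' := fun a f => by rw [RingHom.id_apply, ← map_smul]; rfl }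
  obtain ⟨S, hS⟩ := LinearMap.exists_extend S₀
  exact ⟨S, fun f hf => LinearMap.congr_fun hS ⟨f, hf⟩⟩

end Lp

variable {X : Type*} [NormedAddCommGroup X] [NormedSpace ℝ X] [CompleteSpace X]
  [Lattice X] [IsOrderedAddMonoid X] [HasSolidNorm X]

theorem exists_latticeHom_Lp {K : Type*} [TopologicalSpace K] [CompactSpace K] [T2Space K]
    [MeasurableSpace K] [BorelSpace K] {μ : Measure K} [IsProbabilityMeasure μ]
    [μ.WeaklyRegular] {q : ℝ} (hq : 1 ≤ q) {C : ℝ} {T : C(K, ℝ) →ₗ[ℝ] X}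
    (hTabs : ∀ f, T |f| = |T f|) (hnorm : ∀ f, ‖T f‖ ≤ (∫ k, |f k| ^ q ∂μ) ^ (1 / q))
    (hint : ∀ f, ∫ k, |f k| ∂μ ≤ C * ‖T f‖) (hdense : DenseRange T) :
    ∃ R : Lp ℝ (ENNReal.ofReal q) μ →ₗ[ℝ] X, (∀ F, R |F| = |R F|) ∧ (∀ F, ‖R F‖ ≤ ‖F‖) ∧
      (∀ F, ∫ k, |F k| ∂μ ≤ C * ‖R F‖) ∧ DenseRange R := by
  have : Fact (1 ≤ ENNReal.ofReal q) := ⟨by simpa using hq⟩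
  let e : C(K, ℝ) →L[ℝ] Lp ℝ (ENNReal.ofReal q) μ := ContinuousMap.toLp (ENNReal.ofReal q) μ ℝ
  have he : DenseRange e := ContinuousMap.toLp_denseRange ℝ μ ℝ ENNReal.ofReal_ne_top
  have hecoe : ∀ f : C(K, ℝ), e f =ᵐ[μ] f := ContinuousMap.coeFn_toLp μ
  have hmem : ∀ f : C(K, ℝ), MemLp f (ENNReal.ofReal q) μ := fun f =>
    memLp_of_mem_boundedMeasurable ⟨f.continuous.measurable, ‖f‖, f.norm_coe_le_norm⟩ _
  have hetoLp : ∀ f : C(K, ℝ), e f = (hmem f).toLp f := fun f =>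
    Lp.ext ((hecoe f).trans (hmem f).coeFn_toLp.symm)
  have hbound : ∀ f, ‖T f‖ ≤ 1 * ‖e.toLinearMap f‖ := fun f => by
    rw [one_mul, ContinuousLinearMap.coe_coe, hetoLp,
      norm_toLp_eq_integral (zero_lt_one.trans_le hq)]
    exact hnorm f
  let R := T.extendOfNorm e.toLinearMap
  have hRe : ∀ f, R (e f) = T f := LinearMap.extendOfNorm_eq (e := e.toLinearMap) he ⟨1, hbound⟩
  have habs : Continuous fun F : Lp ℝ (ENNReal.ofReal q) μ => |F| :=
    continuous_id.sup continuous_neg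
  have heabs : ∀ f, e |f| = |e f| := fun f => by
    rw [hetoLp, hetoLp]
    exact abs_toLp (hmem f) (hmem |f|)
  have hRabs : ∀ F, R |F| = |R F| := fun F => by
    refine he.induction_on F (isClosed_eq (R.continuous.comp habs)
      (R.continuous.sup R.continuous.neg)) fun f => ?_
    rw [← heabs, hRe, hTabs, ← hRe]
  have hRnorm : ∀ F, ‖R F‖ ≤ ‖F‖ := fun F => by
    simpa only [one_mul] using
      LinearMap.norm_extendOfNorm_apply_le (e := e.toLinearMap) he 1 hbound F
  have hRint : ∀ F, ∫ k, |F k| ∂μ ≤ C * ‖R F‖ := fun F => by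
    refine he.induction_on F (isClosed_le continuous_integral_abs_Lp
      (R.continuous.norm.const_mul C)) fun f => ?_
    rw [hRe]
    exact (integral_congr_ae ((hecoe f).fun_comp abs)).trans_le (hint f)
  exact ⟨R.toLinearMap, hRabs, hRnorm, hRint,
    hdense.mono (by rintro _ ⟨f, rfl⟩; exact ⟨e f, hRe f⟩)⟩

variable [IsOrderedModule ℝ X]

theorem exists_isMeasureRep_of_latticeHom {Ω : Type*} [MeasurableSpace Ω] {μ : Measure Ω}
    [IsProbabilityMeasure μ] {q : ℝ} (hq : 1 ≤ q) {C : ℝ≥0} (hC1 : 1 ≤ C)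
    (hC : IsConcaveWith q X C) {R : Lp ℝ (ENNReal.ofReal q) μ →ₗ[ℝ] X}
    (hRabs : ∀ F, R |F| = |R F|) (hnorm : ∀ F, ‖R F‖ ≤ ‖F‖)
    (hint : ∀ F, ∫ ω, |F ω| ∂μ ≤ C * ‖R F‖) (hdense : DenseRange R) :
    ∃ T : (Ω → ℝ) →ₗ[ℝ] X, IsMeasureRep μ T q C := by
  have : Fact (1 ≤ ENNReal.ofReal q) := ⟨by simpa using hq⟩
  have hmem := fun {f : Ω → ℝ} (hf : f ∈ boundedMeasurable Ω) =>
    memLp_of_mem_boundedMeasurable (μ := μ) hf (ENNReal.ofReal q)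
  obtain ⟨T, hT⟩ := exists_linearMap_eq_toLp R
  refine ⟨T, ?_, fun f hf => ?_, fun f hf => ?_, ?_⟩
  · refine isConcaveRep_of_latticeHom hq hC1 hC
      (fun f hf g hg Φ hΦ => comp_mem_boundedMeasurable hf hg hΦ) (fun f hf => hf.2) fun f hf => ?_
    have hf' : (fun ω => |f ω|) ∈ boundedMeasurable Ω :=
      comp_mem_boundedMeasurable hf hf (Φ := fun a _ => |a|) (by fun_prop)
    rw [hT f hf, hT _ hf', ← hRabs, abs_toLp (hmem hf) (hmem hf')]
  · rw [hT f hf, ← norm_toLp_eq_integral (zero_lt_one.trans_le hq) (hmem hf)]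
    exact hnorm _
  · rw [hT f hf]
    refine le_trans (integral_congr_ae ?_).le (hint _)
    filter_upwards [(hmem hf).coeFn_toLp] with ω hω
    rw [hω]
  · have hcont : Continuous R := AddMonoidHomClass.continuous_of_bound R 1 fun F => by
      rw [one_mul]; exact hnorm F
    refine (hdense.comp (dense_toLp_boundedMeasurable ENNReal.ofReal_ne_top) hcont).mono ?_
    rintro _ ⟨f, rfl⟩
    exact ⟨f.1, f.2, hT f.1 f.2⟩

theorem IsConcaveRep.concaveNorm_one_pos {Ω Y : Type*} [NormedAddCommGroup Y] [NormedSpace ℝ Y]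
    {A : Submodule ℝ (Ω → ℝ)} {S : (Ω → ℝ) →ₗ[ℝ] Y} {q C : ℝ} (h : IsConcaveRep A S q C)
    {f : Ω → ℝ} (hf : f ∈ A) (hSf : S f ≠ 0) : 0 < concaveNorm A S q (fun _ => 1) := by
  obtain ⟨b, hb⟩ := h.bdd f hf
  have hle : ‖S f‖ ≤ |b| * concaveNorm A S q (fun _ => 1) := by
    rw [← h.concaveNorm_smul (h.const_mem 1)]
    refine (h.le_concaveNorm hf).trans
      (h.concaveNorm_mono (A.smul_mem b (h.const_mem 1)) fun ω => ?_)
    simpa using (hb ω).trans (le_abs_self b)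
  exact pos_of_mul_pos_right ((norm_pos_iff.2 hSf).trans_le hle) (abs_nonneg b)

section CompactSpace

variable {K : Type*} [TopologicalSpace K] [CompactSpace K]

theorem exists_isConcaveRep_continuousFunctions {q : ℝ} (hq : 1 ≤ q) {C : ℝ≥0} (hC1 : 1 ≤ C)
    (hC : IsConcaveWith q X C) {T : C(K, ℝ) →ₗ[ℝ] X} (hTabs : ∀ f, T |f| = |T f|) :
    ∃ S : (K → ℝ) →ₗ[ℝ] X, IsConcaveRep (continuousFunctions K) S q C ∧
      ∀ f : C(K, ℝ), S f = T f := by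
  let S₀ : continuousFunctions K →ₗ[ℝ] X :=
    { toFun := fun f => T ⟨f.1, f.2⟩
      map_add' := fun f g => by rw [← map_add]; rfl
      map_smul' := fun c f => by rw [RingHom.id_apply, ← map_smul]; rfl }
  obtain ⟨S, hS⟩ := LinearMap.exists_extend S₀
  have hST : ∀ f : C(K, ℝ), S f = T f := fun f => LinearMap.congr_fun hS ⟨f, f.continuous⟩
  refine ⟨S, isConcaveRep_of_latticeHom hq hC1 hC (fun f hf g hg Φ hΦ =>
    hΦ.comp (Continuous.prodMk hf hg)) (fun f hf => ?_) fun f hf => ?_, hST⟩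
  · exact ⟨‖(⟨f, hf⟩ : C(K, ℝ))‖, (⟨f, hf⟩ : C(K, ℝ)).norm_coe_le_norm⟩
  · exact (hST |⟨f, hf⟩|).trans ((hTabs _).trans (congrArg _ (hST ⟨f, hf⟩).symm))

variable [T2Space K] [MeasurableSpace K] [BorelSpace K]

/-- `c` normalises the constant function, and `μ` represents a norming functional for it. -/
theorem exists_measure_norm_le_integral {q : ℝ} (hq : 1 ≤ q) {C : ℝ≥0} (hC1 : 1 ≤ C)
    (hC : IsConcaveWith q X C) {T : C(K, ℝ) →ₗ[ℝ] X} (hTabs : ∀ f, T |f| = |T f|) (hT : T ≠ 0) :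
    ∃ c : ℝ, 0 < c ∧ ∃ μ : Measure K, IsProbabilityMeasure μ ∧ μ.WeaklyRegular ∧ ∀ f : C(K, ℝ),
      ‖c • T f‖ ≤ (∫ k, |f k| ^ q ∂μ) ^ (1 / q) ∧ ∫ k, |f k| ∂μ ≤ C * ‖c • T f‖ := by
  obtain ⟨S, h, hST⟩ := exists_isConcaveRep_continuousFunctions hq hC1 hC hTabs
  set A := continuousFunctions K
  obtain ⟨g, hg⟩ : ∃ g, T g ≠ 0 := not_forall.1 fun h0 => hT (LinearMap.ext h0)
  have hpos : 0 < concaveNorm A S q fun _ => 1 :=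
    h.concaveNorm_one_pos g.continuous (by rwa [hST])
  set c := (concaveNorm A S q fun _ => 1)⁻¹ with hc
  have hcpos : 0 < c := inv_pos.2 hpos
  obtain ⟨π, hπ⟩ := h.exists_isNorming (A.smul_mem c (h.const_mem 1)) (by
    rw [h.concaveNorm_smul (h.const_mem 1), abs_of_pos hcpos, hc, inv_mul_cancel₀ hpos.ne'])
  obtain ⟨μ, hμ, hreg, hint⟩ := exists_measure_of_positive hπ.nonneg hπ.one
  have hmul : ∀ w : K → ℝ, c • (fun _ : K => (1 : ℝ)) * w = c • w := fun w => by ext; simp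
  refine ⟨c, hcpos, μ, hμ, hreg, fun f => ?_⟩
  have hf' : (fun k => |f k|) ∈ A := f.continuous.abs
  have hcf : c • (f : K → ℝ) ∈ A := A.smul_mem c f.continuous
  have habs : ∀ k, |(c • f : K → ℝ) k| = |(c • fun k => |f k|) k| := fun k => by simp [abs_mul]
  rw [← hST, ← map_smul]
  constructor
  · rw [one_div, Real.le_rpow_inv_iff_of_pos (norm_nonneg _)
      (integral_nonneg fun k => Real.rpow_nonneg (abs_nonneg _) _) h.q_pos]
    calc ‖S (c • f)‖ ^ q ≤ concaveNorm A S q (c • fun k => |f k|) ^ q :=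
          Real.rpow_le_rpow (norm_nonneg _) ((h.le_concaveNorm hcf).trans
            (h.concaveNorm_mono (A.smul_mem c hf') fun k => (habs k).le)) h.q_pos.le
      _ ≤ ∫ k, |f k| ^ q ∂μ := by
          have := hπ.ge _ hf' fun k => abs_nonneg _
          rwa [hmul, ← hint _ (h.rpow_mem hf' h.q_pos.le)] at this
  · calc ∫ k, |f k| ∂μ ≤ concaveNorm A S q (c • fun k => |f k|) := by
          have := hπ.le _ hf' fun k => abs_nonneg _
          rwa [hmul, ← hint _ hf'] at this
      _ ≤ concaveNorm A S q (c • f) := h.concaveNorm_mono hcf fun k => (habs k).ge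
      _ ≤ C * ‖S (c • f)‖ := h.concaveNorm_le hcf

end CompactSpace

theorem exists_isMeasureRep.{u} (X : Type u) [NormedAddCommGroup X] [NormedSpace ℝ X]
    [CompleteSpace X] [Lattice X] [IsOrderedAddMonoid X] [HasSolidNorm X] [IsOrderedModule ℝ X]
    [TopologicalSpace.SeparableSpace X] [Nontrivial X] {q : ℝ} (hq : 1 ≤ q) {C : ℝ≥0}
    (hC1 : 1 ≤ C) (hC : IsConcaveWith q X C) :
    ∃ (Ω : Type u) (_ : MeasurableSpace Ω) (μ : Measure Ω) (_ : IsProbabilityMeasure μ)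
      (T : (Ω → ℝ) →ₗ[ℝ] X), IsMeasureRep μ T q C := by
  obtain ⟨K, _, _, _, T, hTabs, hTdense⟩ := exists_continuousMap_latticeHom X
  borelize K
  have hT : T.toLinearMap ≠ 0 := fun h0 => by
    obtain ⟨x, hx⟩ := exists_ne (0 : X)
    obtain ⟨f, hf⟩ := hTdense.exists_mem_open isOpen_compl_singleton ⟨x, hx⟩
    exact hf (LinearMap.congr_fun h0 f)
  obtain ⟨c, hc, μ, hμ, hreg, hbounds⟩ := exists_measure_norm_le_integral hq hC1 hC hTabs hT
  have hcT : DenseRange (c • T.toLinearMap) := by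
    have hsurj := MulAction.surjective₀ (α := X) hc.ne'
    exact hsurj.denseRange.comp hTdense (continuous_const_smul c)
  obtain ⟨R, hRabs, hRnorm, hRint, hRdense⟩ := exists_latticeHom_Lp hq (T := c • T.toLinearMap)
    (fun f => by
      simp only [LinearMap.smul_apply, ContinuousLinearMap.coe_coe, hTabs,
        abs_smul_eq_smul_abs hc])
    (fun f => (hbounds f).1) (fun f => (hbounds f).2) hcT
  obtain ⟨S, hS⟩ :=
    exists_isMeasureRep_of_latticeHom hq hC1 hC hRabs hRnorm hRint hRdense
  exact ⟨K, inferInstance, μ, hμ, S, hS⟩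

end MeasureRepresentation

section Density

open MeasureTheory

section PositiveFunctional

variable {Ω : Type*} [MeasurableSpace Ω]

theorem indicator_mem_boundedMeasurable {B : Set Ω} (hB : MeasurableSet B) :
    B.indicator 1 ∈ boundedMeasurable Ω := by
  refine ⟨measurable_one.indicator hB, 1, fun ω => ?_⟩
  by_cases h : ω ∈ B <;> simp [h]

theorem simpleFunc_mem_boundedMeasurable (s : SimpleFunc Ω ℝ) : ⇑s ∈ boundedMeasurable Ω :=
  ⟨s.measurable, s.exists_forall_norm_le⟩

theorem exists_simpleFunc_le_le_add {w : Ω → ℝ} (hw : w ∈ boundedMeasurable Ω) {ε : ℝ}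
    (hε : 0 < ε) : ∃ s : SimpleFunc Ω ℝ, ∀ ω, s ω ≤ w ω ∧ w ω ≤ s ω + ε := by
  obtain ⟨hm, b, hb⟩ := hw
  have hfloor : Measurable fun ω => ⌊w ω / ε⌋ := (hm.div_const ε).floor
  have hmem : ∀ ω, ⌊w ω / ε⌋ ∈ Set.Icc ⌊-b / ε⌋ ⌊b / ε⌋ := fun ω =>
    ⟨Int.floor_mono (by gcongr; exact (abs_le.1 (hb ω)).1),
      Int.floor_mono (by gcongr; exact (abs_le.1 (hb ω)).2)⟩
  let s : SimpleFunc Ω ℤ :=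
    { toFun := fun ω => ⌊w ω / ε⌋
      measurableSet_fiber' := fun k => hfloor (measurableSet_singleton k)
      finite_range' := (Set.finite_Icc _ _).subset (Set.range_subset_iff.2 hmem) }
  refine ⟨s.map fun k : ℤ => ε * k, fun ω => ?_⟩
  have hle := Int.floor_le (w ω / ε)
  have hlt := Int.lt_floor_add_one (w ω / ε)
  rw [le_div_iff₀' hε] at hle
  rw [div_lt_iff₀' hε, mul_add_one] at hlt
  exact ⟨hle, hlt.le⟩

variable {π : (Ω → ℝ) →ₗ[ℝ] ℝ}

theorem map_le_map_of_nonneg (hπ : ∀ w ∈ boundedMeasurable Ω, (∀ ω, 0 ≤ w ω) → 0 ≤ π w)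
    {v w : Ω → ℝ} (hv : v ∈ boundedMeasurable Ω) (hw : w ∈ boundedMeasurable Ω)
    (hvw : ∀ ω, v ω ≤ w ω) : π v ≤ π w := by
  simpa only [map_sub, sub_nonneg] using
    hπ (w - v) (sub_mem hw hv) fun ω => sub_nonneg.2 (hvw ω)

theorem exists_measure_apply_eq_ofReal
    (hπ : ∀ w ∈ boundedMeasurable Ω, (∀ ω, 0 ≤ w ω) → 0 ≤ π w)
    (hcont : ∀ s : ℕ → Set Ω, (∀ n, MeasurableSet (s n)) → Antitone s → ⋂ n, s n = ∅ →
      Tendsto (fun n => π ((s n).indicator 1)) atTop (𝓝 0)) :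
    ∃ ν : Measure Ω, ∀ B, MeasurableSet B → ν B = ENNReal.ofReal (π (B.indicator 1)) := by
  have hring : IsSetRing {B : Set Ω | MeasurableSet B} :=
    ⟨MeasurableSet.empty, fun _ _ => MeasurableSet.union, fun _ _ => MeasurableSet.diff⟩
  have hnn : ∀ B, MeasurableSet B → 0 ≤ π (B.indicator 1) := fun B hB =>
    hπ _ (indicator_mem_boundedMeasurable hB) (Set.indicator_nonneg (by simp))
  let m := hring.addContent_of_union (fun B => ENNReal.ofReal (π (B.indicator 1)))
    (by rw [Set.indicator_empty', map_zero, ENNReal.ofReal_zero])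
    fun {A B} hA hB hAB => by
      rw [Set.indicator_union_of_disjoint hAB, ← Pi.add_def, map_add,
        ENNReal.ofReal_add (hnn A hA) (hnn B hB)]
  have hzero : ∀ ⦃s : ℕ → Set Ω⦄, (∀ n, MeasurableSet (s n)) → Antitone s → ⋂ n, s n = ∅ →
      Tendsto (fun n => m (s n)) atTop (𝓝 0) := fun s hs hanti hs0 =>
    ENNReal.ofReal_zero ▸ ENNReal.tendsto_ofReal (hcont s hs hanti hs0)
  exact ⟨Measure.ofMeasurable (fun B _ => m B) addContent_empty fun B hB hdisj =>
    addContent_iUnion_eq_sum_of_tendsto_zero hring m (fun _ _ => ENNReal.ofReal_ne_top) hzero hB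
      (MeasurableSet.iUnion hB) hdisj, fun B hB => Measure.ofMeasurable_apply B hB⟩

theorem integral_eq_of_forall_indicator {ν : Measure Ω} [IsFiniteMeasure ν]
    (hπ : ∀ w ∈ boundedMeasurable Ω, (∀ ω, 0 ≤ w ω) → 0 ≤ π w)
    (hν : ∀ B, MeasurableSet B → ν.real B = π (B.indicator 1)) {w : Ω → ℝ}
    (hw : w ∈ boundedMeasurable Ω) : ∫ ω, w ω ∂ν = π w := by
  have hsimple : ∀ s : SimpleFunc Ω ℝ, ∫ ω, s ω ∂ν = π s := fun s => by
    induction s using SimpleFunc.induction with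
    | const c hB =>
      rename_i B
      have hcoe : ⇑(SimpleFunc.piecewise B hB (.const Ω c) (.const Ω 0)) = c • B.indicator 1 := by
        ext ω
        by_cases hω : ω ∈ B <;> simp [hω]
      simp only [hcoe, Pi.smul_apply, integral_smul, integral_indicator_one hB, map_smul, hν B hB]
    | add _ hf hg =>
      rw [SimpleFunc.coe_add, map_add, ← hf, ← hg]
      exact integral_add (integrable_of_mem_boundedMeasurable (simpleFunc_mem_boundedMeasurable _))
        (integrable_of_mem_boundedMeasurable (simpleFunc_mem_boundedMeasurable _))
  have hint : ∀ {f : Ω → ℝ}, f ∈ boundedMeasurable Ω → Integrable f ν := fun hf =>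
    integrable_of_mem_boundedMeasurable hf
  have hone : ∫ _, (1 : ℝ) ∂ν = π 1 := by
    rw [integral_const, smul_eq_mul, mul_one, hν _ MeasurableSet.univ, Set.indicator_univ]
  have hclose : ∀ ε : ℝ, 0 < ε → |∫ ω, w ω ∂ν - π w| ≤ ε * π 1 := fun ε hε => by
    obtain ⟨s, hs⟩ := exists_simpleFunc_le_le_add hw hε
    have hsm := simpleFunc_mem_boundedMeasurable s
    have h1m : (1 : Ω → ℝ) ∈ boundedMeasurable Ω := ⟨measurable_const, 1, by simp⟩
    have hπ1 : π s ≤ π w := map_le_map_of_nonneg hπ hsm hw fun ω => (hs ω).1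
    have hπ2 : π w ≤ π s + ε * π 1 := by
      rw [← smul_eq_mul, ← map_smul, ← map_add]
      exact map_le_map_of_nonneg hπ hw (add_mem hsm (Submodule.smul_mem _ ε h1m)) fun ω => by
        simpa using (hs ω).2
    have hν1 : π s ≤ ∫ ω, w ω ∂ν := by
      rw [← hsimple]
      exact integral_mono (hint hsm) (hint hw) fun ω => (hs ω).1
    have hν2 : ∫ ω, w ω ∂ν ≤ π s + ε * π 1 := by
      rw [← hsimple, ← hone, ← integral_const_mul, ← integral_add (hint hsm) (by fun_prop)]
      exact integral_mono (hint hw) ((hint hsm).add (by fun_prop)) fun ω => by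
        simpa using (hs ω).2
    rw [abs_le]
    constructor <;> linarith
  have hlim : Tendsto (fun ε : ℝ => ε * π 1) (𝓝[>] 0) (𝓝 0) := by
    simpa only [zero_mul, id] using
      ((tendsto_id (x := 𝓝 (0 : ℝ))).mono_left nhdsWithin_le_nhds).mul_const (π 1)
  exact sub_eq_zero.1 (abs_nonpos_iff.1
    (ge_of_tendsto hlim (eventually_mem_nhdsWithin.mono hclose)))

theorem exists_density_of_positive {μ : Measure Ω} [IsFiniteMeasure μ]
    (hπ : ∀ w ∈ boundedMeasurable Ω, (∀ ω, 0 ≤ w ω) → 0 ≤ π w) {D r : ℝ} (hr : 0 < r)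
    (hle : ∀ B, MeasurableSet B → π (B.indicator 1) ≤ D * μ.real B ^ r) :
    ∃ ρ : Ω → ℝ, Measurable ρ ∧ (∀ ω, 0 ≤ ρ ω) ∧ Integrable ρ μ ∧
      ∀ w ∈ boundedMeasurable Ω, ∫ ω, ρ ω * w ω ∂μ = π w := by
  have hnn : ∀ B, MeasurableSet B → 0 ≤ π (B.indicator 1) := fun B hB =>
    hπ _ (indicator_mem_boundedMeasurable hB) (Set.indicator_nonneg (by simp))
  obtain ⟨ν, hν⟩ := exists_measure_apply_eq_ofReal hπ fun s hs hanti hs0 => by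
    have hμ : Tendsto (fun n => D * μ.real (s n) ^ r) atTop (𝓝 0) := by
      have := tendsto_measure_iInter_atTop (μ := μ) (fun n => (hs n).nullMeasurableSet) hanti
        ⟨0, measure_ne_top _ _⟩
      rw [hs0, measure_empty] at this
      simpa only [ENNReal.toReal_zero, Real.zero_rpow hr.ne', mul_zero, Function.comp_def,
        measureReal_def] using
        (((ENNReal.tendsto_toReal ENNReal.zero_ne_top).comp this).rpow_const
          (Or.inr hr.le)).const_mul D
    exact squeeze_zero (fun n => hnn _ (hs n)) (fun n => hle _ (hs n)) hμ
  have : IsFiniteMeasure ν := ⟨by rw [hν _ MeasurableSet.univ]; exact ENNReal.ofReal_lt_top⟩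
  have hac : ν ≪ μ := Measure.AbsolutelyContinuous.mk fun B hB h0 => by
    rw [hν B hB, ENNReal.ofReal_eq_zero]
    simpa only [measureReal_def, h0, ENNReal.toReal_zero, Real.zero_rpow hr.ne', mul_zero]
      using hle B hB
  have hint : ∀ w ∈ boundedMeasurable Ω, ∫ ω, w ω ∂ν = π w := fun w =>
    integral_eq_of_forall_indicator hπ fun B hB => by
      rw [measureReal_def, hν B hB, ENNReal.toReal_ofReal (hnn B hB)]
  exact ⟨fun ω => (ν.rnDeriv μ ω).toReal, (Measure.measurable_rnDeriv ν μ).ennreal_toReal,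
    fun _ => ENNReal.toReal_nonneg, Measure.integrable_toReal_rnDeriv, fun w hw =>
      (integral_rnDeriv_smul hac).trans (hint w hw)⟩

end PositiveFunctional

variable {Ω X : Type*} [MeasurableSpace Ω] {μ : Measure Ω} [NormedAddCommGroup X]
  [NormedSpace ℝ X] {T : (Ω → ℝ) →ₗ[ℝ] X} {q C : ℝ}

/-- The renorming of the bounded measurable functions with `q`-concavity constant `1`. -/
noncomputable abbrev bmNorm (T : (Ω → ℝ) →ₗ[ℝ] X) (q : ℝ) (f : Ω → ℝ) : ℝ :=
  concaveNorm (boundedMeasurable Ω) T q f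

/-- `ρ` is the density of `w ↦ φ (|x| w)`, where `φ` is a norming functional of `|x|`. -/
structure IsNormingDensity (μ : Measure Ω) (T : (Ω → ℝ) →ₗ[ℝ] X) (q : ℝ) (x ρ : Ω → ℝ) :
    Prop where
  measurable : Measurable ρ
  nonneg : ∀ ω, 0 ≤ ρ ω
  integrable : Integrable ρ μ
  integral_eq_one : ∫ ω, ρ ω ∂μ = 1
  le : ∀ w ∈ boundedMeasurable Ω, (∀ ω, 0 ≤ w ω) → ∫ ω, ρ ω * w ω ∂μ ≤ bmNorm T q (x * w)
  ge : ∀ w ∈ boundedMeasurable Ω, (∀ ω, 0 ≤ w ω) →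
    bmNorm T q (x * w) ^ q ≤ ∫ ω, ρ ω * w ω ^ q ∂μ

theorem IsMeasureRep.norm_indicator_le (h : IsMeasureRep μ T q C) {B : Set Ω}
    (hB : MeasurableSet B) : ‖T (B.indicator 1)‖ ≤ μ.real B ^ (1 / q) := by
  have hpow : (fun ω => |B.indicator (1 : Ω → ℝ) ω| ^ q) = B.indicator 1 := by
    ext ω
    by_cases hω : ω ∈ B <;> simp [hω, h.isConcaveRep.q_pos.ne']
  have hle := h.norm_le _ (indicator_mem_boundedMeasurable hB)
  rwa [hpow, integral_indicator_one hB] at hle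

theorem IsMeasureRep.bmNorm_mul_indicator_le (h : IsMeasureRep μ T q C) {x : Ω → ℝ}
    {b : ℝ} (hb : ∀ ω, |x ω| ≤ b) {B : Set Ω}
    (hB : MeasurableSet B) : bmNorm T q (x * B.indicator 1) ≤ C * |b| * μ.real B ^ (1 / q) := by
  have hrep := h.isConcaveRep
  have hI : B.indicator (1 : Ω → ℝ) ∈ boundedMeasurable Ω := indicator_mem_boundedMeasurable hB
  have hC : 0 ≤ C := zero_le_one.trans hrep.one_le_C
  calc bmNorm T q (x * B.indicator 1) ≤ bmNorm T q (b • B.indicator 1) :=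
        hrep.concaveNorm_mono (Submodule.smul_mem _ b hI) fun ω => by
          rw [Pi.mul_apply, Pi.smul_apply, smul_eq_mul, abs_mul, abs_mul]
          exact mul_le_mul_of_nonneg_right ((hb ω).trans (le_abs_self b)) (abs_nonneg _)
    _ ≤ C * ‖T (b • B.indicator 1)‖ := hrep.concaveNorm_le (Submodule.smul_mem _ b hI)
    _ = C * |b| * ‖T (B.indicator 1)‖ := by
        rw [map_smul, norm_smul, Real.norm_eq_abs, mul_assoc]
    _ ≤ C * |b| * μ.real B ^ (1 / q) := by
        have := h.norm_indicator_le hB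
        gcongr

theorem IsMeasureRep.exists_isNormingDensity [IsFiniteMeasure μ] (h : IsMeasureRep μ T q C)
    {x : Ω → ℝ} (hx : x ∈ boundedMeasurable Ω) (hN : bmNorm T q x = 1) :
    ∃ ρ, IsNormingDensity μ T q x ρ := by
  have hrep := h.isConcaveRep
  obtain ⟨π, hπ⟩ := hrep.exists_isNorming hx hN
  obtain ⟨b, hb⟩ := hx.2
  have hdom : ∀ B, MeasurableSet B → π (B.indicator 1) ≤ C * |b| * μ.real B ^ (1 / q) :=
    fun B hB => (hπ.le _ (indicator_mem_boundedMeasurable hB)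
      (Set.indicator_nonneg (by simp))).trans (h.bmNorm_mul_indicator_le hb hB)
  obtain ⟨ρ, hρm, hρ0, hρi, hρ⟩ :=
    exists_density_of_positive hπ.nonneg (one_div_pos.2 hrep.q_pos) hdom
  refine ⟨ρ, hρm, hρ0, hρi, ?_, fun w hw hw0 => ?_, fun w hw hw0 => ?_⟩
  · simpa [hπ.one] using hρ _ (hrep.const_mem 1)
  · exact (hρ w hw).trans_le (hπ.le w hw hw0)
  · exact (hπ.ge w hw hw0).trans_eq (hρ _ (hrep.rpow_mem hw hrep.q_pos.le)).symm

end Density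

section Estimates

open MeasureTheory

theorem one_add_rpow_sub_one_le {q t : ℝ} (hq : 1 ≤ q) (ht0 : 0 ≤ t) (ht1 : t ≤ 1) :
    ((1 + t) ^ q - 1) / q ≤ t + 2 ^ q * t ^ 2 := by
  have hq0 : 0 < q := by linarith
  have h1t : 0 < 1 + t := by linarith
  have hpos : 0 < (1 + t) ^ q := Real.rpow_pos_of_pos h1t q
  have hinv : 1 - q * t ≤ ((1 + t) ^ q)⁻¹ := by
    have hbern := one_add_mul_self_le_rpow_one_add (s := -(t / (1 + t))) (by
      rw [neg_le_neg_iff, div_le_one h1t]; linarith) hq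
    rw [show 1 + -(t / (1 + t)) = (1 + t)⁻¹ by field_simp; ring, Real.inv_rpow h1t.le] at hbern
    nlinarith [div_le_self ht0 (show 1 ≤ 1 + t by linarith)]
  have hslope : (1 + t) ^ q - 1 ≤ q * t * (1 + t) ^ q := by
    have := mul_le_mul_of_nonneg_right hinv hpos.le
    rw [inv_mul_cancel₀ hpos.ne'] at this
    linarith
  have hchord : (1 + t) ^ q ≤ 1 + t * (2 ^ q - 1) := by
    have := (convexOn_rpow hq).2 (show (1 : ℝ) ∈ Set.Ici 0 by simp)
      (show (2 : ℝ) ∈ Set.Ici 0 by simp) (show 0 ≤ 1 - t by linarith) ht0 (by ring)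
    simp only [smul_eq_mul, Real.one_rpow, mul_one] at this
    rw [show 1 - t + t * 2 = 1 + t by ring] at this
    linarith
  rw [div_le_iff₀ hq0]
  calc (1 + t) ^ q - 1 ≤ q * t * (1 + t * (2 ^ q - 1)) := hslope.trans (by gcongr)
    _ ≤ (t + 2 ^ q * t ^ 2) * q := by nlinarith [mul_nonneg hq0.le (sq_nonneg t)]

theorem one_add_mul_rpow_one_div_le {q t s : ℝ} (hq : 1 ≤ q) (ht0 : 0 ≤ t) (ht1 : t ≤ 1)
    (hs0 : 0 ≤ s) (hs1 : s ≤ 1) :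
    (1 + ((1 + t) ^ q - 1) * s) ^ (1 / q) ≤ 1 + t * s + 2 ^ q * t ^ 2 := by
  have hq0 : 0 < q := by linarith
  have hone : 1 ≤ (1 + t) ^ q := Real.one_le_rpow (by linarith) hq0.le
  calc (1 + ((1 + t) ^ q - 1) * s) ^ (1 / q) ≤ 1 + 1 / q * (((1 + t) ^ q - 1) * s) :=
        rpow_one_add_le_one_add_mul_self (by nlinarith) (by positivity) ((div_le_one hq0).2 hq)
    _ = 1 + ((1 + t) ^ q - 1) / q * s := by ring
    _ ≤ 1 + (t + 2 ^ q * t ^ 2) * s := by gcongr; exact one_add_rpow_sub_one_le hq ht0 ht1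
    _ ≤ 1 + t * s + 2 ^ q * t ^ 2 := by
        nlinarith [mul_le_of_le_one_right (show 0 ≤ 2 ^ q * t ^ 2 by positivity) hs1]

theorem le_mul_sqrt_of_forall_mul_le {a c ε : ℝ} (hc : 0 ≤ c) (ha : a ≤ 1)
    (h : ∀ t, 0 < t → t ≤ 1 → t * a ≤ c * t ^ 2 + 2 * ε) : a ≤ (c + 2) * √ε := by
  have hlt : ∀ δ, √ε < δ → a ≤ (c + 2) * δ := fun δ hδ => by
    have hδ0 : 0 < δ := (Real.sqrt_nonneg ε).trans_lt hδ
    rcases le_total δ 1 with h1 | h1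
    · have hεδ : ε ≤ δ ^ 2 := (Real.sqrt_le_left hδ0.le).1 hδ.le
      refine le_of_mul_le_mul_left ((h δ hδ0 h1).trans ?_) hδ0
      linarith
    · nlinarith
  have hlim : Tendsto (fun δ => (c + 2) * δ) (𝓝[>] √ε) (𝓝 ((c + 2) * √ε)) :=
    ((continuous_const.mul continuous_id).tendsto _).mono_left nhdsWithin_le_nhds
  exact ge_of_tendsto hlim (eventually_mem_nhdsWithin.mono hlt)

theorem one_add_smul_indicator_mem_Icc {Ω : Type*} {t : ℝ} (ht : 0 ≤ t) (B : Set Ω) (ω : Ω) :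
    (1 + t • B.indicator (1 : Ω → ℝ)) ω ∈ Set.Icc 1 (1 + t) := by
  by_cases hω : ω ∈ B <;> simp [hω, ht]

namespace IsConcaveRep

variable {Ω X : Type*} [NormedAddCommGroup X] [NormedSpace ℝ X] {A : Submodule ℝ (Ω → ℝ)}
  {T : (Ω → ℝ) →ₗ[ℝ] X} {q C : ℝ} {f g k : Ω → ℝ}

theorem concaveNorm_congr_abs (h : IsConcaveRep A T q C) (hf : f ∈ A) (hg : g ∈ A)
    (hfg : ∀ ω, |f ω| = |g ω|) : concaveNorm A T q f = concaveNorm A T q g :=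
  le_antisymm (h.concaveNorm_mono hg fun ω => (hfg ω).le)
    (h.concaveNorm_mono hf fun ω => (hfg ω).ge)

theorem concaveNorm_le_add_of_abs_le_add (h : IsConcaveRep A T q C) (hg : g ∈ A) (hk : k ∈ A)
    (hle : ∀ ω, |f ω| ≤ |g ω| + |k ω|) :
    concaveNorm A T q f ≤ concaveNorm A T q g + concaveNorm A T q k := by
  have hgA := h.abs_mem hg
  have hkA := h.abs_mem hk
  rw [← h.concaveNorm_congr_abs hgA hg fun ω => abs_abs _,
    ← h.concaveNorm_congr_abs hkA hk fun ω => abs_abs _]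
  exact (h.concaveNorm_mono (add_mem hgA hkA) fun ω => (hle ω).trans (le_abs_self _)).trans
    (h.concaveNorm_add_le hgA hkA)

end IsConcaveRep

variable {Ω X : Type*} [MeasurableSpace Ω] {μ : Measure Ω} {B : Set Ω} {x y ρ σ : Ω → ℝ}

/-- The units of the algebra of bounded measurable functions: their absolute value is bounded and
bounded away from `0`. -/
def boundedUnits (Ω : Type*) [MeasurableSpace Ω] : Set (Ω → ℝ) :=
  {x | x ∈ boundedMeasurable Ω ∧ ∃ a > 0, ∀ ω, a ≤ |x ω|}

theorem ne_zero_of_mem_boundedUnits (hx : x ∈ boundedUnits Ω) (ω : Ω) : x ω ≠ 0 := by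
  obtain ⟨-, a, ha, hax⟩ := hx
  exact abs_pos.1 (ha.trans_le (hax ω))

theorem abs_div_mem_boundedMeasurable (hx : x ∈ boundedUnits Ω) (hy : y ∈ boundedMeasurable Ω) :
    (fun ω => |y ω / x ω|) ∈ boundedMeasurable Ω := by
  obtain ⟨⟨hxm, -⟩, a, ha, hax⟩ := hx
  obtain ⟨hym, b, hb⟩ := hy
  refine ⟨(hym.div hxm).abs, b / a, fun ω => ?_⟩
  rw [abs_abs, abs_div]
  exact div_le_div₀ ((abs_nonneg _).trans (hb ω)) (hb ω) ha (hax ω)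

theorem integrable_mul_of_mem_boundedMeasurable {w : Ω → ℝ} (hρ : Integrable ρ μ)
    (hw : w ∈ boundedMeasurable Ω) : Integrable (fun ω => ρ ω * w ω) μ := by
  obtain ⟨hm, c, hc⟩ := hw
  exact hρ.mul_bdd hm.aestronglyMeasurable (Filter.Eventually.of_forall hc)

theorem one_add_smul_indicator_mem_boundedMeasurable (hB : MeasurableSet B) (t : ℝ) :
    1 + t • B.indicator (1 : Ω → ℝ) ∈ boundedMeasurable Ω :=
  add_mem ⟨measurable_one, 1, by simp⟩
    (Submodule.smul_mem _ t (indicator_mem_boundedMeasurable hB))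

theorem integral_mul_one_add_smul_indicator (hρ : Integrable ρ μ) (hB : MeasurableSet B) (t : ℝ) :
    ∫ ω, ρ ω * (1 + t • B.indicator (1 : Ω → ℝ)) ω ∂μ =
      ∫ ω, ρ ω ∂μ + t * ∫ ω in B, ρ ω ∂μ := by
  have hpt : ∀ ω, ρ ω * (1 + t • B.indicator (1 : Ω → ℝ)) ω = ρ ω + t * B.indicator ρ ω :=
    fun ω => by by_cases hω : ω ∈ B <;> simp [hω, mul_add, mul_comm]
  simp only [hpt]
  rw [integral_add hρ ((hρ.indicator hB).const_mul t), integral_const_mul, integral_indicator hB]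

theorem integral_abs_sub_le_of_setIntegral {c : ℝ} (hρm : Measurable ρ) (hσm : Measurable σ)
    (hρ : Integrable ρ μ) (hσ : Integrable σ μ)
    (hρσ : ∀ B, MeasurableSet B → ∫ ω in B, ρ ω ∂μ - ∫ ω in B, σ ω ∂μ ≤ c)
    (hσρ : ∀ B, MeasurableSet B → ∫ ω in B, σ ω ∂μ - ∫ ω in B, ρ ω ∂μ ≤ c) :
    ∫ ω, |ρ ω - σ ω| ∂μ ≤ 2 * c := by
  have hBm : MeasurableSet {ω | σ ω ≤ ρ ω} := measurableSet_le hσm hρm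
  have hd : Integrable (fun ω => |ρ ω - σ ω|) μ := (hρ.sub hσ).abs
  rw [← integral_add_compl hBm hd, two_mul]
  refine add_le_add ?_ ?_
  · rw [setIntegral_congr_fun hBm fun ω (hω : σ ω ≤ ρ ω) => abs_of_nonneg (sub_nonneg.2 hω),
      integral_sub hρ.integrableOn hσ.integrableOn]
    exact hρσ _ hBm
  · rw [setIntegral_congr_fun hBm.compl fun ω (hω : ¬σ ω ≤ ρ ω) =>
        (abs_sub_comm _ _).trans (abs_of_nonneg (sub_nonneg.2 (not_le.1 hω).le)),
      integral_sub hσ.integrableOn hρ.integrableOn]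
    exact hσρ _ hBm.compl

theorem integral_min_eq (hρ : Integrable ρ μ) (hσ : Integrable σ μ) :
    ∫ ω, min (ρ ω) (σ ω) ∂μ =
      (∫ ω, ρ ω ∂μ + ∫ ω, σ ω ∂μ - ∫ ω, |ρ ω - σ ω| ∂μ) / 2 := by
  have hadd : Integrable (fun ω => ρ ω + σ ω) μ := hρ.add hσ
  have hsub : Integrable (fun ω => |ρ ω - σ ω|) μ := (hρ.sub hσ).abs
  have hmin : ∀ ω, min (ρ ω) (σ ω) = (ρ ω + σ ω - |ρ ω - σ ω|) / 2 := fun ω => by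
    linarith [min_add_max (ρ ω) (σ ω), max_sub_min_eq_abs' (ρ ω) (σ ω)]
  simp only [hmin]
  rw [integral_div, integral_sub hadd hsub, integral_add hρ hσ]

theorem sq_posPart_one_sub_le {r : ℝ} (hr : 0 < r) : max (1 - r) 0 ^ 2 ≤ r + r⁻¹ - 2 := by
  rw [show r + r⁻¹ - 2 = (1 - r) ^ 2 * r⁻¹ by field_simp; ring]
  rcases le_total r 1 with h | h
  · rw [max_eq_left (by linarith)]
    exact le_mul_of_one_le_right (sq_nonneg _) ((one_le_inv₀ hr).2 h)
  · rw [max_eq_right (by linarith), zero_pow two_ne_zero]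
    exact mul_nonneg (sq_nonneg _) (inv_nonneg.2 hr.le)

theorem integral_mul_sq_le {m f : Ω → ℝ} (hm : Integrable m μ) (hm0 : ∀ ω, 0 ≤ m ω)
    (hm1 : ∫ ω, m ω ∂μ ≤ 1) (hmf : Integrable (fun ω => m ω * f ω) μ)
    (hmf2 : Integrable (fun ω => m ω * f ω ^ 2) μ) :
    (∫ ω, m ω * f ω ∂μ) ^ 2 ≤ ∫ ω, m ω * f ω ^ 2 ∂μ := by
  set I := ∫ ω, m ω * f ω ∂μ with hI
  have hvar : 0 ≤ ∫ ω, m ω * (f ω - I) ^ 2 ∂μ :=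
    integral_nonneg fun ω => mul_nonneg (hm0 ω) (sq_nonneg _)
  have hexp : ∀ ω, m ω * (f ω - I) ^ 2 =
      m ω * f ω ^ 2 - 2 * I * (m ω * f ω) + I ^ 2 * m ω := fun ω => by ring
  simp only [hexp] at hvar
  have hsub : Integrable (fun ω => m ω * f ω ^ 2 - 2 * I * (m ω * f ω)) μ :=
    hmf2.sub (hmf.const_mul _)
  rw [integral_add hsub (hm.const_mul _), integral_sub hmf2 (hmf.const_mul _),
    integral_const_mul, integral_const_mul, ← hI] at hvar
  nlinarith [mul_le_of_le_one_right (sq_nonneg I) hm1]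

theorem integral_mul_le_integral_abs_sub_add {f : Ω → ℝ} (hρ : Integrable ρ μ)
    (hσ : Integrable σ μ) (hf : f ∈ boundedMeasurable Ω) (hf0 : ∀ ω, 0 ≤ f ω)
    (hf1 : ∀ ω, f ω ≤ 1) :
    ∫ ω, ρ ω * f ω ∂μ ≤ ∫ ω, |ρ ω - σ ω| ∂μ + ∫ ω, min (ρ ω) (σ ω) * f ω ∂μ := by
  have hd : Integrable (fun ω => |ρ ω - σ ω|) μ := (hρ.sub hσ).abs
  have hm : Integrable (fun ω => min (ρ ω) (σ ω) * f ω) μ :=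
    integrable_mul_of_mem_boundedMeasurable (hρ.inf hσ) hf
  rw [← integral_add hd hm]
  refine integral_mono (integrable_mul_of_mem_boundedMeasurable hρ hf) (hd.add hm) fun ω => ?_
  have hsplit : ρ ω ≤ |ρ ω - σ ω| + min (ρ ω) (σ ω) := by
    linarith [max_sub_min_eq_abs' (ρ ω) (σ ω), le_max_left (ρ ω) (σ ω)]
  calc ρ ω * f ω ≤ (|ρ ω - σ ω| + min (ρ ω) (σ ω)) * f ω :=
        mul_le_mul_of_nonneg_right hsplit (hf0 ω)
    _ ≤ |ρ ω - σ ω| + min (ρ ω) (σ ω) * f ω := by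
      rw [add_mul]
      gcongr
      exact mul_le_of_le_one_right (abs_nonneg _) (hf1 ω)

/-- With `m = min ρ σ`, integrating `((1 - r)⁺)² ≤ r + r⁻¹ - 2` against `m` bounds
`∫ m ((1 - r)⁺)²` by `‖ρ - σ‖₁`. -/
theorem integral_mul_posPart_one_sub_le {r : Ω → ℝ} (hρ : Integrable ρ μ) (hσ : Integrable σ μ)
    (hρ0 : ∀ ω, 0 ≤ ρ ω) (hσ0 : ∀ ω, 0 ≤ σ ω) (hρ1 : ∫ ω, ρ ω ∂μ = 1) (hσ1 : ∫ ω, σ ω ∂μ = 1)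
    (hr0 : ∀ ω, 0 < r ω) (hr : r ∈ boundedMeasurable Ω)
    (hr' : (fun ω => (r ω)⁻¹) ∈ boundedMeasurable Ω)
    (hρr : ∫ ω, ρ ω * r ω ∂μ ≤ 1) (hσr : ∫ ω, σ ω * (r ω)⁻¹ ∂μ ≤ 1) :
    ∫ ω, ρ ω * max (1 - r ω) 0 ∂μ ≤
      ∫ ω, |ρ ω - σ ω| ∂μ + √(∫ ω, |ρ ω - σ ω| ∂μ) := by
  have hint := fun {k w : Ω → ℝ} (hk : Integrable k μ) (hw : w ∈ boundedMeasurable Ω) =>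
    integrable_mul_of_mem_boundedMeasurable hk hw
  set m : Ω → ℝ := fun ω => min (ρ ω) (σ ω)
  set f : Ω → ℝ := fun ω => max (1 - r ω) 0
  have hm : Integrable m μ := hρ.inf hσ
  have hm0 : ∀ ω, 0 ≤ m ω := fun ω => le_min (hρ0 ω) (hσ0 ω)
  have hmint : ∫ ω, m ω ∂μ = 1 - (∫ ω, |ρ ω - σ ω| ∂μ) / 2 := by
    rw [integral_min_eq hρ hσ, hρ1, hσ1]
    ring
  have hf0 : ∀ ω, 0 ≤ f ω := fun ω => le_max_right _ _
  have hf1 : ∀ ω, f ω ≤ 1 := fun ω => max_le (by linarith [hr0 ω]) zero_le_one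
  have hf : f ∈ boundedMeasurable Ω :=
    ⟨(measurable_const.sub hr.1).max measurable_const, 1, fun ω =>
      (abs_of_nonneg (hf0 ω)).trans_le (hf1 ω)⟩
  have hf2 : (fun ω => f ω ^ 2) ∈ boundedMeasurable Ω :=
    ⟨hf.1.pow_const 2, 1, fun ω =>
      (abs_of_nonneg (sq_nonneg _)).trans_le (pow_le_one₀ (hf0 ω) (hf1 ω))⟩
  have hmr : ∫ ω, m ω * r ω ∂μ ≤ 1 := (integral_mono (hint hm hr) (hint hρ hr) fun ω =>
    mul_le_mul_of_nonneg_right (min_le_left _ _) (hr0 ω).le).trans hρr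
  have hmr' : ∫ ω, m ω * (r ω)⁻¹ ∂μ ≤ 1 := (integral_mono (hint hm hr') (hint hσ hr') fun ω =>
    mul_le_mul_of_nonneg_right (min_le_right _ _) (inv_nonneg.2 (hr0 ω).le)).trans hσr
  have hmf2 : ∫ ω, m ω * f ω ^ 2 ∂μ ≤ ∫ ω, |ρ ω - σ ω| ∂μ := by
    have hadd : Integrable (fun ω => m ω * r ω + m ω * (r ω)⁻¹) μ :=
      (hint hm hr).add (hint hm hr')
    calc ∫ ω, m ω * f ω ^ 2 ∂μ ≤ ∫ ω, (m ω * r ω + m ω * (r ω)⁻¹ - 2 * m ω) ∂μ :=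
          integral_mono (hint hm hf2) (hadd.sub (hm.const_mul 2))
            fun ω => by
              simpa only [mul_add, mul_sub, mul_comm (m ω) 2] using
                mul_le_mul_of_nonneg_left (sq_posPart_one_sub_le (hr0 ω)) (hm0 ω)
      _ = ∫ ω, m ω * r ω ∂μ + ∫ ω, m ω * (r ω)⁻¹ ∂μ - 2 * ∫ ω, m ω ∂μ := by
          rw [integral_sub hadd (hm.const_mul 2), integral_add (hint hm hr) (hint hm hr'),
            integral_const_mul]
      _ ≤ ∫ ω, |ρ ω - σ ω| ∂μ := by linarith
  have hd0 : 0 ≤ ∫ ω, |ρ ω - σ ω| ∂μ := integral_nonneg fun ω => abs_nonneg _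
  have hmf : ∫ ω, m ω * f ω ∂μ ≤ √(∫ ω, |ρ ω - σ ω| ∂μ) :=
    Real.le_sqrt_of_sq_le <| (integral_mul_sq_le hm hm0 (by linarith) (hint hm hf)
      (hint hm hf2)).trans hmf2
  exact (integral_mul_le_integral_abs_sub_add hρ hσ hf hf0 hf1).trans (add_le_add_right hmf _)

variable [NormedAddCommGroup X] [NormedSpace ℝ X] {T : (Ω → ℝ) →ₗ[ℝ] X} {q C : ℝ}

namespace IsNormingDensity

theorem setIntegral_le_one (hρ : IsNormingDensity μ T q x ρ) (B : Set Ω) :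
    ∫ ω in B, ρ ω ∂μ ≤ 1 := by
  rw [← hρ.integral_eq_one]
  exact setIntegral_le_integral hρ.integrable (Filter.Eventually.of_forall hρ.nonneg)

theorem setIntegral_nonneg (hρ : IsNormingDensity μ T q x ρ) (B : Set Ω) :
    0 ≤ ∫ ω in B, ρ ω ∂μ :=
  integral_nonneg hρ.nonneg

theorem integral_mul_abs_div_le (hρ : IsNormingDensity μ T q x ρ) (h : IsMeasureRep μ T q C)
    (hx : x ∈ boundedUnits Ω) {v : Ω → ℝ} (hv : v ∈ boundedMeasurable Ω) :
    ∫ ω, ρ ω * |v ω / x ω| ∂μ ≤ bmNorm T q v := by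
  have hdiv := abs_div_mem_boundedMeasurable hx hv
  refine (hρ.le _ hdiv fun ω => abs_nonneg _).trans_eq
    (h.isConcaveRep.concaveNorm_congr_abs (h.isConcaveRep.mul_mem hx.1 hdiv) hv fun ω => ?_)
  rw [Pi.mul_apply, abs_mul, abs_abs, ← abs_mul,
    mul_div_cancel₀ _ (ne_zero_of_mem_boundedUnits hx ω)]

theorem bmNorm_mul_one_add_smul_indicator_le (hσ : IsNormingDensity μ T q y σ)
    (h : IsMeasureRep μ T q C) (hB : MeasurableSet B) {t : ℝ} (ht0 : 0 ≤ t) (ht1 : t ≤ 1) :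
    bmNorm T q (y * (1 + t • B.indicator 1)) ≤
      1 + t * ∫ ω in B, σ ω ∂μ + 2 ^ q * t ^ 2 := by
  have hq0 := h.isConcaveRep.q_pos
  have hpow : ∀ ω, (1 + t • B.indicator (1 : Ω → ℝ)) ω ^ q =
      (1 + ((1 + t) ^ q - 1) • B.indicator (1 : Ω → ℝ)) ω := fun ω => by
    by_cases hω : ω ∈ B <;> simp [hω]
  have hge := hσ.ge _ (one_add_smul_indicator_mem_boundedMeasurable hB t) fun ω =>
    zero_le_one.trans (one_add_smul_indicator_mem_Icc ht0 B ω).1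
  simp only [hpow] at hge
  rw [integral_mul_one_add_smul_indicator hσ.integrable hB, hσ.integral_eq_one] at hge
  refine le_trans ?_ (one_add_mul_rpow_one_div_le h.isConcaveRep.one_le_q ht0 ht1
    (hσ.setIntegral_nonneg B) (hσ.setIntegral_le_one B))
  rwa [one_div, Real.le_rpow_inv_iff_of_pos concaveNorm_nonneg ?_ hq0]
  exact (Real.rpow_nonneg concaveNorm_nonneg q).trans hge

theorem setIntegral_sub_le (hρ : IsNormingDensity μ T q x ρ) (hσ : IsNormingDensity μ T q y σ)
    (h : IsMeasureRep μ T q C) (hx : x ∈ boundedUnits Ω) (hy : y ∈ boundedMeasurable Ω)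
    (hB : MeasurableSet B) :
    ∫ ω in B, ρ ω ∂μ - ∫ ω in B, σ ω ∂μ ≤ (2 ^ q + 2) * √(bmNorm T q (x - y)) := by
  have hr := h.isConcaveRep
  refine le_mul_sqrt_of_forall_mul_le (by positivity)
    (by linarith [hρ.setIntegral_le_one B, hσ.setIntegral_nonneg B]) fun t ht0 ht1 => ?_
  set w : Ω → ℝ := 1 + t • B.indicator 1
  have hw : w ∈ boundedMeasurable Ω := one_add_smul_indicator_mem_boundedMeasurable hB t
  have hw1 : ∀ ω, w ω ∈ Set.Icc 1 (1 + t) := one_add_smul_indicator_mem_Icc ht0.le B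
  have hxy := sub_mem hx.1 hy
  have hyw := hr.mul_mem hy hw
  have hxyw := hr.mul_mem hxy hw
  have hint := fun {v : Ω → ℝ} (hv : v ∈ boundedMeasurable Ω) =>
    integrable_mul_of_mem_boundedMeasurable hρ.integrable (abs_div_mem_boundedMeasurable hx hv)
  have hdiff : bmNorm T q ((x - y) * w) ≤ 2 * bmNorm T q (x - y) := by
    rw [two_mul]
    refine hr.concaveNorm_le_add_of_abs_le_add hxy hxy fun ω => ?_
    rw [Pi.mul_apply, abs_mul, ← two_mul, mul_comm, abs_of_nonneg (by linarith [(hw1 ω).1])]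
    exact mul_le_mul_of_nonneg_right (by linarith [(hw1 ω).2]) (abs_nonneg _)
  have hsplit : ∀ ω, ρ ω * w ω ≤
      ρ ω * |(y * w) ω / x ω| + ρ ω * |((x - y) * w) ω / x ω| := fun ω => by
    rw [← mul_add]
    refine mul_le_mul_of_nonneg_left ?_ (hρ.nonneg ω)
    refine le_trans (le_of_eq ?_) ((le_abs_self _).trans (abs_add_le _ _))
    have := ne_zero_of_mem_boundedUnits hx ω
    simp only [Pi.mul_apply, Pi.sub_apply]
    field_simp
    ring
  have hchain : 1 + t * ∫ ω in B, ρ ω ∂μ ≤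
      1 + t * ∫ ω in B, σ ω ∂μ + 2 ^ q * t ^ 2 + 2 * bmNorm T q (x - y) := by
    calc 1 + t * ∫ ω in B, ρ ω ∂μ = ∫ ω, ρ ω * w ω ∂μ := by
          rw [integral_mul_one_add_smul_indicator hρ.integrable hB, hρ.integral_eq_one]
      _ ≤ ∫ ω, ρ ω * |(y * w) ω / x ω| ∂μ + ∫ ω, ρ ω * |((x - y) * w) ω / x ω| ∂μ := by
          rw [← integral_add (hint hyw) (hint hxyw)]
          exact integral_mono (integrable_mul_of_mem_boundedMeasurable hρ.integrable hw)
            ((hint hyw).add (hint hxyw)) hsplit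
      _ ≤ bmNorm T q (y * w) + bmNorm T q ((x - y) * w) :=
          add_le_add (hρ.integral_mul_abs_div_le h hx hyw) (hρ.integral_mul_abs_div_le h hx hxyw)
      _ ≤ _ := add_le_add (hσ.bmNorm_mul_one_add_smul_indicator_le h hB ht0.le ht1) hdiff
  linarith

theorem integral_abs_sub_le (hρ : IsNormingDensity μ T q x ρ) (hσ : IsNormingDensity μ T q y σ)
    (h : IsMeasureRep μ T q C) (hx : x ∈ boundedUnits Ω) (hy : y ∈ boundedUnits Ω) :
    ∫ ω, |ρ ω - σ ω| ∂μ ≤ 2 * ((2 ^ q + 2) * √(bmNorm T q (x - y))) := by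
  refine integral_abs_sub_le_of_setIntegral hρ.measurable hσ.measurable hρ.integrable
    hσ.integrable (fun B hB => hρ.setIntegral_sub_le hσ h hx hy.1 hB) fun B hB => ?_
  rw [bmNorm, h.isConcaveRep.concaveNorm_congr_abs (sub_mem hx.1 hy.1) (sub_mem hy.1 hx.1)
    fun ω => abs_sub_comm _ _]
  exact hσ.setIntegral_sub_le hρ h hy hx.1 hB

theorem bmNorm_mul_le_of_le_one (hρ : IsNormingDensity μ T q x ρ) (h : IsMeasureRep μ T q C)
    {f : Ω → ℝ} (hf : f ∈ boundedMeasurable Ω) (hf0 : ∀ ω, 0 ≤ f ω) (hf1 : ∀ ω, f ω ≤ 1) :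
    bmNorm T q (x * f) ≤ (∫ ω, ρ ω * f ω ∂μ) ^ (1 / q) := by
  have hq0 := h.isConcaveRep.q_pos
  rw [one_div, Real.le_rpow_inv_iff_of_pos concaveNorm_nonneg
    (integral_nonneg fun ω => mul_nonneg (hρ.nonneg ω) (hf0 ω)) hq0]
  refine (hρ.ge f hf hf0).trans (integral_mono
    (integrable_mul_of_mem_boundedMeasurable hρ.integrable (h.isConcaveRep.rpow_mem hf hq0.le))
    (integrable_mul_of_mem_boundedMeasurable hρ.integrable hf) fun ω =>
      mul_le_mul_of_nonneg_left ?_ (hρ.nonneg ω))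
  exact Real.rpow_le_self_of_le_one (hf0 ω) (hf1 ω) h.isConcaveRep.one_le_q

theorem bmNorm_mul_posPart_le (hρ : IsNormingDensity μ T q x ρ)
    (hσ : IsNormingDensity μ T q y σ) (h : IsMeasureRep μ T q C) (hx : x ∈ boundedUnits Ω)
    (hy : y ∈ boundedUnits Ω) (hNx : bmNorm T q x = 1) (hNy : bmNorm T q y = 1) :
    bmNorm T q (x * fun ω => max (1 - |y ω / x ω|) 0) ≤
      (∫ ω, |ρ ω - σ ω| ∂μ + √(∫ ω, |ρ ω - σ ω| ∂μ)) ^ (1 / q) := by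
  have hr := h.isConcaveRep
  have hinv : ∀ ω, |y ω / x ω|⁻¹ = |x ω / y ω| := fun ω => by rw [← abs_inv, inv_div]
  have hrA := abs_div_mem_boundedMeasurable hx hy.1
  have hr0 : ∀ ω, 0 < |y ω / x ω| := fun ω =>
    abs_pos.2 (div_ne_zero (ne_zero_of_mem_boundedUnits hy ω) (ne_zero_of_mem_boundedUnits hx ω))
  have hf0 : ∀ ω, 0 ≤ max (1 - |y ω / x ω|) 0 := fun ω => le_max_right _ _
  refine (hρ.bmNorm_mul_le_of_le_one h
    (hr.comp_one hrA (Φ := fun a => max (1 - a) 0) (by fun_prop)) hf0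
    fun ω => max_le (by linarith [hr0 ω]) zero_le_one).trans
    (Real.rpow_le_rpow (integral_nonneg fun ω => mul_nonneg (hρ.nonneg ω) (hf0 ω)) ?_
      (one_div_nonneg.2 hr.q_pos.le))
  exact integral_mul_posPart_one_sub_le hρ.integrable hσ.integrable hρ.nonneg hσ.nonneg
    hρ.integral_eq_one hσ.integral_eq_one hr0 hrA
    (by simpa only [hinv] using abs_div_mem_boundedMeasurable hy hx.1)
    ((hρ.integral_mul_abs_div_le h hx hy.1).trans_eq hNy)
    (by simpa only [hinv] using (hσ.integral_mul_abs_div_le h hy hx.1).trans_eq hNx)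

end IsNormingDensity

end Estimates

section SignedEstimates

open MeasureTheory

theorem abs_mul_abs_sub_mul_abs_le (a b : ℝ) :
    |(a * |a| - b * |b|)| ≤ |a - b| * |a| + |a - b| * |b| := by
  have hsplit : a * |a| - b * |b| = (a - b) * |a| + b * (|a| - |b|) := by ring
  calc |(a * |a| - b * |b|)| ≤ |((a - b) * |a|)| + |(b * (|a| - |b|))| :=
        hsplit ▸ abs_add_le _ _
    _ = |a - b| * |a| + |b| * |(|a| - |b|)| := by rw [abs_mul, abs_mul, abs_abs]
    _ ≤ |a - b| * |a| + |a - b| * |b| := by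
      rw [mul_comm |b|]
      exact add_le_add_right
        (mul_le_mul_of_nonneg_right (abs_abs_sub_abs_le a b) (abs_nonneg b)) _

theorem sq_sub_le_two_mul_abs (a b : ℝ) : (a - b) ^ 2 ≤ 2 * |(a * |a| - b * |b|)| := by
  have hle := le_abs_self (a * |a| - b * |b|)
  have hge := neg_abs_le (a * |a| - b * |b|)
  rcases abs_cases a with ⟨ha, ha'⟩ | ⟨ha, ha'⟩ <;>
    rcases abs_cases b with ⟨hb, hb'⟩ | ⟨hb, hb'⟩ <;> rcases le_total a b with hab | hab <;>
    rw [ha, hb] at hle hge ⊢ <;> nlinarith [sq_nonneg (a + b)]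

theorem abs_mul_posPart_one_sub_abs_div {a : ℝ} (ha : a ≠ 0) (b : ℝ) :
    |a * max (1 - |b / a|) 0| = max (|a| - |b|) 0 := by
  have ha' : 0 < |a| := abs_pos.2 ha
  rw [abs_mul, abs_of_nonneg (le_max_right (1 - |b / a|) 0), mul_max_of_nonneg _ _ ha'.le,
    mul_zero, abs_div, mul_sub, mul_one, mul_div_cancel₀ _ ha'.ne']

section WithSign

variable {Ω : Type*} {x y ρ σ : Ω → ℝ} {ω : Ω}

/-- `ρ` with the signs of `x`, a zero of `x` counting as negative. -/
noncomputable def withSign (x ρ : Ω → ℝ) : Ω → ℝ := fun ω => if 0 < x ω then ρ ω else -ρ ω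

/-- The set where `x` and `y` have different signs, a zero counting as negative. -/
def signDiff (x y : Ω → ℝ) : Set Ω := symmDiff {ω | 0 < x ω} {ω | 0 < y ω}

theorem abs_withSign (x ρ : Ω → ℝ) (ω : Ω) : |withSign x ρ ω| = |ρ ω| := by
  rw [withSign]
  split_ifs <;> simp

theorem withSign_abs_self (x : Ω → ℝ) : withSign x (fun ω => |x ω|) = x := by
  ext ω
  rcases lt_or_ge 0 (x ω) with h | h
  · simp only [withSign, if_pos h, abs_of_pos h]
  · simp only [withSign, if_neg h.not_gt, abs_of_nonpos h, neg_neg]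

theorem withSign_sqrt_mul_abs (hρ : ∀ ω, 0 ≤ ρ ω) (ω : Ω) :
    withSign x (fun ω => √(ρ ω)) ω * |withSign x (fun ω => √(ρ ω)) ω| = withSign x ρ ω := by
  rw [abs_withSign, abs_of_nonneg (Real.sqrt_nonneg _)]
  simp only [withSign]
  split_ifs <;> simp [hρ ω]

theorem abs_withSign_sub_of_mem (h : ω ∈ signDiff x y) (ρ σ : Ω → ℝ) :
    |withSign x ρ ω - withSign y σ ω| = |ρ ω + σ ω| := by
  rcases h with ⟨hx : 0 < x ω, hy : ¬0 < y ω⟩ | ⟨hy : 0 < y ω, hx : ¬0 < x ω⟩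
  · simp only [withSign, if_pos hx, if_neg hy, sub_neg_eq_add]
  · simp only [withSign, if_neg hx, if_pos hy, ← abs_neg (ρ ω + σ ω), neg_add']

theorem abs_withSign_sub_of_notMem (h : ω ∉ signDiff x y) (ρ σ : Ω → ℝ) :
    |withSign x ρ ω - withSign y σ ω| = |ρ ω - σ ω| := by
  have hiff : 0 < x ω ↔ 0 < y ω := by
    simp only [signDiff, Set.mem_symmDiff, Set.mem_ofPred_eq] at h
    tauto
  by_cases hx : 0 < x ω
  · simp only [withSign, if_pos hx, if_pos (hiff.1 hx)]
  · simp only [withSign, if_neg hx, if_neg (mt hiff.2 hx), neg_sub_neg, abs_sub_comm (σ ω)]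

theorem abs_sub_of_mem_signDiff (h : ω ∈ signDiff x y) : |x ω - y ω| = |x ω| + |y ω| := by
  have hadd := abs_withSign_sub_of_mem h (fun ω => |x ω|) (fun ω => |y ω|)
  rw [withSign_abs_self, withSign_abs_self] at hadd
  exact hadd.trans (abs_of_nonneg (add_nonneg (abs_nonneg _) (abs_nonneg _)))

theorem abs_sub_of_notMem_signDiff (h : ω ∉ signDiff x y) :
    |x ω - y ω| = |(|x ω| - |y ω|)| := by
  simpa only [withSign_abs_self] using
    abs_withSign_sub_of_notMem h (fun ω => |x ω|) (fun ω => |y ω|)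

theorem abs_sub_le_abs_withSign_sub (hρ : ∀ ω, 0 ≤ ρ ω) (hσ : ∀ ω, 0 ≤ σ ω) (ω : Ω) :
    |ρ ω - σ ω| ≤ |withSign x ρ ω - withSign y σ ω| := by
  simpa only [abs_withSign, abs_of_nonneg (hρ ω), abs_of_nonneg (hσ ω)] using
    abs_abs_sub_abs_le (withSign x ρ ω) (withSign y σ ω)

end WithSign

variable {Ω : Type*} [MeasurableSpace Ω] {μ : Measure Ω} {B : Set Ω} {x y f g ρ σ : Ω → ℝ}

theorem measurable_withSign (hx : Measurable x) (hρ : Measurable ρ) :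
    Measurable (withSign x ρ) :=
  Measurable.ite (measurableSet_lt measurable_const hx) hρ hρ.neg

theorem measurableSet_signDiff (hx : Measurable x) (hy : Measurable y) :
    MeasurableSet (signDiff x y) :=
  (measurableSet_lt measurable_const hx).symmDiff (measurableSet_lt measurable_const hy)

theorem integrable_withSign (hx : Measurable x) (hρm : Measurable ρ) (hρ : Integrable ρ μ) :
    Integrable (withSign x ρ) μ :=
  hρ.mono (measurable_withSign hx hρm).aestronglyMeasurable
    (Filter.Eventually.of_forall fun ω => (abs_withSign x ρ ω).le)

theorem integral_mul_indicator_one (hB : MeasurableSet B) (ρ : Ω → ℝ) :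
    ∫ ω, ρ ω * B.indicator (1 : Ω → ℝ) ω ∂μ = ∫ ω in B, ρ ω ∂μ := by
  rw [← integral_indicator hB]
  refine integral_congr_ae (Filter.Eventually.of_forall fun ω => ?_)
  by_cases hω : ω ∈ B <;> simp [hω]

theorem norm_toLp_two_sq (hf : MemLp f 2 μ) : ‖hf.toLp f‖ ^ 2 = ∫ ω, f ω ^ 2 ∂μ := by
  rw [← real_inner_self_eq_norm_sq, L2.inner_def]
  refine integral_congr_ae ?_
  filter_upwards [hf.coeFn_toLp] with ω hω
  rw [hω, real_inner_self_eq_norm_sq, Real.norm_eq_abs, sq_abs]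

theorem integral_abs_mul_abs_le (hf : MemLp f 2 μ) (hg : MemLp g 2 μ) :
    ∫ ω, |f ω| * |g ω| ∂μ ≤ ‖hf.toLp f‖ * ‖hg.toLp g‖ := by
  have hnorm : ∀ {k : Ω → ℝ} (hk : MemLp k 2 μ), ‖hk.abs.toLp _‖ = ‖hk.toLp k‖ := fun hk => by
    rw [← sq_eq_sq₀ (norm_nonneg _) (norm_nonneg _), norm_toLp_two_sq, norm_toLp_two_sq]
    simp only [Pi.abs_apply, sq_abs]
  rw [← hnorm hf, ← hnorm hg]
  refine le_trans (le_of_eq ?_) (real_inner_le_norm (hf.abs.toLp _) (hg.abs.toLp _))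
  rw [L2.inner_def]
  refine integral_congr_ae ?_
  filter_upwards [hf.abs.coeFn_toLp, hg.abs.coeFn_toLp] with ω hfω hgω
  rw [hfω, hgω]
  exact mul_comm _ _

theorem integrable_mul_abs_sub_mul_abs (hf : MemLp f 2 μ) (hg : MemLp g 2 μ) :
    Integrable (fun ω => |(f ω * |f ω| - g ω * |g ω|)|) μ :=
  ((hf.integrable_mul hf.abs).sub (hg.integrable_mul hg.abs)).abs

theorem norm_toLp_sub_sq_le (hf : MemLp f 2 μ) (hg : MemLp g 2 μ) :
    ‖hf.toLp f - hg.toLp g‖ ^ 2 ≤ 2 * ∫ ω, |(f ω * |f ω| - g ω * |g ω|)| ∂μ := by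
  rw [← MemLp.toLp_sub, norm_toLp_two_sq, ← integral_const_mul]
  exact integral_mono (hf.sub hg).integrable_sq
    ((integrable_mul_abs_sub_mul_abs hf hg).const_mul 2) fun ω => sq_sub_le_two_mul_abs _ _

theorem integral_abs_mul_abs_sub_mul_abs_le (hf : MemLp f 2 μ) (hg : MemLp g 2 μ) :
    ∫ ω, |(f ω * |f ω| - g ω * |g ω|)| ∂μ ≤
      ‖hf.toLp f - hg.toLp g‖ * (‖hf.toLp f‖ + ‖hg.toLp g‖) := by
  have hint := fun {k : Ω → ℝ} (hk : MemLp k 2 μ) => (hf.sub hg).abs.integrable_mul hk.abs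
  calc ∫ ω, |(f ω * |f ω| - g ω * |g ω|)| ∂μ
      ≤ ∫ ω, (|(f - g) ω| * |f ω| + |(f - g) ω| * |g ω|) ∂μ :=
        integral_mono (integrable_mul_abs_sub_mul_abs hf hg) ((hint hf).add (hint hg))
          fun ω => abs_mul_abs_sub_mul_abs_le _ _
    _ = ∫ ω, |(f - g) ω| * |f ω| ∂μ + ∫ ω, |(f - g) ω| * |g ω| ∂μ :=
        integral_add (hint hf) (hint hg)
    _ ≤ _ := by
        rw [← MemLp.toLp_sub, mul_add]
        exact add_le_add (integral_abs_mul_abs_le _ _) (integral_abs_mul_abs_le _ _)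

variable {X : Type*} [NormedAddCommGroup X] [NormedSpace ℝ X] {T : (Ω → ℝ) →ₗ[ℝ] X} {q C : ℝ}

namespace IsNormingDensity

theorem integrable_abs_withSign_sub (hρ : IsNormingDensity μ T q x ρ)
    (hσ : IsNormingDensity μ T q y σ) (hx : Measurable x) (hy : Measurable y) :
    Integrable (fun ω => |withSign x ρ ω - withSign y σ ω|) μ :=
  ((integrable_withSign hx hρ.measurable hρ.integrable).sub
    (integrable_withSign hy hσ.measurable hσ.integrable)).abs

theorem setIntegral_signDiff_le (hρ : IsNormingDensity μ T q x ρ) (h : IsMeasureRep μ T q C)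
    (hx : x ∈ boundedMeasurable Ω) (hy : y ∈ boundedMeasurable Ω) :
    ∫ ω in signDiff x y, ρ ω ∂μ ≤ √(bmNorm T q (x - y)) := by
  have hB := measurableSet_signDiff hx.1 hy.1
  have hle : ∫ ω in signDiff x y, ρ ω ∂μ ≤ bmNorm T q (x - y) := by
    rw [← integral_mul_indicator_one hB]
    refine (hρ.le _ (indicator_mem_boundedMeasurable hB) (Set.indicator_nonneg (by simp))).trans
      (h.isConcaveRep.concaveNorm_mono (sub_mem hx hy) fun ω => ?_)
    rw [Pi.mul_apply, Pi.sub_apply]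
    by_cases hω : ω ∈ signDiff x y
    · rw [Set.indicator_of_mem hω, Pi.one_apply, mul_one, abs_sub_of_mem_signDiff hω]
      exact le_add_of_nonneg_right (abs_nonneg _)
    · rw [Set.indicator_of_notMem hω, mul_zero, abs_zero]
      exact abs_nonneg _
  exact Real.le_sqrt_of_sq_le ((pow_le_of_le_one (hρ.setIntegral_nonneg _)
    (hρ.setIntegral_le_one _) two_ne_zero).trans hle)

theorem integral_abs_withSign_sub_le (hρ : IsNormingDensity μ T q x ρ)
    (hσ : IsNormingDensity μ T q y σ) (h : IsMeasureRep μ T q C) (hx : x ∈ boundedUnits Ω)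
    (hy : y ∈ boundedUnits Ω) :
    ∫ ω, |withSign x ρ ω - withSign y σ ω| ∂μ ≤ (2 * 2 ^ q + 6) * √(bmNorm T q (x - y)) := by
  have hB := measurableSet_signDiff hx.1.1 hy.1.1
  have hd : Integrable (fun ω => |ρ ω - σ ω|) μ := (hρ.integrable.sub hσ.integrable).abs
  have hBi := (hρ.integrable.indicator hB).const_mul 2
  have hsplit : ∫ ω, |withSign x ρ ω - withSign y σ ω| ∂μ ≤
      ∫ ω, |ρ ω - σ ω| ∂μ + 2 * ∫ ω in signDiff x y, ρ ω ∂μ := by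
    rw [← integral_indicator hB, ← integral_const_mul, ← integral_add hd hBi]
    refine integral_mono (hρ.integrable_abs_withSign_sub hσ hx.1.1 hy.1.1) (hd.add hBi)
      fun ω => ?_
    by_cases hω : ω ∈ signDiff x y
    · simp only [abs_withSign_sub_of_mem hω, Set.indicator_of_mem hω,
        abs_of_nonneg (add_nonneg (hρ.nonneg ω) (hσ.nonneg ω))]
      linarith [neg_abs_le (ρ ω - σ ω)]
    · simp only [abs_withSign_sub_of_notMem hω, Set.indicator_of_notMem hω, mul_zero, add_zero,
        le_refl]
  have hset := hρ.setIntegral_signDiff_le h hx.1 hy.1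
  have habs := hρ.integral_abs_sub_le hσ h hx hy
  linarith

theorem bmNorm_abs_sub_abs_le (hρ : IsNormingDensity μ T q x ρ)
    (hσ : IsNormingDensity μ T q y σ) (h : IsMeasureRep μ T q C) (hx : x ∈ boundedUnits Ω)
    (hy : y ∈ boundedUnits Ω) (hNx : bmNorm T q x = 1) (hNy : bmNorm T q y = 1) :
    bmNorm T q (fun ω => |x ω| - |y ω|) ≤
      2 * (∫ ω, |ρ ω - σ ω| ∂μ + √(∫ ω, |ρ ω - σ ω| ∂μ)) ^ (1 / q) := by
  have hr := h.isConcaveRep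
  have hxy := hρ.bmNorm_mul_posPart_le hσ h hx hy hNx hNy
  have hyx := hσ.bmNorm_mul_posPart_le hρ h hy hx hNy hNx
  simp only [abs_sub_comm (σ _)] at hyx
  have hmem : ∀ {u v : Ω → ℝ}, u ∈ boundedUnits Ω → v ∈ boundedUnits Ω →
      (u * fun ω => max (1 - |v ω / u ω|) 0) ∈ boundedMeasurable Ω := fun hu hv =>
    hr.mul_mem hu.1 (hr.comp_one (abs_div_mem_boundedMeasurable hu hv.1)
      (Φ := fun a => max (1 - a) 0) (by fun_prop))
  refine (hr.concaveNorm_le_add_of_abs_le_add (hmem hx hy) (hmem hy hx) fun ω => ?_).trans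
    ((add_le_add hxy hyx).trans_eq (two_mul _).symm)
  rw [Pi.mul_apply, Pi.mul_apply,
    abs_mul_posPart_one_sub_abs_div (ne_zero_of_mem_boundedUnits hx ω),
    abs_mul_posPart_one_sub_abs_div (ne_zero_of_mem_boundedUnits hy ω), abs_le']
  constructor <;> linarith [le_max_left (|x ω| - |y ω|) 0, le_max_right (|x ω| - |y ω|) 0,
    le_max_left (|y ω| - |x ω|) 0, le_max_right (|y ω| - |x ω|) 0]

theorem bmNorm_mul_indicator_signDiff_le (hρ : IsNormingDensity μ T q x ρ)
    (hσ : IsNormingDensity μ T q y σ) (h : IsMeasureRep μ T q C) (hx : Measurable x)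
    (hy : Measurable y) :
    bmNorm T q (y * (signDiff x y).indicator 1) ≤
      (∫ ω, |withSign x ρ ω - withSign y σ ω| ∂μ) ^ (1 / q) := by
  have hB := measurableSet_signDiff hx hy
  refine (hσ.bmNorm_mul_le_of_le_one h (indicator_mem_boundedMeasurable hB)
    (Set.indicator_nonneg (by simp)) (Set.indicator_le_self' (by simp))).trans ?_
  rw [integral_mul_indicator_one hB]
  refine Real.rpow_le_rpow (hσ.setIntegral_nonneg _) ?_ (one_div_nonneg.2 h.isConcaveRep.q_pos.le)
  rw [← integral_indicator hB]
  refine integral_mono (hσ.integrable.indicator hB) (hρ.integrable_abs_withSign_sub hσ hx hy)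
    fun ω => ?_
  by_cases hω : ω ∈ signDiff x y
  · simp only [abs_withSign_sub_of_mem hω, Set.indicator_of_mem hω]
    exact le_trans (le_add_of_nonneg_left (hρ.nonneg ω)) (le_abs_self _)
  · simp only [Set.indicator_of_notMem hω]
    exact abs_nonneg _

theorem bmNorm_sub_le (hρ : IsNormingDensity μ T q x ρ) (hσ : IsNormingDensity μ T q y σ)
    (h : IsMeasureRep μ T q C) (hx : x ∈ boundedUnits Ω) (hy : y ∈ boundedUnits Ω)
    (hNx : bmNorm T q x = 1) (hNy : bmNorm T q y = 1) :
    bmNorm T q (x - y) ≤ 4 * (∫ ω, |withSign x ρ ω - withSign y σ ω| ∂μ +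
      √(∫ ω, |withSign x ρ ω - withSign y σ ω| ∂μ)) ^ (1 / q) := by
  have hr := h.isConcaveRep
  have hq0 := hr.q_pos
  set Δ := ∫ ω, |withSign x ρ ω - withSign y σ ω| ∂μ
  have hδ0 : 0 ≤ ∫ ω, |ρ ω - σ ω| ∂μ := integral_nonneg fun ω => abs_nonneg _
  have hδΔ : ∫ ω, |ρ ω - σ ω| ∂μ ≤ Δ :=
    integral_mono (hρ.integrable.sub hσ.integrable).abs
      (hρ.integrable_abs_withSign_sub hσ hx.1.1 hy.1.1)
      (abs_sub_le_abs_withSign_sub hρ.nonneg hσ.nonneg)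
  set k : Ω → ℝ := y * (signDiff x y).indicator 1 with hkdef
  have hk : k ∈ boundedMeasurable Ω :=
    hr.mul_mem hy.1 (indicator_mem_boundedMeasurable (measurableSet_signDiff hx.1.1 hy.1.1))
  have hsmul : bmNorm T q ((2 : ℝ) • k) = 2 * bmNorm T q k := by
    rw [bmNorm, hr.concaveNorm_smul hk, abs_two]
  have hpt : ∀ ω, |(x - y) ω| ≤ |(|x ω| - |y ω|)| + |((2 : ℝ) • k) ω| := fun ω => by
    by_cases hω : ω ∈ signDiff x y
    · simp only [Pi.sub_apply, abs_sub_of_mem_signDiff hω, hkdef, Pi.smul_apply, Pi.mul_apply,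
        Set.indicator_of_mem hω, Pi.one_apply, mul_one, smul_eq_mul, abs_mul, abs_two]
      linarith [le_abs_self (|x ω| - |y ω|)]
    · simp only [Pi.sub_apply, abs_sub_of_notMem_signDiff hω]
      exact le_add_of_nonneg_right (abs_nonneg _)
  calc bmNorm T q (x - y)
      ≤ bmNorm T q (fun ω => |x ω| - |y ω|) +
          bmNorm T q ((2 : ℝ) • k) :=
        hr.concaveNorm_le_add_of_abs_le_add (sub_mem (hr.abs_mem hx.1) (hr.abs_mem hy.1))
          (Submodule.smul_mem _ _ hk) hpt
    _ ≤ 2 * (Δ + √Δ) ^ (1 / q) + 2 * (Δ + √Δ) ^ (1 / q) := by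
        rw [hsmul]
        refine add_le_add ((hρ.bmNorm_abs_sub_abs_le hσ h hx hy hNx hNy).trans ?_)
          (mul_le_mul_of_nonneg_left
            ((hρ.bmNorm_mul_indicator_signDiff_le hσ h hx.1.1 hy.1.1).trans ?_) two_pos.le)
        · gcongr
        · have := hδ0.trans hδΔ
          gcongr
          exact le_add_of_nonneg_right (Real.sqrt_nonneg _)
    _ = 4 * (Δ + √Δ) ^ (1 / q) := by ring

theorem sq_withSign_sqrt (hρ : IsNormingDensity μ T q x ρ) (ω : Ω) :
    withSign x (fun ω => √(ρ ω)) ω ^ 2 = ρ ω := by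
  rw [← sq_abs, abs_withSign, sq_abs, Real.sq_sqrt (hρ.nonneg ω)]

theorem memLp_withSign_sqrt (hρ : IsNormingDensity μ T q x ρ) (hx : Measurable x) :
    MemLp (withSign x fun ω => √(ρ ω)) 2 μ := by
  rw [memLp_two_iff_integrable_sq
    (measurable_withSign hx hρ.measurable.sqrt).aestronglyMeasurable]
  simpa only [hρ.sq_withSign_sqrt] using hρ.integrable

theorem norm_toLp_withSign_sqrt (hρ : IsNormingDensity μ T q x ρ) (hx : Measurable x) :
    ‖(hρ.memLp_withSign_sqrt hx).toLp _‖ = 1 := by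
  rw [← sq_eq_sq₀ (norm_nonneg _) zero_le_one, norm_toLp_two_sq, one_pow]
  simpa only [hρ.sq_withSign_sqrt] using hρ.integral_eq_one

theorem norm_toLp_withSign_sqrt_sub_sq_le (hρ : IsNormingDensity μ T q x ρ)
    (hσ : IsNormingDensity μ T q y σ) (hx : Measurable x) (hy : Measurable y) :
    ‖(hρ.memLp_withSign_sqrt hx).toLp _ - (hσ.memLp_withSign_sqrt hy).toLp _‖ ^ 2 ≤
      2 * ∫ ω, |withSign x ρ ω - withSign y σ ω| ∂μ := by
  simpa only [withSign_sqrt_mul_abs hρ.nonneg, withSign_sqrt_mul_abs hσ.nonneg] using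
    norm_toLp_sub_sq_le (hρ.memLp_withSign_sqrt hx) (hσ.memLp_withSign_sqrt hy)

theorem integral_abs_withSign_sub_le_norm (hρ : IsNormingDensity μ T q x ρ)
    (hσ : IsNormingDensity μ T q y σ) (hx : Measurable x) (hy : Measurable y) :
    ∫ ω, |withSign x ρ ω - withSign y σ ω| ∂μ ≤
      2 * ‖(hρ.memLp_withSign_sqrt hx).toLp _ - (hσ.memLp_withSign_sqrt hy).toLp _‖ := by
  have hle := integral_abs_mul_abs_sub_mul_abs_le (hρ.memLp_withSign_sqrt hx)
    (hσ.memLp_withSign_sqrt hy)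
  rw [hρ.norm_toLp_withSign_sqrt hx, hσ.norm_toLp_withSign_sqrt hy] at hle
  simp only [withSign_sqrt_mul_abs hρ.nonneg, withSign_sqrt_mul_abs hσ.nonneg] at hle
  linarith

end IsNormingDensity

end SignedEstimates

section DenseRange

open MeasureTheory

theorem exists_mem_norm_normalize_sub_lt {E : Type*} [NormedAddCommGroup E] [NormedSpace ℝ E]
    {s : Set E} (hs : Dense s) {u : E} (hu : ‖u‖ = 1) {ε : ℝ} (hε : 0 < ε) :
    ∃ v ∈ s, v ≠ 0 ∧ ‖‖v‖⁻¹ • v - u‖ < ε := by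
  have hu0 : u ≠ 0 := norm_ne_zero_iff.1 (hu ▸ one_ne_zero)
  have hcont : Tendsto (fun v : E => ‖v‖⁻¹ • v) (𝓝 u) (𝓝 u) := by
    have hat : ContinuousAt (fun v : E => ‖v‖⁻¹ • v) u :=
      (continuousAt_id.norm.inv₀ (norm_ne_zero_iff.2 hu0)).smul continuousAt_id
    simpa only [ContinuousAt, hu, inv_one, one_smul] using hat
  obtain ⟨v, hvs, hv0, hvε⟩ := ((mem_closure_iff_frequently.1 (hs u)).and_eventually
    ((eventually_ne_nhds hu0).and (hcont (Metric.ball_mem_nhds u hε)))).exists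
  exact ⟨v, hvs, hv0, mem_ball_iff_norm.1 hvε⟩

theorem sub_sq_le_log_one_add {t : ℝ} (ht : 0 ≤ t) : t - t ^ 2 ≤ Real.log (1 + t) := by
  have ht1 : 0 < 1 + t := by linarith
  refine le_trans ?_ (Real.one_sub_inv_le_log_of_pos ht1)
  rw [le_sub_comm, inv_le_iff_one_le_mul₀ ht1]
  nlinarith [pow_nonneg ht 3]

section WithSign

variable {Ω : Type*} {x y : Ω → ℝ}

theorem withSign_withSign (hy : ∀ ω, 0 < y ω) (ρ : Ω → ℝ) :
    withSign (withSign x y) ρ = withSign x ρ := by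
  ext ω
  by_cases hω : 0 < x ω
  · simp only [withSign, if_pos hω, if_pos (hy ω)]
  · simp only [withSign, if_neg hω, if_neg (neg_neg_of_pos (hy ω)).not_gt]

theorem mul_abs_eq_withSign_sq (x : Ω → ℝ) (ω : Ω) :
    x ω * |x ω| = withSign x (fun ω => x ω ^ 2) ω := by
  rcases lt_or_ge 0 (x ω) with h | h
  · simp only [withSign, if_pos h, abs_of_pos h, sq]
  · simp only [withSign, if_neg h.not_gt, abs_of_nonpos h, sq, mul_neg]

theorem abs_withSign_sub_withSign (x ρ σ : Ω → ℝ) (ω : Ω) :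
    |withSign x ρ ω - withSign x σ ω| = |ρ ω - σ ω| :=
  abs_withSign_sub_of_notMem (by simp [signDiff]) ρ σ

end WithSign

variable {Ω X : Type*} [MeasurableSpace Ω] {μ : Measure Ω} {B : Set Ω} [NormedAddCommGroup X]
  [NormedSpace ℝ X] {T : (Ω → ℝ) →ₗ[ℝ] X} {q C t : ℝ} {x y ρ k : Ω → ℝ}

/-- The functions of norm one in `boundedUnits Ω`, for the renorming `bmNorm`. -/
def bmUnitSphere (T : (Ω → ℝ) →ₗ[ℝ] X) (q : ℝ) : Set (Ω → ℝ) :=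
  {x | x ∈ boundedUnits Ω ∧ bmNorm T q x = 1}

theorem log_mem_boundedMeasurable (hx : x ∈ boundedUnits Ω) :
    (fun ω => Real.log (x ω)) ∈ boundedMeasurable Ω := by
  obtain ⟨⟨hm, b, hb⟩, a, ha, hax⟩ := hx
  refine ⟨hm.log, max |Real.log a| |Real.log b|, fun ω => ?_⟩
  beta_reduce
  rw [← Real.log_abs (x ω)]
  exact abs_le_max_abs_abs (Real.log_le_log ha (hax ω))
    (Real.log_le_log (ha.trans_le (hax ω)) (hb ω))

theorem smul_mem_boundedUnits (hx : x ∈ boundedUnits Ω) {c : ℝ} (hc : c ≠ 0) :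
    c • x ∈ boundedUnits Ω := by
  obtain ⟨hx, a, ha, hax⟩ := hx
  refine ⟨Submodule.smul_mem _ _ hx, |c| * a, mul_pos (abs_pos.2 hc) ha, fun ω => ?_⟩
  rw [Pi.smul_apply, smul_eq_mul, abs_mul]
  exact mul_le_mul_of_nonneg_left (hax ω) (abs_nonneg c)

theorem mul_one_add_smul_indicator_mem_boundedUnits (hx : x ∈ boundedUnits Ω)
    (hB : MeasurableSet B) (ht : 0 ≤ t) : x * (1 + t • B.indicator 1) ∈ boundedUnits Ω := by
  obtain ⟨⟨hxm, b, hb⟩, a, ha, hax⟩ := hx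
  obtain ⟨hwm, c, hc⟩ := one_add_smul_indicator_mem_boundedMeasurable hB t
  refine ⟨⟨hxm.mul hwm, b * c, fun ω => ?_⟩, a, ha, fun ω => ?_⟩ <;> rw [Pi.mul_apply, abs_mul]
  · exact mul_le_mul (hb ω) (hc ω) (abs_nonneg _) ((abs_nonneg _).trans (hb ω))
  · exact (hax ω).trans (le_mul_of_one_le_right (abs_nonneg _)
      ((one_add_smul_indicator_mem_Icc ht B ω).1.trans (le_abs_self _)))

theorem withSign_mem_boundedUnits (hx : Measurable x) (hy : y ∈ boundedUnits Ω) :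
    withSign x y ∈ boundedUnits Ω := by
  obtain ⟨⟨hym, b, hb⟩, a, ha, hay⟩ := hy
  exact ⟨⟨measurable_withSign hx hym, b, fun ω => (abs_withSign x y ω).trans_le (hb ω)⟩, a, ha,
    fun ω => (hay ω).trans_eq (abs_withSign x y ω).symm⟩

theorem abs_mem_boundedUnits (hx : x ∈ boundedUnits Ω) : (fun ω => |x ω|) ∈ boundedUnits Ω := by
  obtain ⟨⟨hxm, hb⟩, ha⟩ := hx
  exact ⟨⟨hxm.abs, by simpa only [abs_abs] using hb⟩, by simpa only [abs_abs] using ha⟩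

theorem integral_mul_log_inv_smul_mul (hk : Integrable k μ) (hx : x ∈ boundedUnits Ω)
    (hB : MeasurableSet B) (ht : 0 ≤ t) {N : ℝ} (hN : N ≠ 0) :
    ∫ ω, k ω * Real.log ((N⁻¹ • (x * (1 + t • B.indicator (1 : Ω → ℝ)))) ω) ∂μ =
      ∫ ω, k ω * Real.log (x ω) ∂μ + Real.log (1 + t) * ∫ ω in B, k ω ∂μ -
        Real.log N * ∫ ω, k ω ∂μ := by
  have hpt : ∀ ω, k ω * Real.log ((N⁻¹ • (x * (1 + t • B.indicator (1 : Ω → ℝ)))) ω) =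
      k ω * Real.log (x ω) + Real.log (1 + t) * B.indicator k ω - Real.log N * k ω := fun ω => by
    have hw : (1 + t • B.indicator (1 : Ω → ℝ)) ω ≠ 0 :=
      (one_pos.trans_le (one_add_smul_indicator_mem_Icc ht B ω).1).ne'
    have hlog : k ω * Real.log ((1 + t • B.indicator (1 : Ω → ℝ)) ω) =
        Real.log (1 + t) * B.indicator k ω := by
      by_cases hω : ω ∈ B <;> simp [hω, mul_comm]
    have hx0 := ne_zero_of_mem_boundedUnits hx ω
    rw [Pi.smul_apply, Pi.mul_apply, smul_eq_mul,
      Real.log_mul (inv_ne_zero hN) (mul_ne_zero hx0 hw), Real.log_mul hx0 hw, Real.log_inv]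
    linear_combination hlog
  have hlogx := integrable_mul_of_mem_boundedMeasurable hk (log_mem_boundedMeasurable hx)
  have hlogB := (hk.indicator hB).const_mul (Real.log (1 + t))
  have hsum : Integrable
      (fun ω => k ω * Real.log (x ω) + Real.log (1 + t) * B.indicator k ω) μ := hlogx.add hlogB
  simp only [hpt]
  rw [integral_sub hsum (hk.const_mul _), integral_add hlogx hlogB, integral_const_mul,
    integral_const_mul, integral_indicator hB]

namespace IsMeasureRep

theorem norm_pos [IsProbabilityMeasure μ] (h : IsMeasureRep μ T q C) (hx : x ∈ boundedUnits Ω) :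
    0 < ‖T x‖ := by
  obtain ⟨hx, a, ha, hax⟩ := hx
  have hint : a ≤ ∫ ω, |x ω| ∂μ := by
    simpa using integral_mono (integrable_const a)
      (integrable_of_mem_boundedMeasurable (μ := μ) hx).abs hax
  exact pos_of_mul_pos_right ((ha.trans_le hint).trans_le (h.integral_le x hx))
    (zero_le_one.trans h.isConcaveRep.one_le_C)

theorem bmNorm_pos [IsProbabilityMeasure μ] (h : IsMeasureRep μ T q C)
    (hx : x ∈ boundedUnits Ω) : 0 < bmNorm T q x :=
  (h.norm_pos hx).trans_le (h.isConcaveRep.le_concaveNorm hx.1)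

theorem inv_smul_mem_bmUnitSphere [IsProbabilityMeasure μ] (h : IsMeasureRep μ T q C)
    (hx : x ∈ boundedUnits Ω) : (bmNorm T q x)⁻¹ • x ∈ bmUnitSphere T q := by
  have hN := h.bmNorm_pos hx
  refine ⟨smul_mem_boundedUnits hx (inv_ne_zero hN.ne'), ?_⟩
  rw [bmNorm, h.isConcaveRep.concaveNorm_smul hx.1, abs_of_pos (inv_pos.2 hN)]
  exact inv_mul_cancel₀ hN.ne'

theorem integral_mul_log_le [IsProbabilityMeasure μ] (h : IsMeasureRep μ T q C)
    (hk : Measurable k) {b : ℝ} (hk0 : ∀ ω, 0 ≤ k ω) (hkb : ∀ ω, k ω ≤ b)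
    (hx : x ∈ bmUnitSphere T q) : ∫ ω, k ω * Real.log (x ω) ∂μ ≤ b * C := by
  obtain ⟨hxu, hN⟩ := hx
  have hki : Integrable k μ := integrable_of_mem_boundedMeasurable
    ⟨hk, b, fun ω => (abs_of_nonneg (hk0 ω)).trans_le (hkb ω)⟩
  have hb : 0 ≤ b := by
    obtain ⟨ω⟩ := μ.nonempty_of_neZero
    exact (hk0 ω).trans (hkb ω)
  have hnorm : ‖T x‖ ≤ 1 := hN ▸ h.isConcaveRep.le_concaveNorm hxu.1
  calc ∫ ω, k ω * Real.log (x ω) ∂μ ≤ ∫ ω, b * |x ω| ∂μ := by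
        refine integral_mono
          (integrable_mul_of_mem_boundedMeasurable hki (log_mem_boundedMeasurable hxu))
          ((integrable_of_mem_boundedMeasurable hxu.1).abs.const_mul b) fun ω => ?_
        have hlog : Real.log (x ω) ≤ |x ω| := by
          rw [← Real.log_abs]
          exact Real.log_le_self (abs_nonneg _)
        exact (mul_le_mul_of_nonneg_left hlog (hk0 ω)).trans
          (mul_le_mul_of_nonneg_right (hkb ω) (abs_nonneg _))
    _ = b * ∫ ω, |x ω| ∂μ := integral_const_mul _ _
    _ ≤ b * (C * 1) := mul_le_mul_of_nonneg_left ((h.integral_le x hxu.1).trans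
        (mul_le_mul_of_nonneg_left hnorm (zero_le_one.trans h.isConcaveRep.one_le_C))) hb
    _ = b * C := by rw [mul_one]

theorem exists_forall_integral_mul_log_le [IsProbabilityMeasure μ] (h : IsMeasureRep μ T q C)
    (hk : k ∈ boundedMeasurable Ω) (hk0 : ∀ ω, 0 ≤ k ω) {δ : ℝ} (hδ : 0 < δ) :
    ∃ x ∈ bmUnitSphere T q, ∀ z ∈ bmUnitSphere T q,
      ∫ ω, k ω * Real.log (z ω) ∂μ ≤ ∫ ω, k ω * Real.log (x ω) ∂μ + δ := by
  obtain ⟨hkm, b, hb⟩ := hk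
  let E : (Ω → ℝ) → ℝ := fun x => ∫ ω, k ω * Real.log (x ω) ∂μ
  have hne : (bmUnitSphere T q).Nonempty := ⟨_, h.inv_smul_mem_bmUnitSphere
    ⟨h.isConcaveRep.const_mem 1, 1, one_pos, fun _ => abs_one.ge⟩⟩
  have hbdd : BddAbove (E '' bmUnitSphere T q) :=
    ⟨b * C, Set.forall_mem_image.2 fun x hx =>
      h.integral_mul_log_le hkm hk0 (fun ω => (le_abs_self _).trans (hb ω)) hx⟩
  obtain ⟨_, ⟨x, hx, rfl⟩, hxs⟩ := exists_lt_of_lt_csSup (hne.image E) (sub_lt_self _ hδ)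
  exact ⟨x, hx, fun z hz => (le_csSup hbdd ⟨z, hz, rfl⟩).trans (sub_lt_iff_lt_add.1 hxs).le⟩

end IsMeasureRep

namespace IsNormingDensity

-- Perturbing `x` to `x (1 + t 1_B)` changes the entropy by about `t ∫_B k` and the logarithm of
-- the norm by about `t ∫_B ρ`.
theorem setIntegral_sub_le_of_forall_integral_mul_log_le [IsProbabilityMeasure μ]
    (hρ : IsNormingDensity μ T q x ρ) (h : IsMeasureRep μ T q C) (hk : Integrable k μ)
    (hk0 : ∀ ω, 0 ≤ k ω) (hk1 : ∫ ω, k ω ∂μ = 1) (hx : x ∈ boundedUnits Ω) (ht0 : 0 < t)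
    (ht1 : t ≤ 1) (hmax : ∀ z ∈ bmUnitSphere T q,
      ∫ ω, k ω * Real.log (z ω) ∂μ ≤ ∫ ω, k ω * Real.log (x ω) ∂μ + t ^ 2)
    (hB : MeasurableSet B) : ∫ ω in B, k ω ∂μ - ∫ ω in B, ρ ω ∂μ ≤ (2 ^ q + 2) * t := by
  have hxw := mul_one_add_smul_indicator_mem_boundedUnits hx hB ht0.le
  have hN0 := h.bmNorm_pos hxw
  have hlogN : Real.log (bmNorm T q (x * (1 + t • B.indicator 1))) ≤
      t * ∫ ω in B, ρ ω ∂μ + 2 ^ q * t ^ 2 := by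
    linarith [Real.log_le_sub_one_of_pos hN0,
      hρ.bmNorm_mul_one_add_smul_indicator_le h hB ht0.le ht1]
  have hent := hmax _ (h.inv_smul_mem_bmUnitSphere hxw)
  rw [integral_mul_log_inv_smul_mul hk hx hB ht0.le hN0.ne', hk1, mul_one] at hent
  have hkB0 : 0 ≤ ∫ ω in B, k ω ∂μ := integral_nonneg hk0
  have hkB1 : ∫ ω in B, k ω ∂μ ≤ 1 :=
    hk1 ▸ setIntegral_le_integral hk (Filter.Eventually.of_forall hk0)
  have hlog := mul_le_mul_of_nonneg_right (sub_sq_le_log_one_add ht0.le) hkB0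
  refine le_of_mul_le_mul_left ?_ ht0
  linarith [mul_le_mul_of_nonneg_left hkB1 (sq_nonneg t)]

theorem congr_abs (hρ : IsNormingDensity μ T q x ρ) (h : IsMeasureRep μ T q C)
    (hx : x ∈ boundedMeasurable Ω) (hy : y ∈ boundedMeasurable Ω) (hxy : ∀ ω, |x ω| = |y ω|) :
    IsNormingDensity μ T q y ρ := by
  have hN : ∀ w ∈ boundedMeasurable Ω, bmNorm T q (x * w) = bmNorm T q (y * w) := fun w hw =>
    h.isConcaveRep.concaveNorm_congr_abs (h.isConcaveRep.mul_mem hx hw)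
      (h.isConcaveRep.mul_mem hy hw) fun ω => by
        rw [Pi.mul_apply, Pi.mul_apply, abs_mul, abs_mul, hxy]
  exact ⟨hρ.measurable, hρ.nonneg, hρ.integrable, hρ.integral_eq_one,
    fun w hw hw0 => hN w hw ▸ hρ.le w hw hw0, fun w hw hw0 => hN w hw ▸ hρ.ge w hw hw0⟩

end IsNormingDensity

theorem exists_boundedMeasurable_norm_toLp_eq_one [IsProbabilityMeasure μ] {g : Lp ℝ 2 μ}
    (hg : ‖g‖ = 1) {ε : ℝ} (hε : 0 < ε) :
    ∃ (f : Ω → ℝ) (hf : f ∈ boundedMeasurable Ω),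
      ‖(memLp_of_mem_boundedMeasurable (μ := μ) hf 2).toLp f‖ = 1 ∧
        ‖(memLp_of_mem_boundedMeasurable hf 2).toLp f - g‖ < ε := by
  obtain ⟨_, ⟨f, rfl⟩, hf0, hfg⟩ := exists_mem_norm_normalize_sub_lt
    (dense_toLp_boundedMeasurable (μ := μ) (p := 2) (by simp)) hg hε
  refine ⟨_, Submodule.smul_mem _ _ f.2, ?_, hfg⟩
  exact norm_smul_inv_norm (𝕜 := ℝ) hf0

namespace IsMeasureRep

theorem exists_forall_integral_abs_sub_le [IsProbabilityMeasure μ] (h : IsMeasureRep μ T q C)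
    (hk : k ∈ boundedMeasurable Ω) (hk0 : ∀ ω, 0 ≤ k ω) (hk1 : ∫ ω, k ω ∂μ = 1) {η : ℝ}
    (hη : 0 < η) :
    ∃ x ∈ bmUnitSphere T q, ∀ ρ, IsNormingDensity μ T q x ρ → ∫ ω, |k ω - ρ ω| ∂μ ≤ η := by
  have hki := integrable_of_mem_boundedMeasurable (μ := μ) hk
  set t : ℝ := min 1 (η / (2 * (2 ^ q + 2)))
  have ht0 : 0 < t := lt_min one_pos (by positivity)
  have htη : 2 * ((2 ^ q + 2) * t) ≤ η := by
    have hle : t ≤ η / (2 * (2 ^ q + 2)) := min_le_right _ _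
    rw [le_div_iff₀ (by positivity)] at hle
    linarith
  obtain ⟨x, hx, hmax⟩ := h.exists_forall_integral_mul_log_le hk hk0 (pow_pos ht0 2)
  refine ⟨x, hx, fun ρ hρ => ?_⟩
  have hset := fun B hB => hρ.setIntegral_sub_le_of_forall_integral_mul_log_le (B := B) h hki hk0
    hk1 hx.1 ht0 (min_le_left _ _) hmax hB
  refine (integral_abs_sub_le_of_setIntegral hk.1 hρ.measurable hki hρ.integrable hset
    fun B hB => ?_).trans htη
  linarith [hset Bᶜ hB.compl, integral_add_compl hB hki, integral_add_compl hB hρ.integrable,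
    hρ.integral_eq_one]

theorem exists_norm_toLp_withSign_sub_le [IsProbabilityMeasure μ] (h : IsMeasureRep μ T q C)
    {f : Ω → ℝ} (hf : f ∈ boundedMeasurable Ω) (hfm : MemLp f 2 μ) (hf1 : ‖hfm.toLp f‖ = 1)
    {ε : ℝ} (hε : 0 < ε) :
    ∃ x, ∃ hx : x ∈ bmUnitSphere T q, ∀ (ρ : Ω → ℝ) (hρ : IsNormingDensity μ T q x ρ),
      ‖(hρ.memLp_withSign_sqrt hx.1.1.1).toLp _ - hfm.toLp f‖ ≤ ε := by
  have hr := h.isConcaveRep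
  obtain ⟨x, ⟨hxu, hxN⟩, hxρ⟩ := h.exists_forall_integral_abs_sub_le (k := fun ω => f ω ^ 2)
    (hr.comp_one hf (Φ := fun a => a ^ 2) (by fun_prop)) (fun ω => sq_nonneg _)
    (by rw [← norm_toLp_two_sq hfm, hf1, one_pow]) (half_pos (pow_pos hε 2))
  have hsu := withSign_mem_boundedUnits hf.1 (abs_mem_boundedUnits hxu)
  have habs : ∀ ω, |withSign f (fun ω => |x ω|) ω| = |x ω| := fun ω => by
    rw [abs_withSign, abs_abs]
  refine ⟨withSign f fun ω => |x ω|,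
    ⟨hsu, (hr.concaveNorm_congr_abs hsu.1 hxu.1 habs).trans hxN⟩, fun ρ hρ => ?_⟩
  have hpt : ∀ ω, |(withSign (withSign f fun ω => |x ω|) (fun ω => √(ρ ω)) ω *
      |withSign (withSign f fun ω => |x ω|) (fun ω => √(ρ ω)) ω| - f ω * |f ω|)| =
        |f ω ^ 2 - ρ ω| := fun ω => by
    rw [withSign_sqrt_mul_abs hρ.nonneg, mul_abs_eq_withSign_sq,
      withSign_withSign fun ω => abs_pos.2 (ne_zero_of_mem_boundedUnits hxu ω),
      abs_withSign_sub_withSign, abs_sub_comm]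
  have hsq := norm_toLp_sub_sq_le (hρ.memLp_withSign_sqrt hsu.1.1) hfm
  rw [integral_congr_ae (.of_forall hpt)] at hsq
  refine (sq_le_sq₀ (norm_nonneg _) hε.le).1 (hsq.trans ?_)
  linarith [hxρ ρ (hρ.congr_abs h hsu.1 hxu.1 habs)]

theorem dense_image_boundedUnits [IsProbabilityMeasure μ] (h : IsMeasureRep μ T q C) :
    Dense (T '' boundedUnits Ω) := by
  have hr := h.isConcaveRep
  have hone : ‖T fun _ => 1‖ ≤ 1 := by
    simpa using h.norm_le _ (hr.const_mem 1)
  suffices hsub : T '' boundedMeasurable Ω ⊆ closure (T '' boundedUnits Ω) from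
    (h.dense.mono hsub).of_closure
  rintro _ ⟨f, hf, rfl⟩
  refine Metric.mem_closure_iff.2 fun ε hε => ?_
  have hmax : (fun ω => max |f ω| (ε / 2)) ∈ boundedUnits Ω :=
    ⟨hr.comp_one hf (Φ := fun s => max |s| (ε / 2)) (by fun_prop), ε / 2, half_pos hε,
      fun ω => (le_max_right _ _).trans (le_abs_self _)⟩
  have hg := withSign_mem_boundedUnits hf.1 hmax
  refine ⟨_, ⟨_, hg, rfl⟩, ?_⟩
  rw [dist_eq_norm, ← map_sub]
  have hle : ‖T (f - withSign f fun ω => max |f ω| (ε / 2))‖ ≤ ‖T ((ε / 2) • fun _ => 1)‖ := by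
    refine hr.mono _ (sub_mem hf hg.1) _ (Submodule.smul_mem _ _ (hr.const_mem 1)) fun ω => ?_
    have habs := abs_withSign_sub_withSign f (fun ω => |f ω|) (fun ω => max |f ω| (ε / 2)) ω
    rw [withSign_abs_self] at habs
    rw [Pi.sub_apply, habs, Pi.smul_apply, smul_eq_mul, mul_one, abs_of_pos (half_pos hε),
      abs_le]
    constructor
    · linarith [max_le_add_of_nonneg (abs_nonneg (f ω)) (half_pos hε).le]
    · linarith [le_max_left |f ω| (ε / 2)]
  rw [map_smul, norm_smul, Real.norm_of_nonneg (half_pos hε).le] at hle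
  linarith [mul_le_of_le_one_right (half_pos hε).le hone]

end IsMeasureRep

end DenseRange

section Spheres

open Metric

section ModulusOfContinuity

variable {A B D : Type*} [PseudoMetricSpace A] [PseudoMetricSpace B] [PseudoMetricSpace D]
  {φ ψ : ℝ≥0 → ℝ≥0} {F : A → B} {G : B → D}

namespace IsModulusOfContinuity

theorem isometry_comp (hF : IsModulusOfContinuity φ F) (hG : Isometry G) :
    IsModulusOfContinuity φ (G ∘ F) :=
  ⟨hF.1, hF.2.1, fun x y => (hG.nndist_eq _ _).trans_le (hF.2.2 x y)⟩

theorem comp_isometry (hG : IsModulusOfContinuity φ G) (hF : Isometry F) :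
    IsModulusOfContinuity φ (G ∘ F) :=
  ⟨hG.1, hG.2.1, fun x y => (hG.2.2 _ _).trans_eq (by rw [hF.nndist_eq])⟩

theorem comp (hG : IsModulusOfContinuity ψ G) (hF : IsModulusOfContinuity φ F)
    (hψ : Monotone ψ) : IsModulusOfContinuity (ψ ∘ φ) (G ∘ F) :=
  ⟨hG.1.comp hF.1, by rw [Function.comp_apply, hF.2.1, hG.2.1],
    fun x y => (hG.2.2 _ _).trans (hψ (hF.2.2 x y))⟩

theorem mono (hF : IsModulusOfContinuity φ F) (hψ : Continuous ψ) (hψ0 : ψ 0 = 0)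
    (hle : φ ≤ ψ) : IsModulusOfContinuity ψ F :=
  ⟨hψ, hψ0, fun x y => (hF.2.2 x y).trans (hle _)⟩

theorem of_denseRange {S : Type*} {i : S → A} (hi : DenseRange i) (hF : Continuous F)
    (hφ : Continuous φ) (hφ0 : φ 0 = 0)
    (hle : ∀ x y, nndist (F (i x)) (F (i y)) ≤ φ (nndist (i x) (i y))) :
    IsModulusOfContinuity φ F :=
  ⟨hφ, hφ0, hi.induction_on₂ (isClosed_le (by fun_prop) (by fun_prop)) hle⟩

end IsModulusOfContinuity

theorem exists_forall_lt_of_continuous (hφ : Continuous φ) (hφ0 : φ 0 = 0) {ε : ℝ} (hε : 0 < ε) :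
    ∃ δ > (0 : ℝ), ∀ t : ℝ≥0, (t : ℝ) < δ → (φ t : ℝ) < ε := by
  simpa only [hφ0, NNReal.dist_eq, NNReal.coe_zero, sub_zero, NNReal.abs_eq] using
    Metric.continuous_iff.1 hφ 0 ε hε

end ModulusOfContinuity

theorem exists_uniformEquiv_of_denseRange {S A B : Type*} [MetricSpace A] [CompleteSpace A]
    [MetricSpace B] [CompleteSpace B] {i : S → A} {j : S → B} (hi : DenseRange i)
    (hj : DenseRange j) {φ ψ : ℝ≥0 → ℝ≥0} (hφ : Continuous φ) (hφ0 : φ 0 = 0)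
    (hψ : Continuous ψ) (hψ0 : ψ 0 = 0)
    (hij : ∀ x y, nndist (j x) (j y) ≤ φ (nndist (i x) (i y)))
    (hji : ∀ x y, nndist (i x) (i y) ≤ ψ (nndist (j x) (j y))) :
    ∃ F : A ≃ᵤ B, IsModulusOfContinuity φ F ∧ IsModulusOfContinuity ψ F.symm := by
  -- For the metric that `i` induces on `S`, both `A` and `B` are completions of `S`.
  let _ : PseudoMetricSpace S := PseudoMetricSpace.induced i inferInstance
  have hjU : IsUniformInducing j := by
    refine Metric.isUniformInducing_iff.2 ⟨Metric.uniformContinuous_iff.2 fun ε hε => ?_,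
      fun ε hε => ?_⟩
    · obtain ⟨δ, hδ, h⟩ := exists_forall_lt_of_continuous hφ hφ0 hε
      exact ⟨δ, hδ, fun x y hxy => lt_of_le_of_lt (NNReal.coe_le_coe.2 (hij x y)) (h _ hxy)⟩
    · obtain ⟨δ, hδ, h⟩ := exists_forall_lt_of_continuous hψ hψ0 hε
      exact ⟨δ, hδ, fun hxy => lt_of_le_of_lt (NNReal.coe_le_coe.2 (hji _ _)) (h _ hxy)⟩
  let P : AbstractCompletion S := ⟨A, i, inferInstance, inferInstance, inferInstance, ⟨rfl⟩, hi⟩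
  let Q : AbstractCompletion S := ⟨B, j, inferInstance, inferInstance, inferInstance, hjU, hj⟩
  let F : A ≃ᵤ B := P.compareEquiv Q
  have hF : ∀ x, F (i x) = j x := P.compare_coe Q
  have hFsymm : ∀ x, F.symm (j x) = i x := Q.compare_coe P
  exact ⟨F, .of_denseRange hi F.continuous hφ hφ0 fun x y => by simpa only [hF] using hij x y,
    .of_denseRange hj F.symm.continuous hψ hψ0 fun x y => by simpa only [hFsymm] using hji x y⟩

section NormedSpace

variable {E F : Type*} [NormedAddCommGroup E] [NormedSpace ℝ E] [NormedAddCommGroup F]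
  [NormedSpace ℝ F]

theorem exists_mem_sphere_norm_smul_eq [Nontrivial E] (x : E) :
    ∃ y ∈ sphere (0 : E) 1, ‖x‖ • y = x := by
  rcases eq_or_ne x 0 with rfl | hx
  · obtain ⟨y, hy⟩ := (NormedSpace.sphere_nonempty (E := E) (x := 0)).2 zero_le_one
    exact ⟨y, hy, by rw [norm_zero, zero_smul]⟩
  · exact ⟨‖x‖⁻¹ • x, mem_sphere_zero_iff_norm.2 (norm_smul_inv_norm (𝕜 := ℝ) hx),
      smul_inv_smul₀ (norm_ne_zero_iff.2 hx) x⟩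

theorem separableSpace_of_sphere [Nontrivial E]
    [TopologicalSpace.SeparableSpace (sphere (0 : E) 1)] : TopologicalSpace.SeparableSpace E := by
  have hsurj : Function.Surjective fun p : ℝ × sphere (0 : E) 1 => p.1 • (p.2 : E) := fun x =>
    let ⟨y, hy, hyx⟩ := exists_mem_sphere_norm_smul_eq x
    ⟨(‖x‖, ⟨y, hy⟩), hyx⟩
  exact hsurj.denseRange.separableSpace (by fun_prop)

theorem finiteDimensional_of_isCompact_sphere [Nontrivial E]
    (hS : IsCompact (sphere (0 : E) 1)) : FiniteDimensional ℝ E := by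
  refine FiniteDimensional.of_isCompact_closedBall₀ ℝ zero_lt_one
    (((isCompact_Icc (a := (0 : ℝ)) (b := 1)).smul_set hS).of_isClosed_subset isClosed_closedBall
      fun x hx => ?_)
  obtain ⟨y, hy, hyx⟩ := exists_mem_sphere_norm_smul_eq x
  exact Set.mem_smul.2 ⟨‖x‖, ⟨norm_nonneg x, mem_closedBall_zero_iff.1 hx⟩, y, hy, hyx⟩

/-- The restriction of a linear isometry to the unit spheres. -/
def sphereIsometryEquiv (e : E ≃ₗᵢ[ℝ] F) : sphere (0 : E) 1 ≃ᵢ sphere (0 : F) 1 where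
  toFun x := ⟨e x, by simp⟩
  invFun y := ⟨e.symm y, by simp⟩
  left_inv x := by simp
  right_inv y := by simp
  isometry_toFun := Isometry.of_dist_eq fun x y => e.dist_map x y

end NormedSpace

section HilbertSpace

variable {H ι : Type*} [NormedAddCommGroup H] [InnerProductSpace ℝ H]

theorem dist_sq_eq_two_of_orthonormal {v : ι → H} (hv : Orthonormal ℝ v) {i j : ι} (hij : i ≠ j) :
    dist (v i) (v j) ^ 2 = 2 := by
  rw [dist_eq_norm, norm_sub_sq_real, hv.1, hv.1, hv.2 hij]
  norm_num

theorem countable_of_orthonormal [TopologicalSpace.SeparableSpace H] {v : ι → H}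
    (hv : Orthonormal ℝ v) : Countable ι := by
  refine Pairwise.countable_of_isOpen_disjoint (s := fun i => ball (v i) (1 / 2))
    (fun i j hij => ball_disjoint_ball ?_) (fun _ => isOpen_ball) fun i =>
      ⟨v i, mem_ball_self one_half_pos⟩
  nlinarith [dist_sq_eq_two_of_orthonormal hv hij, dist_nonneg (x := v i) (y := v j)]

theorem nonempty_linearIsometryEquiv_l2 [CompleteSpace H] [TopologicalSpace.SeparableSpace H]
    (hH : ¬FiniteDimensional ℝ H) : Nonempty (H ≃ₗᵢ[ℝ] lp (fun _ : ℕ => ℝ) 2) := by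
  obtain ⟨w, b, -⟩ := exists_hilbertBasis ℝ H
  have hcount : Countable w := countable_of_orthonormal b.orthonormal
  have hinf : Infinite w := not_finite_iff_infinite.1 fun hfin =>
    have := Fintype.ofFinite w
    hH b.toOrthonormalBasis.toBasis.finiteDimensional_of_finite
  obtain ⟨e⟩ := nonempty_equiv_of_countable (α := ℕ) (β := w)
  have hspan : ⊤ ≤ (Submodule.span ℝ (Set.range (b ∘ e))).topologicalClosure := by
    rw [e.surjective.range_comp, b.dense_span]
  exact ⟨(HilbertBasis.mk (b.orthonormal.comp e e.injective) hspan).repr⟩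

end HilbertSpace

theorem seminorm_normalize_sub_le {E : Type*} [AddCommGroup E] [Module ℝ E] (p : Seminorm ℝ E)
    {u v : E} (hu : 0 < p u) (hv : 0 < p v) :
    p ((p u)⁻¹ • u - (p v)⁻¹ • v) ≤ 2 * (p u)⁻¹ * p (u - v) := by
  have hsplit : (p u)⁻¹ • u - (p v)⁻¹ • v =
      (p u)⁻¹ • ((u - v) + (p v - p u) • (p v)⁻¹ • v) := by
    rw [sub_smul (p v), smul_inv_smul₀ hv.ne', sub_add_sub_cancel, smul_sub,
      inv_smul_smul₀ hu.ne']
  have hnormalize : p ((p v - p u) • (p v)⁻¹ • v) = |p v - p u| := by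
    rw [map_smul_eq_mul, map_smul_eq_mul, Real.norm_eq_abs, norm_inv, Real.norm_eq_abs,
      abs_of_pos hv, inv_mul_cancel₀ hv.ne', mul_one]
  calc p ((p u)⁻¹ • u - (p v)⁻¹ • v)
      = (p u)⁻¹ * p ((u - v) + (p v - p u) • (p v)⁻¹ • v) := by
        rw [hsplit, map_smul_eq_mul, norm_inv, Real.norm_eq_abs, abs_of_pos hu]
    _ ≤ (p u)⁻¹ * (p (u - v) + p (u - v)) := by
        gcongr
        refine (map_add_le_add p _ _).trans (add_le_add_right (hnormalize.trans_le ?_) _)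
        exact map_sub_rev p v u ▸ abs_sub_map_le_sub p v u
    _ = 2 * (p u)⁻¹ * p (u - v) := by ring

end Spheres

section Assembly

open MeasureTheory Metric

/-- The modulus of continuity of the homeomorphism from the unit sphere of a Banach lattice that is
`q`-concave with constant `C` onto the unit sphere of a Hilbert space, and of its inverse. -/
noncomputable def sphereModulus (q : ℝ) (C t : ℝ≥0) : ℝ≥0 :=
  Real.toNNReal (√(2 * ((2 * 2 ^ q + 6) * √(2 * C * t)))) +
    Real.toNNReal (8 * C * (2 * t + √(2 * t)) ^ (1 / q))

theorem continuous_sphereModulus {q : ℝ} (hq : 0 < q) (C : ℝ≥0) :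
    Continuous (sphereModulus q C) := by
  have hrpow : Continuous fun t : ℝ≥0 => (2 * (t : ℝ) + √(2 * t)) ^ (1 / q) :=
    Continuous.rpow_const (by fun_prop) fun _ => Or.inr (one_div_nonneg.2 hq.le)
  unfold sphereModulus
  fun_prop

theorem sphereModulus_zero {q : ℝ} (hq : 0 < q) (C : ℝ≥0) : sphereModulus q C 0 = 0 := by
  simp [sphereModulus, hq.ne']

theorem monotone_sphereModulus {q : ℝ} (hq : 0 < q) (C : ℝ≥0) : Monotone (sphereModulus q C) := by
  intro s t hst
  have : 0 ≤ 1 / q := one_div_nonneg.2 hq.le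
  unfold sphereModulus
  gcongr

/-- The norm `concaveNorm A T q` of a `q`-concave representation, as a seminorm on `A`. -/
noncomputable def IsConcaveRep.concaveSeminorm {Ω X : Type*} [NormedAddCommGroup X]
    [NormedSpace ℝ X] {A : Submodule ℝ (Ω → ℝ)} {T : (Ω → ℝ) →ₗ[ℝ] X} {q C : ℝ}
    (h : IsConcaveRep A T q C) : Seminorm ℝ A :=
  Seminorm.of (fun f => concaveNorm A T q f) (fun f g => h.concaveNorm_add_le f.2 g.2)
    fun c f => h.concaveNorm_smul f.2 c

namespace IsMeasureRep

variable {Ω X : Type*} [MeasurableSpace Ω] {μ : Measure Ω} [NormedAddCommGroup X]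
  [NormedSpace ℝ X] {T : (Ω → ℝ) →ₗ[ℝ] X} {q C : ℝ} {x y ρ σ : Ω → ℝ}

theorem norm_mem_Ioc (h : IsMeasureRep μ T q C) (hx : x ∈ bmUnitSphere T q) :
    ‖T x‖ ∈ Set.Ioc 0 1 := by
  have hr := h.isConcaveRep
  have hle : 1 ≤ C * ‖T x‖ := hx.2 ▸ hr.concaveNorm_le hx.1.1
  exact ⟨pos_of_mul_pos_right (one_pos.trans_le hle) (zero_le_one.trans hr.one_le_C),
    hx.2 ▸ hr.le_concaveNorm hx.1.1⟩

theorem norm_normalize_sub_le_bmNorm (h : IsMeasureRep μ T q C) (hx : x ∈ bmUnitSphere T q)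
    (hy : y ∈ bmUnitSphere T q) :
    ‖‖T x‖⁻¹ • T x - ‖T y‖⁻¹ • T y‖ ≤ 2 * C * bmNorm T q (x - y) := by
  have hr := h.isConcaveRep
  have hTx := (h.norm_mem_Ioc hx).1
  have hC : 0 ≤ C := zero_le_one.trans hr.one_le_C
  have hinv : ‖T x‖⁻¹ ≤ C :=
    (inv_le_iff_one_le_mul₀ hTx).2 (hx.2 ▸ hr.concaveNorm_le hx.1.1)
  have hsub : ‖T x - T y‖ ≤ bmNorm T q (x - y) :=
    map_sub T x y ▸ hr.le_concaveNorm (sub_mem hx.1.1 hy.1.1)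
  calc ‖‖T x‖⁻¹ • T x - ‖T y‖⁻¹ • T y‖ ≤ 2 * ‖T x‖⁻¹ * ‖T x - T y‖ :=
        seminorm_normalize_sub_le (normSeminorm ℝ X) hTx (h.norm_mem_Ioc hy).1
    _ ≤ 2 * C * bmNorm T q (x - y) := by gcongr

theorem bmNorm_sub_le_norm_normalize (h : IsMeasureRep μ T q C) (hx : x ∈ bmUnitSphere T q)
    (hy : y ∈ bmUnitSphere T q) :
    bmNorm T q (x - y) ≤ 2 * C * ‖‖T x‖⁻¹ • T x - ‖T y‖⁻¹ • T y‖ := by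
  have hr := h.isConcaveRep
  let p : Seminorm ℝ (boundedMeasurable Ω) := hr.concaveSeminorm
  let x' : boundedMeasurable Ω := ⟨x, hx.1.1⟩
  let y' : boundedMeasurable Ω := ⟨y, hy.1.1⟩
  -- `x` and `y` are the `bmNorm`-normalizations of `u` and `v`.
  let u := ‖T x‖⁻¹ • x'
  let v := ‖T y‖⁻¹ • y'
  obtain ⟨hTx0, hTx1⟩ := h.norm_mem_Ioc hx
  have hTy0 := (h.norm_mem_Ioc hy).1
  have hpu : p u = ‖T x‖⁻¹ := by
    rw [map_smul_eq_mul, norm_inv, norm_norm, show p x' = 1 from hx.2, mul_one]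
  have hpv : p v = ‖T y‖⁻¹ := by
    rw [map_smul_eq_mul, norm_inv, norm_norm, show p y' = 1 from hy.2, mul_one]
  have huv := seminorm_normalize_sub_le p (hpu ▸ inv_pos.2 hTx0) (hpv ▸ inv_pos.2 hTy0)
  rw [hpu, hpv, inv_inv, inv_inv, smul_inv_smul₀ hTx0.ne', smul_inv_smul₀ hTy0.ne'] at huv
  have hT : p (u - v) ≤ C * ‖‖T x‖⁻¹ • T x - ‖T y‖⁻¹ • T y‖ := by
    rw [← map_smul, ← map_smul, ← map_sub]
    exact hr.concaveNorm_le (u - v).2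
  calc bmNorm T q (x - y) ≤ 2 * ‖T x‖ * p (u - v) := huv
    _ ≤ 2 * 1 * (C * ‖‖T x‖⁻¹ • T x - ‖T y‖⁻¹ • T y‖) := by gcongr
    _ = _ := by ring

theorem exists_norm_normalize_sub_lt [IsProbabilityMeasure μ] (h : IsMeasureRep μ T q C) {u : X}
    (hu : ‖u‖ = 1) {ε : ℝ} (hε : 0 < ε) :
    ∃ x ∈ bmUnitSphere T q, ‖‖T x‖⁻¹ • T x - u‖ < ε := by
  obtain ⟨_, ⟨x, hx, rfl⟩, -, hxu⟩ :=
    exists_mem_norm_normalize_sub_lt h.dense_image_boundedUnits hu hε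
  refine ⟨_, h.inv_smul_mem_bmUnitSphere hx, ?_⟩
  have hN := h.bmNorm_pos hx
  rwa [map_smul, norm_smul, norm_inv, Real.norm_of_nonneg hN.le, mul_inv, inv_inv, smul_smul,
    mul_right_comm, mul_inv_cancel₀ hN.ne', one_mul]

theorem exists_norm_toLp_withSign_sub_lt [IsProbabilityMeasure μ] (h : IsMeasureRep μ T q C)
    {g : Lp ℝ 2 μ} (hg : ‖g‖ = 1) {ε : ℝ} (hε : 0 < ε) :
    ∃ x, ∃ hx : x ∈ bmUnitSphere T q, ∀ (ρ : Ω → ℝ) (hρ : IsNormingDensity μ T q x ρ),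
      ‖(hρ.memLp_withSign_sqrt hx.1.1.1).toLp _ - g‖ < ε := by
  obtain ⟨f, hf, hf1, hfg⟩ := exists_boundedMeasurable_norm_toLp_eq_one hg (half_pos hε)
  obtain ⟨x, hx, hxf⟩ := h.exists_norm_toLp_withSign_sub_le hf _ hf1 (half_pos hε)
  exact ⟨x, hx, fun ρ hρ => (norm_sub_le_norm_sub_add_norm_sub _ _ _).trans_lt
    ((add_lt_add_of_le_of_lt (hxf ρ hρ) hfg).trans_eq (add_halves ε))⟩

theorem norm_toLp_withSign_sqrt_sub_le (h : IsMeasureRep μ T q C)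
    (hρ : IsNormingDensity μ T q x ρ) (hσ : IsNormingDensity μ T q y σ)
    (hx : x ∈ bmUnitSphere T q) (hy : y ∈ bmUnitSphere T q) :
    ‖(hρ.memLp_withSign_sqrt hx.1.1.1).toLp _ - (hσ.memLp_withSign_sqrt hy.1.1.1).toLp _‖ ≤
      √(2 * ((2 * 2 ^ q + 6) * √(2 * C * ‖‖T x‖⁻¹ • T x - ‖T y‖⁻¹ • T y‖))) := by
  refine Real.le_sqrt_of_sq_le ((hρ.norm_toLp_withSign_sqrt_sub_sq_le hσ hx.1.1.1
    hy.1.1.1).trans ?_)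
  gcongr
  refine (hρ.integral_abs_withSign_sub_le hσ h hx.1 hy.1).trans ?_
  gcongr
  exact h.bmNorm_sub_le_norm_normalize hx hy

theorem norm_normalize_sub_le_norm_toLp (h : IsMeasureRep μ T q C)
    (hρ : IsNormingDensity μ T q x ρ) (hσ : IsNormingDensity μ T q y σ)
    (hx : x ∈ bmUnitSphere T q) (hy : y ∈ bmUnitSphere T q) {d : ℝ}
    (hd : ‖(hρ.memLp_withSign_sqrt hx.1.1.1).toLp _ -
      (hσ.memLp_withSign_sqrt hy.1.1.1).toLp _‖ = d) :
    ‖‖T x‖⁻¹ • T x - ‖T y‖⁻¹ • T y‖ ≤ 8 * C * (2 * d + √(2 * d)) ^ (1 / q) := by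
  have hC : 0 ≤ C := zero_le_one.trans h.isConcaveRep.one_le_C
  have hΔ := hρ.integral_abs_withSign_sub_le_norm hσ hx.1.1.1 hy.1.1.1
  rw [hd] at hΔ
  calc ‖‖T x‖⁻¹ • T x - ‖T y‖⁻¹ • T y‖ ≤ 2 * C * bmNorm T q (x - y) :=
        h.norm_normalize_sub_le_bmNorm hx hy
    _ ≤ 2 * C * (4 * (2 * d + √(2 * d)) ^ (1 / q)) := by
        gcongr
        refine (hρ.bmNorm_sub_le hσ h hx.1 hy.1 hx.2 hy.2).trans ?_
        have hq : 0 ≤ 1 / q := one_div_nonneg.2 h.isConcaveRep.q_pos.le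
        gcongr
    _ = 8 * C * (2 * d + √(2 * d)) ^ (1 / q) := by ring

theorem exists_uniformEquiv_sphere_Lp [IsProbabilityMeasure μ] [CompleteSpace X]
    {C : ℝ≥0} (h : IsMeasureRep μ T q C) :
    ∃ F : sphere (0 : X) 1 ≃ᵤ sphere (0 : Lp ℝ 2 μ) 1,
      IsModulusOfContinuity (sphereModulus q C) F ∧
        IsModulusOfContinuity (sphereModulus q C) F.symm := by
  have hq := h.isConcaveRep.q_pos
  choose ρ hρ using fun x : bmUnitSphere T q => h.exists_isNormingDensity x.2.1.1 x.2.2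
  let i : bmUnitSphere T q → sphere (0 : X) 1 := fun x => ⟨‖T x.1‖⁻¹ • T x.1,
    mem_sphere_zero_iff_norm.2
      (norm_smul_inv_norm (𝕜 := ℝ) (norm_pos_iff.1 (h.norm_mem_Ioc x.2).1))⟩
  let j : bmUnitSphere T q → sphere (0 : Lp ℝ 2 μ) 1 := fun x =>
    ⟨((hρ x).memLp_withSign_sqrt x.2.1.1.1).toLp _,
      mem_sphere_zero_iff_norm.2 ((hρ x).norm_toLp_withSign_sqrt x.2.1.1.1)⟩
  have hi : DenseRange i := Metric.denseRange_iff.2 fun u ε hε => by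
    obtain ⟨x, hx, hxu⟩ := h.exists_norm_normalize_sub_lt (mem_sphere_zero_iff_norm.1 u.2) hε
    refine ⟨⟨x, hx⟩, ?_⟩
    rwa [dist_comm, Subtype.dist_eq, dist_eq_norm]
  have hj : DenseRange j := Metric.denseRange_iff.2 fun g ε hε => by
    obtain ⟨x, hx, hxg⟩ := h.exists_norm_toLp_withSign_sub_lt (mem_sphere_zero_iff_norm.1 g.2) hε
    refine ⟨⟨x, hx⟩, ?_⟩
    rw [dist_comm, Subtype.dist_eq, dist_eq_norm]
    exact hxg _ (hρ ⟨x, hx⟩)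
  have := isClosed_sphere (x := (0 : X)) (ε := 1).completeSpace_coe
  have := isClosed_sphere (x := (0 : Lp ℝ 2 μ)) (ε := 1).completeSpace_coe
  refine exists_uniformEquiv_of_denseRange hi hj (continuous_sphereModulus hq C)
    (sphereModulus_zero hq C) (continuous_sphereModulus hq C) (sphereModulus_zero hq C)
    (fun x y => le_add_right ?_) fun x y => le_add_left ?_
  · refine NNReal.le_toNNReal_of_coe_le ?_
    rw [coe_nndist, coe_nndist, Subtype.dist_eq, Subtype.dist_eq, dist_eq_norm, dist_eq_norm]
    exact h.norm_toLp_withSign_sqrt_sub_le (hρ x) (hρ y) x.2 y.2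
  · refine NNReal.le_toNNReal_of_coe_le ?_
    rw [coe_nndist, coe_nndist, Subtype.dist_eq, Subtype.dist_eq, dist_eq_norm, dist_eq_norm]
    exact h.norm_normalize_sub_le_norm_toLp (hρ x) (hρ y) x.2 y.2 rfl

end IsMeasureRep

theorem exists_uniformEquiv_sphere_l2 (X : Type*) [NormedAddCommGroup X] [NormedSpace ℝ X]
    [CompleteSpace X] [Lattice X] [IsOrderedAddMonoid X] [HasSolidNorm X] [IsOrderedModule ℝ X]
    [TopologicalSpace.SeparableSpace X] (hX : ¬FiniteDimensional ℝ X) {q : ℝ} (hq : 1 ≤ q)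
    {C : ℝ≥0} (hC1 : 1 ≤ C) (hC : IsConcaveWith q X C) :
    ∃ F : sphere (0 : X) 1 ≃ᵤ sphere (0 : lp (fun _ : ℕ => ℝ) 2) 1,
      IsModulusOfContinuity (sphereModulus q C) F ∧
        IsModulusOfContinuity (sphereModulus q C) F.symm := by
  have hnontrivial : ∀ {E : Type _} [NormedAddCommGroup E] [NormedSpace ℝ E],
      ¬FiniteDimensional ℝ E → Nontrivial E := fun hE =>
    not_subsingleton_iff_nontrivial.1 fun _ => hE inferInstance
  have := hnontrivial hX
  obtain ⟨Ω, _, μ, _, T, h⟩ := exists_isMeasureRep X hq hC1 hC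
  obtain ⟨F, hF, hFsymm⟩ := h.exists_uniformEquiv_sphere_Lp
  have hL : ¬FiniteDimensional ℝ (Lp ℝ 2 μ) := fun hfin => by
    have := FiniteDimensional.proper ℝ (Lp ℝ 2 μ)
    have : CompactSpace (sphere (0 : X) 1) := F.toHomeomorph.symm.compactSpace
    exact hX (finiteDimensional_of_isCompact_sphere (isCompact_iff_compactSpace.2 this))
  have := hnontrivial hL
  have : SecondCountableTopology X := UniformSpace.secondCountable_of_separable X
  have : TopologicalSpace.SeparableSpace (sphere (0 : Lp ℝ 2 μ) 1) :=
    F.surjective.denseRange.separableSpace F.continuous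
  have := separableSpace_of_sphere (E := Lp ℝ 2 μ)
  obtain ⟨e⟩ := nonempty_linearIsometryEquiv_l2 hL
  let G := sphereIsometryEquiv e
  exact ⟨F.trans ⟨G.toEquiv, G.isometry.uniformContinuous, G.symm.isometry.uniformContinuous⟩,
    hF.isometry_comp G.isometry, hFsymm.comp_isometry G.symm.isometry⟩

theorem IsConcaveWith.of_concavityConstant_eq {X : Type*} [NormedAddCommGroup X]
    [NormedSpace ℝ X] [CompleteSpace X] [Lattice X] [IsOrderedAddMonoid X] [HasSolidNorm X]
    [IsOrderedModule ℝ X] {q : ℝ} {M : ℝ≥0} (h : concavityConstant q X = M) :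
    IsConcaveWith q X (M + 1) := by
  have hlt : concavityConstant q X < ((M + 1 : ℝ≥0) : ℝ≥0∞) := by
    rw [h, ENNReal.coe_lt_coe]
    exact lt_add_of_pos_right _ one_pos
  simp only [concavityConstant, iInf_lt_iff] at hlt
  obtain ⟨C, hC, hCM⟩ := hlt
  exact fun n x => (hC n x).trans (mul_le_mul_of_nonneg_right
    (NNReal.coe_le_coe.2 (ENNReal.coe_lt_coe.1 hCM).le) (norm_nonneg _))

end Assembly

theorem theorem2p2 (q q' : ℝ) (hq : 1 ≤ q) (hq' : 1 ≤ q') (M M' : ℝ≥0) :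
    ∃ α : ℝ≥0 → ℝ≥0,
      ∀ (X : Type*) [NormedAddCommGroup X] [NormedSpace ℝ X] [CompleteSpace X]
        [Lattice X] [IsOrderedAddMonoid X] [HasSolidNorm X] [IsOrderedModule ℝ X]
        (Y : Type*) [NormedAddCommGroup Y] [NormedSpace ℝ Y] [CompleteSpace Y]
        [Lattice Y] [IsOrderedAddMonoid Y] [HasSolidNorm Y] [IsOrderedModule ℝ Y],
        TopologicalSpace.SeparableSpace X → TopologicalSpace.SeparableSpace Y →
        ¬ FiniteDimensional ℝ X → ¬ FiniteDimensional ℝ Y →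
        concavityConstant q X = M → concavityConstant q' Y = M' →
        ∃ F : Metric.sphere (0 : X) 1 ≃ᵤ Metric.sphere (0 : Y) 1,
          IsModulusOfContinuity α F ∧ IsModulusOfContinuity α F.symm := by
  have hq0 : 0 < q := one_pos.trans_le hq
  have hq0' : 0 < q' := one_pos.trans_le hq'
  let φ := sphereModulus q (M + 1)
  let ψ := sphereModulus q' (M' + 1)
  have hα : Continuous (ψ ∘ φ + φ ∘ ψ) :=
    have hφ : Continuous φ := continuous_sphereModulus hq0 _
    have hψ : Continuous ψ := continuous_sphereModulus hq0' _
    (hψ.comp hφ).add (hφ.comp hψ)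
  have hα0 : (ψ ∘ φ + φ ∘ ψ) 0 = 0 := by
    simp [φ, ψ, sphereModulus_zero hq0, sphereModulus_zero hq0']
  refine ⟨ψ ∘ φ + φ ∘ ψ, ?_⟩
  intro X _ _ _ _ _ _ _ Y _ _ _ _ _ _ _ _ _ hX hY hMX hMY
  obtain ⟨F, hF, hFsymm⟩ := exists_uniformEquiv_sphere_l2 X hX hq
    (le_add_of_nonneg_left zero_le) (.of_concavityConstant_eq hMX)
  obtain ⟨G, hG, hGsymm⟩ := exists_uniformEquiv_sphere_l2 Y hY hq'
    (le_add_of_nonneg_left zero_le) (.of_concavityConstant_eq hMY)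
  exact ⟨F.trans G.symm,
    (hGsymm.comp hF (monotone_sphereModulus hq0' _)).mono hα hα0 (le_add_of_nonneg_right zero_le),
    (hFsymm.comp hG (monotone_sphereModulus hq0 _)).mono hα hα0 (le_add_of_nonneg_left zero_le)⟩
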